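/- \textbf{Setting.} Fix $d$ and the label set $S=\{1,\dots,d\}$. A combinatorial type $\pi$ of a labelled interval exchange with $d$ bands is a pair of words in $S$, the top row and the bottom row, in which every label occurs exactly twice in total; the rows record the ends of the bands met from left to right on the two sides of a thickened horizontal interval. A band is orientation reversing if both its ends lie in the same row; let $S_t$, $S_b$ be the sets of bands with both ends on the top, respectively on the bottom. The switch condition on widths $\lambda\in\mathbb R^d$ is $\sum_{\alpha\in S_t}\lambda_\alpha=\sum_{\alpha\in S_b}\lambda_\alpha$; $\pi$ is recurrent if it has a solution with all $\lambda_\alpha>0$. The type is \emph{complete} if every boundary curve of the oriented ribbon surface formed by the thickened interval and the bands has exactly one or three cusps, a cusp being the gap between two consecutive ends of a row (so that gluing in once-punctured discs and discs embeds the track in an oriented surface with all complementary regions once-punctured monogons or ideal triangles). A \emph{non-classical interval exchange} is one whose type is recurrent and complete. Its configuration space is $W=\{\lambda\in\mathbb R_{\ge0}^d:\sum_\alpha\lambda_\alpha=1,\ \lambda\text{ satisfies the switch condition}\}$. \textbf{Rauzy induction.} Let $\alpha,\beta$ be the last labels of the two rows (the critical positions), named so that $\lambda_\alpha>\lambda_\beta$.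 Then $\lambda_\alpha$ is replaced by $\lambda_\alpha-\lambda_\beta$, the other widths are unchanged, and the critical end of $\beta$ is removed from its row and inserted next to the other end of $\alpha$: immediately to its right if $\alpha$ joins top to bottom, immediately to its left if $\alpha$ is orientation reversing. The old and new widths satisfy $\lambda=E\lambda'$ with $E=I+M_{\alpha\beta}$, where $M_{\alpha\beta}$ has a single nonzero entry, equal to $1$, at $(\alpha,\beta)$. There is no step if the two critical widths are equal. The expansion of $\mathbf x\in W_0$ from a type $\pi_0$ with configuration space $W_0$ is obtained by iterating this from $(\pi_0,\mathbf x)$; if the first $n$ steps have matrices $E_1,\dots,E_n$, the $n$-th stage has matrix $Q_{\mathbf x,n}=E_1\cdots E_n$. For $C>1$, the stage is \emph{$C$-distributed} if the columns $Q(\gamma)$, $\gamma\in S$, of its matrix $Q$ satisfy $\frac1C<\frac{|Q(\gamma)|}{|Q(\gamma')|}<C$ for all $\gamma,\gamma'\in S$, where $|\mathbf y|=\sum_i|y_i|$. The reduced Rauzy diagram has as nodes the types of non-classical interval exchanges with $d$ bands up to relabelling, with an arrow from $\pi$ to $\pi'$ if $\pi'$ results from $\pi$ by one step of Rauzy induction.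 A \emph{sink} is a set of nodes which no arrow leaves and in which every node is joined to every node, itself included, by a directed path with at least one arrow. \textbf{Theorem.} For every $d$ there is a constant $C>1$, depending only on $d$, such that for every type $\pi_0$ of a labelled non-classical interval exchange with $d$ bands whose node lies in a sink of the reduced Rauzy diagram, with configuration space $W_0$, the following holds. For almost every $\mathbf x\in W_0$, with respect to the $(d-2)$-dimensional Lebesgue measure on $W_0$, the expansion of $\mathbf x$ is infinite and its $n$-th stage is $C$-distributed for infinitely many $n$. -/

import Mathlib

open MeasureTheory

/-- A combinatorial type of labelled interval exchange with `d` bands: the labels of the band ends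
met along the top and along the bottom interval, from left to right. Every band has two ends. The
critical positions are the last entries of the two rows. -/
@[ext]
structure CombType (d : ℕ) where
  top : List (Fin d)
  bot : List (Fin d)
  two_ends : ∀ a : Fin d, (top ++ bot).count a = 2

namespace CombType

variable {d : ℕ}

/-- The top row (`true`) or the bottom row (`false`). -/
def row (p : CombType d) : Bool → List (Fin d)
  | true => p.top
  | false => p.bot

/-- Labels of the orientation reversing bands on the top (both ends are on the top). -/
def revTop (p : CombType d) : Finset (Fin d) :=
  Finset.univ.filter fun a => p.top.count a = 2

/-- Labels of the orientation reversing bands on the bottom (both ends are on the bottom). -/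
def revBot (p : CombType d) : Finset (Fin d) :=
  Finset.univ.filter fun a => p.bot.count a = 2

/-- The switch condition on the widths of the bands. -/
def SwitchCondition (p : CombType d) (w : Fin d → ℝ) : Prop :=
  ∑ a ∈ p.revTop, w a = ∑ a ∈ p.revBot, w a

/-- Strictly positive widths satisfying the switch condition exist. -/
def Recurrent (p : CombType d) : Prop :=
  ∃ w : Fin d → ℝ, (∀ a, 0 < w a) ∧ p.SwitchCondition w

/-! ### Complementary regions

Thicken the train track to the oriented ribbon surface made of the thickened interval and the bands.
Its boundary is cut into the long sides of the bands, the cusps (between consecutive ends of a row),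
and the two smooth vertical ends of the thickened interval. -/

/-- The left (`right = false`) or right (`right = true`) corner of the band end at position `pos`
of a row. -/
structure Corner where
  row : Bool
  pos : ℕ
  right : Bool

/-- The corner belongs to an existing band end. -/
def ValidCorner (p : CombType d) (s : Corner) : Prop :=
  s.pos < (p.row s.row).length

/-- `s` and `t` are joined by a long side of a band. A band from top to bottom joins left to left
and right to right, an orientation reversing band joins left to right. -/
def BandJoined (p : CombType d) (s t : Corner) : Prop :=
  ∃ a : Fin d, (p.row s.row)[s.pos]? = some a ∧ (p.row t.row)[t.pos]? = some a ∧
    ((s.row ≠ t.row ∧ s.right = t.right) ∨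
      (s.row = t.row ∧ s.pos ≠ t.pos ∧ s.right ≠ t.right))

/-- `s` and `t` meet in a cusp between two consecutive ends of the same row. -/
def CuspJoined (p : CombType d) (s t : Corner) : Prop :=
  p.ValidCorner s ∧ p.ValidCorner t ∧ s.row = t.row ∧ t.pos = s.pos + 1 ∧
    s.right = true ∧ t.right = false

/-- `s` and `t` are joined by the left or by the right vertical end of the thickened interval. -/
def EndJoined (p : CombType d) (s t : Corner) : Prop :=
  p.ValidCorner s ∧ p.ValidCorner t ∧ s.row ≠ t.row ∧
    ((s.pos = 0 ∧ t.pos = 0 ∧ s.right = false ∧ t.right = false) ∨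
      (s.pos + 1 = (p.row s.row).length ∧ t.pos + 1 = (p.row t.row).length ∧
        s.right = true ∧ t.right = true))

/-- The two corners lie on the same boundary curve of the ribbon surface. -/
def SameBoundary (p : CombType d) : Corner → Corner → Prop :=
  Relation.EqvGen fun s t => p.BandJoined s t ∨ p.CuspJoined s t ∨ p.EndJoined s t

/-- The cusps on the boundary curve through `s`; the cusp `(r, i)` lies in row `r` between the ends
at positions `i` and `i + 1`. -/
def cuspsAt (p : CombType d) (s : Corner) : Set (Bool × ℕ) :=
  {c | c.2 + 1 < (p.row c.1).length ∧ p.SameBoundary s ⟨c.1, c.2, true⟩}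

/-- Every boundary curve has one or three cusps: gluing in once punctured discs and discs
respectively embeds the track in an oriented surface with all complementary regions once punctured
monogons or ideal triangles. -/
def Complete (p : CombType d) : Prop :=
  ∀ s : Corner, p.ValidCorner s → (p.cuspsAt s).ncard = 1 ∨ (p.cuspsAt s).ncard = 3

/-- Combinatorial type of a non-classical interval exchange. -/
def NonClassical (p : CombType d) : Prop :=
  p.Recurrent ∧ p.Complete

/-- The configuration space: normalized non-negative widths satisfying the switch condition. -/
def configSpace (p : CombType d) : Set (EuclideanSpace ℝ (Fin d)) :=
  {x | (∀ a, 0 ≤ x a) ∧ ∑ a, x a = 1 ∧ p.SwitchCondition fun a => x a}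

/-! ### Rauzy induction -/

/-- `Split p a b q`: in `p` the bands `a` and `b` occupy the two critical positions, and `q` is the
type obtained by Rauzy induction when `a` is the wider one. The critical end of `b` is moved next to
the non-critical end of `a`: to its right if `a` joins top to bottom, and to its left if `a` is
orientation reversing. -/
inductive Split (p : CombType d) (a b : Fin d) (q : CombType d) : Prop
  | topPreserving (u v w : List (Fin d))
      (ht : p.top = u ++ [a]) (hb : p.bot = v ++ [a] ++ w ++ [b])
      (ht' : q.top = u ++ [a]) (hb' : q.bot = v ++ [a, b] ++ w)
  | topReversing (u v w : List (Fin d))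
      (ht : p.top = u ++ [a] ++ v ++ [a]) (hb : p.bot = w ++ [b])
      (ht' : q.top = u ++ [b, a] ++ v ++ [a]) (hb' : q.bot = w)
  | botPreserving (u v w : List (Fin d))
      (hb : p.bot = u ++ [a]) (ht : p.top = v ++ [a] ++ w ++ [b])
      (hb' : q.bot = u ++ [a]) (ht' : q.top = v ++ [a, b] ++ w)
  | botReversing (u v w : List (Fin d))
      (hb : p.bot = u ++ [a] ++ v ++ [a]) (ht : p.top = w ++ [b])
      (hb' : q.bot = u ++ [b, a] ++ v ++ [a]) (ht' : q.top = w)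

/-! ### The reduced Rauzy diagram -/

/-- `p` and `q` differ only by the labelling of the bands. -/
def SameUnlabelled (p q : CombType d) : Prop :=
  ∃ σ : Equiv.Perm (Fin d), q.top = p.top.map σ ∧ q.bot = p.bot.map σ

theorem sameUnlabelled_equivalence : Equivalence (SameUnlabelled (d := d)) where
  refl p := ⟨1, by simp, by simp⟩
  symm := by
    rintro p q ⟨σ, h1, h2⟩
    exact ⟨σ.symm, by simp [h1], by simp [h2]⟩
  trans := by
    rintro p q r ⟨σ, h1, h2⟩ ⟨τ, h3, h4⟩
    exact ⟨σ.trans τ, by simp [h1, h3], by simp [h2, h4]⟩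

end CombType

/-- Labelled types of non-classical interval exchanges up to relabelling. -/
def nonClassicalSetoid (d : ℕ) : Setoid {p : CombType d // p.NonClassical} where
  r p q := CombType.SameUnlabelled p.1 q.1
  iseqv := ⟨fun p => CombType.sameUnlabelled_equivalence.refl p.1,
    fun h => CombType.sameUnlabelled_equivalence.symm h,
    fun h k => CombType.sameUnlabelled_equivalence.trans h k⟩

/-- The nodes of the reduced Rauzy diagram: unlabelled combinatorial types of non-classical
interval exchanges with `d` bands. -/
abbrev RauzyNode (d : ℕ) : Type := Quotient (nonClassicalSetoid d)

/-- The node of a non-classical labelled type. -/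
def rauzyNode {d : ℕ} (p : CombType d) (hp : p.NonClassical) : RauzyNode d :=
  Quotient.mk (nonClassicalSetoid d) ⟨p, hp⟩

/-- The arrows of the reduced Rauzy diagram. -/
def RauzyArrow {d : ℕ} (P Q : RauzyNode d) : Prop :=
  ∃ (p q : CombType d) (hp : p.NonClassical) (hq : q.NonClassical) (a b : Fin d),
    rauzyNode p hp = P ∧ rauzyNode q hq = Q ∧ p.Split a b q

/-- A sink: a set of nodes which no arrow leaves and in which any node is joined to any node by a
directed path with at least one arrow. -/
def IsSink {d : ℕ} (G₀ : Set (RauzyNode d)) : Prop :=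
  (∀ P ∈ G₀, ∀ Q ∈ G₀, Relation.TransGen RauzyArrow P Q) ∧
    ∀ P ∈ G₀, ∀ Q, RauzyArrow P Q → Q ∈ G₀

/-! ### Expansions -/

/-- A stage of an expansion: the combinatorial type, the actual (unnormalized) widths of the bands,
and the matrix expressing the initial widths through the actual ones. -/
structure Stage (d : ℕ) where
  type : CombType d
  width : Fin d → ℝ
  mat : Matrix (Fin d) (Fin d) ℝ

/-- One step of Rauzy induction: the wider critical band `a` loses the width of the other critical
band `b`, and the matrix is multiplied on the right by the elementary matrix `1 + M_{a b}`. There is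
no step when the two critical bands have equal width. -/
def Stage.Next {d : ℕ} (s t : Stage d) : Prop :=
  ∃ a b : Fin d, s.width b < s.width a ∧ s.type.Split a b t.type ∧
    t.width = Function.update s.width a (s.width a - s.width b) ∧
    t.mat = s.mat * (1 + Matrix.single a b (1 : ℝ))

/-- `s` is the infinite expansion by Rauzy induction of the point `x`, starting at the type `p`. -/
def IsExpansion {d : ℕ} (p : CombType d) (x : EuclideanSpace ℝ (Fin d)) (s : ℕ → Stage d) : Prop :=
  s 0 = ⟨p, fun a => x a, 1⟩ ∧ ∀ n, (s n).Next (s (n + 1))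

/-- The norm `|y| = ∑ |y_i|`. -/
def l1norm {d : ℕ} (y : Fin d → ℝ) : ℝ := ∑ i, |y i|

/-- A family of vectors is `C`-distributed if all ratios of norms lie strictly between `1 / C`
and `C`. -/
def CDistributed {ι : Type*} {d : ℕ} (C : ℝ) (u : ι → Fin d → ℝ) : Prop :=
  ∀ i j, 1 / C < l1norm (u i) / l1norm (u j) ∧ l1norm (u i) / l1norm (u j) < C

/-- A stage is `C`-distributed if the columns of its matrix are. -/
def Stage.IsCDistributed {d : ℕ} (C : ℝ) (s : Stage d) : Prop :=
  CDistributed C fun j : Fin d => s.mat.col j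

/-! Normalisation is dropped: points range over the cone on the configuration space inside the
switch hyperplane, with Lebesgue measure cut off at total width one (`coneMeasure`). A finite piece
of an expansion is a type with its integer matrix (`RState`). The points which follow it form an
open cone (`cell`), and these cones form a binary tree up to null sets (`cellTree`). If from every
cell a stage with comparable columns is reached on a fixed fraction ε of the cell, then the missed
part has measure at most 1 - ε times itself, so it is null (`CellTree.measure_diff_hits_eq_zero`).
Since there are countably many cells, such stages then recur infinitely often
(`exists_ae_frequently_bal`).

The uniform fraction comes from an induction on the number of columns of norm at least `M` while all
columns stay below `C * M` (`Bal`); it starts with the largest column. The tool is the identity that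
the total width is the sum of column norm times width (`Valid.sum_eq`), so a band with a large
column is thin. Let `J` be the set of large columns. A bounded number of steps, each with a loser in
`J`, makes a band outside `J` critical (`Escape`); each step has probability bounded below, because
the thin loser is beaten after a translation of bounded cost (`measureReal_child_ge`). Next, with
probability at least 1/2 no band of `J` is much thinner than 1 / `M` (`measureReal_thin_le`). From
there, as long as no column outside `J` reaches `M`, only bands outside `J` win. The widths in `J`
are then frozen, which bounds the columns of `J`, and some band of `J` must eventually win, so a new
large column appears (`RPath.exists_bal`).

This needs every band to win infinitely often along a generic path (`RauzySeq.frequently_wins`).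
Otherwise the two rows eventually split into an initial block of bands which neither win nor lose
and a final block of bands whose widths tend to zero. The switch condition then holds on the initial
block alone, and genericity leaves one of the blocks without orientation reversing bands. A parity
count of cusps on the boundary curve through the outer end of such a block contradicts completeness
(`Complete.no_initial_block`, `Complete.no_final_block`), which Rauzy induction preserves
(`Complete.split`).

A sink provides types closed under Rauzy induction whose critical bands can have different widths
(`IsSink.sinkSet`). Homogeneity and Fubini carry the result from the cone to the slice of total
width one (`ae_configSpace_of_ae`). There are finitely many types, hence one constant for each `d`.
-/

namespace CombType

/-! ### The switch condition as a signed sum, and Rauzy induction with the winner's row as a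
parameter. -/

variable {d : ℕ}

/-- `1` on the bands reversing on the top, `-1` on those reversing on the bottom, `0` on the others. -/
def sgn (p : CombType d) (a : Fin d) : ℤ := p.top.count a - 1

theorem count_add_count (p : CombType d) (r : Bool) (a : Fin d) :
    (p.row r).count a + (p.row !r).count a = 2 := by
  have := p.two_ends a
  rw [List.count_append] at this
  cases r <;> simp [row] <;> omega

theorem sgn_eq_ite (p : CombType d) (a : Fin d) :
    p.sgn a = (if a ∈ p.revTop then 1 else 0) - (if a ∈ p.revBot then 1 else 0) := by
  have h := p.count_add_count true a
  simp only [row, Bool.not_true] at h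
  simp only [revTop, revBot, Finset.mem_filter, Finset.mem_univ, true_and, sgn]
  split_ifs <;> omega

theorem switchCondition_iff (p : CombType d) (w : Fin d → ℝ) :
    p.SwitchCondition w ↔ ∑ a, (p.sgn a : ℝ) * w a = 0 := by
  have h : ∑ a, (p.sgn a : ℝ) * w a = ∑ a ∈ p.revTop, w a - ∑ a ∈ p.revBot, w a := by
    simp only [sgn_eq_ite, Int.cast_sub, sub_mul, Finset.sum_sub_distrib, Int.cast_ite,
      Int.cast_one, Int.cast_zero, ite_mul, one_mul, zero_mul, Finset.sum_ite_mem,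
      Finset.univ_inter]
  rw [SwitchCondition, h, sub_eq_zero]

/-- The four cases of `Split` with the row of the winner as a parameter. -/
inductive SplitForm (p : CombType d) (r : Bool) (a b : Fin d) (q : CombType d) : Prop
  | preserving (u v w : List (Fin d))
      (h1 : p.row r = u ++ [a]) (h2 : p.row (!r) = v ++ [a] ++ w ++ [b])
      (h1' : q.row r = u ++ [a]) (h2' : q.row (!r) = v ++ [a, b] ++ w)
  | reversing (u v w : List (Fin d))
      (h1 : p.row r = u ++ [a] ++ v ++ [a]) (h2 : p.row (!r) = w ++ [b])
      (h1' : q.row r = u ++ [b, a] ++ v ++ [a]) (h2' : q.row (!r) = w)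

theorem split_iff {p q : CombType d} {a b : Fin d} :
    p.Split a b q ↔ ∃ r, p.SplitForm r a b q := by
  constructor
  · rintro (⟨u, v, w, h1, h2, h3, h4⟩ | ⟨u, v, w, h1, h2, h3, h4⟩ | ⟨u, v, w, h1, h2, h3, h4⟩ |
      ⟨u, v, w, h1, h2, h3, h4⟩)
    · exact ⟨true, .preserving u v w h1 h2 h3 h4⟩
    · exact ⟨true, .reversing u v w h1 h2 h3 h4⟩
    · exact ⟨false, .preserving u v w h1 h2 h3 h4⟩
    · exact ⟨false, .reversing u v w h1 h2 h3 h4⟩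
  · rintro ⟨r | r, ⟨u, v, w, h1, h2, h3, h4⟩ | ⟨u, v, w, h1, h2, h3, h4⟩⟩
    · exact .botPreserving u v w h1 h2 h3 h4
    · exact .botReversing u v w h1 h2 h3 h4
    · exact .topPreserving u v w h1 h2 h3 h4
    · exact .topReversing u v w h1 h2 h3 h4

theorem SplitForm.ne {p q : CombType d} {r : Bool} {a b : Fin d} (h : p.SplitForm r a b q) :
    a ≠ b := by
  rintro rfl
  have hc := p.count_add_count r a
  rcases h with ⟨u, v, w, h1, h2, -, -⟩ | ⟨u, v, w, h1, h2, -, -⟩ <;>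
    simp [h1, h2] at hc <;> omega

/-- The moved end of the loser changes row exactly when the winner is orientation reversing, and
then it joins the winner's row. This is dual to the substitution of widths, so the switch condition
is carried along. -/
theorem SplitForm.sgn_eq {p q : CombType d} {r : Bool} {a b : Fin d} (h : p.SplitForm r a b q)
    (c : Fin d) : q.sgn c = p.sgn c + if c = b then p.sgn a else 0 := by
  have hab := h.ne
  have hc := p.count_add_count r a
  rcases h with ⟨u, v, w, h1, h2, h3, h4⟩ | ⟨u, v, w, h1, h2, h3, h4⟩ <;> cases r <;>
    simp only [row, Bool.not_true, Bool.not_false] at h1 h2 h3 h4 hc <;>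
    simp only [sgn, h1, h2, h3, h4, List.count_append, List.count_cons, List.count_nil] at hc ⊢ <;>
    by_cases hcb : c = b <;> by_cases hca : c = a <;> simp_all <;> grind

/-- The type with the given rows. -/
def ofRows (r : Bool) (x y : List (Fin d)) (h : ∀ a, x.count a + y.count a = 2) : CombType d where
  top := if r then x else y
  bot := if r then y else x
  two_ends a := by
    have := h a
    cases r <;> simp <;> omega

theorem row_ofRows (r : Bool) (x y : List (Fin d)) (h : ∀ a, x.count a + y.count a = 2) :
    (ofRows r x y h).row r = x := by
  cases r <;> simp [ofRows, row]

theorem row_not_ofRows (r : Bool) (x y : List (Fin d)) (h : ∀ a, x.count a + y.count a = 2) :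
    (ofRows r x y h).row (!r) = y := by
  cases r <;> simp [ofRows, row]

theorem exists_splitForm (p : CombType d) (r : Bool) {a b : Fin d} {x y : List (Fin d)}
    (hx : p.row r = x ++ [a]) (hy : p.row (!r) = y ++ [b]) (hab : a ≠ b) :
    ∃ q, p.SplitForm r a b q := by
  have hc := fun c => p.count_add_count r c
  simp only [hx, hy, List.count_append] at hc
  have hca := hc a
  have hmem : a ∈ x ∨ a ∈ y := by
    by_contra! h
    simp [List.count_eq_zero.2 h.1, List.count_eq_zero.2 h.2, hab.symm] at hca
  rcases hmem with h | h
  · obtain ⟨u, v, rfl⟩ := List.append_of_mem h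
    refine ⟨ofRows r (u ++ [b, a] ++ v ++ [a]) y fun c => ?_, .reversing u v y ?_ hy
      (row_ofRows _ _ _ _) (row_not_ofRows _ _ _ _)⟩
    · have := hc c
      simp only [List.count_append, List.count_cons, List.count_nil] at this ⊢
      omega
    · simp [hx]
  · obtain ⟨v, w, rfl⟩ := List.append_of_mem h
    refine ⟨ofRows r (x ++ [a]) (v ++ [a, b] ++ w) fun c => ?_, .preserving x v w hx ?_
      (row_ofRows _ _ _ _) (row_not_ofRows _ _ _ _)⟩
    · have := hc c
      simp only [List.count_append, List.count_cons, List.count_nil] at this ⊢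
      omega
    · simp [hy]

/-! ### Ends of bands -/

/-- The label of the end at position `e.2` of row `e.1`. -/
def lab (p : CombType d) (e : Bool × ℕ) : Option (Fin d) := (p.row e.1)[e.2]?

theorem _root_.List.count_eq_card_filter_range {α : Type*} [DecidableEq α] (l : List α) (a : α) :
    l.count a = ((Finset.range l.length).filter fun i => l[i]? = some a).card := by
  induction l using List.reverseRecOn with
  | nil => simp
  | append_singleton l x ih =>
    have h1 : (Finset.range l.length).filter (fun i => (l ++ [x])[i]? = some a) =
        (Finset.range l.length).filter fun i => l[i]? = some a := by
      apply Finset.filter_congr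
      intro i hi
      rw [List.getElem?_append_left (Finset.mem_range.1 hi)]
    rw [List.count_append, ih, List.length_append, List.length_singleton, Finset.range_add_one,
      Finset.filter_insert, h1]
    by_cases hx : x = a <;> simp [hx]

/-- The two ends of a band. -/
def endsOf (p : CombType d) (a : Fin d) : Finset (Bool × ℕ) :=
  (Finset.univ ×ˢ Finset.range (2 * d + 2)).filter fun e => p.lab e = some a

theorem length_add_length (p : CombType d) : p.top.length + p.bot.length = 2 * d := by
  have h : ∑ a : Fin d, (p.top ++ p.bot).count a = ∑ _a : Fin d, 2 := by simp [p.two_ends]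
  rw [← List.length_append, ← Multiset.coe_card, ← Multiset.sum_count_eq_card (s := Finset.univ)]
  · simpa [mul_comm] using h
  · simp

theorem length_row_le (p : CombType d) (r : Bool) : (p.row r).length ≤ 2 * d := by
  have := p.length_add_length
  cases r <;> simp only [row] <;> omega

theorem mem_endsOf {p : CombType d} {a : Fin d} {e : Bool × ℕ} :
    e ∈ p.endsOf a ↔ p.lab e = some a := by
  rw [endsOf, Finset.mem_filter, and_iff_right_iff_imp]
  intro h
  have h1 := p.length_row_le e.1
  have h2 := (List.getElem?_eq_some_iff.1 h).1
  exact Finset.mem_product.2 ⟨Finset.mem_univ _, Finset.mem_range.2 (by omega)⟩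

theorem card_endsOf (p : CombType d) (a : Fin d) : (p.endsOf a).card = 2 := by
  have key : ∀ r, ((p.endsOf a).filter fun e => e.1 = r).card = (p.row r).count a := by
    intro r
    rw [List.count_eq_card_filter_range]
    refine Finset.card_bij' (fun e _ => e.2) (fun i _ => (r, i)) ?_ ?_ ?_ ?_
    · rintro ⟨s, i⟩ h
      simp only [Finset.mem_filter, mem_endsOf, lab] at h
      obtain ⟨h, rfl⟩ := h
      simp only [Finset.mem_filter, Finset.mem_range]
      exact ⟨(List.getElem?_eq_some_iff.1 h).1, h⟩
    · intro i h
      simp only [Finset.mem_filter, Finset.mem_range] at h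
      simp [mem_endsOf, lab, h.2]
    · rintro ⟨s, i⟩ h
      simp only [Finset.mem_filter] at h
      simp [h.2]
    · intro i h; rfl
  have h2 := Finset.card_filter_add_card_filter_not (s := p.endsOf a) (fun e => e.1 = true)
  have h3 : (p.endsOf a).filter (fun e => ¬ e.1 = true) = (p.endsOf a).filter fun e => e.1 = false := by
    simp
  rw [h3, key, key] at h2
  have := p.count_add_count true a
  simp only [Bool.not_true] at this
  omega

theorem eq_or_eq_of_lab {p : CombType d} {a : Fin d} {e f g : Bool × ℕ} (he : p.lab e = some a)
    (hf : p.lab f = some a) (hef : e ≠ f) (hg : p.lab g = some a) : g = e ∨ g = f := by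
  have h : p.endsOf a = {e, f} := by
    symm
    apply Finset.eq_of_subset_of_card_le
    · intro x hx
      rcases Finset.mem_insert.1 hx with rfl | hx
      · exact mem_endsOf.2 he
      · rw [Finset.mem_singleton.1 hx]; exact mem_endsOf.2 hf
    · rw [card_endsOf, Finset.card_pair hef]
  have := mem_endsOf.2 hg
  rw [h] at this
  simpa using this

/-- `row ^^ right` records on which side of an end a corner lies with respect to the boundary
orientation of the thickened interval. In an oriented surface every band exchanges the two sides, so
the two kinds of bands need no separate treatment. -/
theorem bandJoined_iff {p : CombType d} {s t : Corner} :
    p.BandJoined s t ↔ ∃ a, p.lab (s.row, s.pos) = some a ∧ p.lab (t.row, t.pos) = some a ∧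
      (s.row, s.pos) ≠ (t.row, t.pos) ∧ (s.row ^^ s.right) ≠ (t.row ^^ t.right) := by
  unfold BandJoined lab
  refine exists_congr fun a => and_congr_right fun _ => and_congr_right fun _ => ?_
  rcases s with ⟨s1, s2, s3⟩
  rcases t with ⟨t1, t2, t3⟩
  by_cases h : s2 = t2 <;> cases s1 <;> cases s3 <;> cases t1 <;> cases t3 <;> simp [h]

/-! ### Boundary curves -/

theorem SameBoundary.refl (p : CombType d) (s : Corner) : p.SameBoundary s s := Relation.EqvGen.refl _

theorem SameBoundary.symm {p : CombType d} {s t : Corner} (h : p.SameBoundary s t) :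
    p.SameBoundary t s := Relation.EqvGen.symm _ _ h

theorem SameBoundary.trans {p : CombType d} {s t u : Corner} (h : p.SameBoundary s t)
    (h' : p.SameBoundary t u) : p.SameBoundary s u := Relation.EqvGen.trans _ _ _ h h'

theorem BandJoined.same {p : CombType d} {s t : Corner} (h : p.BandJoined s t) :
    p.SameBoundary s t := .rel _ _ (Or.inl h)

theorem same_cusp (p : CombType d) (x : Bool) {i : ℕ} (h : i + 1 < (p.row x).length) :
    p.SameBoundary ⟨x, i, true⟩ ⟨x, i + 1, false⟩ :=
  .rel _ _ (Or.inr (Or.inl ⟨by simp only [ValidCorner]; omega, h, rfl, rfl, rfl, rfl⟩))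

theorem same_left (p : CombType d) (h : ∀ x, 0 < (p.row x).length) (x : Bool) :
    p.SameBoundary ⟨x, 0, false⟩ ⟨!x, 0, false⟩ :=
  .rel _ _ (Or.inr (Or.inr ⟨h _, h _, by simp, Or.inl ⟨rfl, rfl, rfl, rfl⟩⟩))

theorem same_right (p : CombType d) (x : Bool) {i j : ℕ} (hi : i + 1 = (p.row x).length)
    (hj : j + 1 = (p.row !x).length) : p.SameBoundary ⟨x, i, true⟩ ⟨!x, j, true⟩ :=
  .rel _ _ (Or.inr (Or.inr ⟨by simp only [ValidCorner]; omega, by simp only [ValidCorner]; omega,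
    by simp, Or.inr ⟨hi, hj, rfl, rfl⟩⟩))

/-- A map of corners which respects the generating relations respects boundary curves. -/
theorem SameBoundary.map {p q : CombType d} {f : Corner → Corner} (r : Bool)
    (hband : ∀ s t, p.BandJoined s t → q.SameBoundary (f s) (f t))
    (hcusp : ∀ x i, i + 1 < (p.row x).length →
      q.SameBoundary (f ⟨x, i, true⟩) (f ⟨x, i + 1, false⟩))
    (hleft : q.SameBoundary (f ⟨r, 0, false⟩) (f ⟨!r, 0, false⟩))
    (hright : ∀ i j, i + 1 = (p.row r).length → j + 1 = (p.row !r).length →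
      q.SameBoundary (f ⟨r, i, true⟩) (f ⟨!r, j, true⟩))
    {s t : Corner} (h : p.SameBoundary s t) : q.SameBoundary (f s) (f t) := by
  induction h with
  | refl => exact .refl _ _
  | symm _ _ _ ih => exact ih.symm
  | trans _ _ _ _ _ ih1 ih2 => exact ih1.trans ih2
  | rel s t h =>
    rcases h with h | h | h
    · exact hband s t h
    · obtain ⟨x, i, o⟩ := s
      obtain ⟨y, j, o'⟩ := t
      obtain ⟨-, hv, h1, h2, h3, h4⟩ := h
      simp only at h1 h2 h3 h4
      subst h1 h2 h3 h4
      exact hcusp x i hv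
    · obtain ⟨x, i, o⟩ := s
      obtain ⟨y, j, o'⟩ := t
      obtain ⟨-, -, h1, h⟩ := h
      have hy : y = !x := by
        cases x <;> cases y <;> simp at h1 ⊢
      subst hy
      rcases h with ⟨h2, h3, h4, h5⟩ | ⟨h2, h3, h4, h5⟩
      · simp only at h2 h3 h4 h5
        subst h2 h3 h4 h5
        by_cases hx : x = r
        · subst hx; exact hleft
        · have : x = !r := by cases x <;> cases r <;> simp at hx ⊢
          subst this
          rw [Bool.not_not]
          exact hleft.symm
      · simp only at h2 h3 h4 h5
        subst h4 h5
        by_cases hx : x = r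
        · subst hx; exact hright i j h2 h3
        · have : x = !r := by cases x <;> cases r <;> simp at hx ⊢
          subst this
          rw [Bool.not_not] at h3 ⊢
          exact (hright j i h3 h2).symm

/-- The corners of all ends. -/
def corners (p : CombType d) : Set Corner := {s | p.ValidCorner s}

theorem finite_corners (p : CombType d) : p.corners.Finite := by
  apply Set.Finite.subset (s := (fun z : Bool × ℕ × Bool => (⟨z.1, z.2.1, z.2.2⟩ : Corner)) ''
    (Set.univ ×ˢ (Set.Iio (2 * d + 1) ×ˢ Set.univ)))
  · exact (Set.finite_univ.prod ((Set.finite_Iio _).prod Set.finite_univ)).image _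
  · rintro ⟨x, i, o⟩ h
    have h1 := p.length_row_le x
    simp only [corners, ValidCorner, Set.mem_ofPred_eq] at h
    exact ⟨(x, i, o), by simp; omega, rfl⟩

theorem finite_cuspsAt (p : CombType d) (s : Corner) : (p.cuspsAt s).Finite := by
  apply Set.Finite.subset (s := Set.univ ×ˢ Set.Iio (2 * d + 1))
  · exact Set.finite_univ.prod (Set.finite_Iio _)
  · rintro ⟨x, i⟩ h
    have h1 := p.length_row_le x
    have := h.1
    simp only at this
    simp; omega

/-- The number of corners on a boundary curve. -/
noncomputable def numCorners (p : CombType d) (s : Corner) : ℕ :=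
  {t | p.ValidCorner t ∧ p.SameBoundary s t}.ncard

/-- A right corner either begins a cusp or is the last corner of its row. -/
theorem ncard_corners_right (p : CombType d) (h : ∀ x, 0 < (p.row x).length) (s : Corner) :
    {t | t.right = true ∧ p.ValidCorner t ∧ p.SameBoundary s t}.ncard = (p.cuspsAt s).ncard +
      (({⟨false, (p.row false).length - 1, true⟩, ⟨true, (p.row true).length - 1, true⟩} : Set Corner)
        ∩ {t | p.SameBoundary s t}).ncard := by
  have h0 : {t | t.right = true ∧ p.ValidCorner t ∧ p.SameBoundary s t} =
      (fun c : Bool × ℕ => (⟨c.1, c.2, true⟩ : Corner)) '' p.cuspsAt s ∪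
      (({⟨false, (p.row false).length - 1, true⟩, ⟨true, (p.row true).length - 1, true⟩} : Set Corner)
        ∩ {t | p.SameBoundary s t}) := by
    ext ⟨x, i, o⟩
    simp only [ValidCorner, cuspsAt, Set.mem_ofPred_eq, Set.mem_union, Set.mem_image, Set.mem_inter_iff,
      Set.mem_insert_iff, Set.mem_singleton_iff, Corner.mk.injEq, Prod.exists]
    constructor
    · rintro ⟨rfl, h1, h2⟩
      by_cases hi : i + 1 < (p.row x).length
      · exact Or.inl ⟨x, i, ⟨hi, h2⟩, rfl, rfl, rfl⟩
      · refine Or.inr ⟨?_, h2⟩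
        have : i = (p.row x).length - 1 := by omega
        cases x <;> simp [this]
    · rintro (⟨_, _, ⟨h1, h2⟩, rfl, rfl, rfl⟩ | ⟨⟨rfl, rfl, rfl⟩ | ⟨rfl, rfl, rfl⟩, h2⟩)
      · exact ⟨rfl, by omega, h2⟩
      · exact ⟨rfl, Nat.sub_lt (h _) one_pos, h2⟩
      · exact ⟨rfl, Nat.sub_lt (h _) one_pos, h2⟩
  rw [h0, Set.ncard_union_eq ?_ ((finite_cuspsAt p s).image _)
    ((Set.toFinite {_, _}).subset Set.inter_subset_left), Set.ncard_image_of_injective]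
  · intro c c' hc
    simpa [Prod.ext_iff] using hc
  · rw [Set.disjoint_left]
    rintro _ ⟨⟨x, i⟩, ⟨h1, -⟩, rfl⟩ ⟨h2, -⟩
    simp only [Set.mem_insert_iff, Set.mem_singleton_iff, Corner.mk.injEq] at h1 h2
    rcases h2 with ⟨rfl, rfl, -⟩ | ⟨rfl, rfl, -⟩ <;> omega

theorem ncard_corners_left (p : CombType d) (h : ∀ x, 0 < (p.row x).length) (s : Corner) :
    {t | t.right = false ∧ p.ValidCorner t ∧ p.SameBoundary s t}.ncard = (p.cuspsAt s).ncard +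
      (({⟨false, 0, false⟩, ⟨true, 0, false⟩} : Set Corner) ∩ {t | p.SameBoundary s t}).ncard := by
  have h0 : {t | t.right = false ∧ p.ValidCorner t ∧ p.SameBoundary s t} =
      (fun c : Bool × ℕ => (⟨c.1, c.2 + 1, false⟩ : Corner)) '' p.cuspsAt s ∪
      (({⟨false, 0, false⟩, ⟨true, 0, false⟩} : Set Corner) ∩ {t | p.SameBoundary s t}) := by
    ext ⟨x, i, o⟩
    simp only [ValidCorner, cuspsAt, Set.mem_ofPred_eq, Set.mem_union, Set.mem_image, Set.mem_inter_iff,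
      Set.mem_insert_iff, Set.mem_singleton_iff, Corner.mk.injEq, Prod.exists]
    constructor
    · rintro ⟨rfl, h1, h2⟩
      cases i with
      | zero => exact Or.inr ⟨by cases x <;> simp, h2⟩
      | succ i => exact Or.inl ⟨x, i, ⟨h1, h2.trans (same_cusp p x h1).symm⟩, rfl, rfl, rfl⟩
    · rintro (⟨_, _, ⟨h1, h2⟩, rfl, rfl, rfl⟩ | ⟨⟨rfl, rfl, rfl⟩ | ⟨rfl, rfl, rfl⟩, h2⟩)
      · exact ⟨rfl, h1, h2.trans (same_cusp p _ h1)⟩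
      · exact ⟨rfl, h _, h2⟩
      · exact ⟨rfl, h _, h2⟩
  rw [h0, Set.ncard_union_eq ?_ ((finite_cuspsAt p s).image _)
    ((Set.toFinite {_, _}).subset Set.inter_subset_left), Set.ncard_image_of_injective]
  · intro c c' hc
    simpa [Prod.ext_iff] using hc
  · rw [Set.disjoint_left]
    rintro _ ⟨⟨x, i⟩, ⟨h1, -⟩, rfl⟩ ⟨h2, -⟩
    simp at h2

/-- A pair of corners on the same boundary curve meets any boundary curve in two or no elements. -/
theorem ncard_pair_inter (p : CombType d) {s t u : Corner} (hne : t ≠ u)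
    (h : p.SameBoundary t u) [Decidable (p.SameBoundary s t)] :
    (({t, u} : Set Corner) ∩ {v | p.SameBoundary s v}).ncard = if p.SameBoundary s t then 2 else 0 := by
  split_ifs with h1
  · rw [Set.inter_eq_left.2, ← Set.ncard_pair hne]
    · rintro v (rfl | rfl)
      · exact h1
      · exact h1.trans h
  · rw [Set.ncard_eq_zero ((Set.toFinite {t, u}).subset Set.inter_subset_left),
      Set.eq_empty_iff_forall_notMem]
    rintro v ⟨rfl | rfl, h2⟩
    · exact h1 h2
    · exact h1 (h2.trans h.symm)

-- Every cusp and each of the two vertical ends contributes two corners to its curve. Cusps can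
-- therefore be counted by counting corners, which are easier to follow through a step of induction.
open Classical in
theorem numCorners_eq (p : CombType d) (h : ∀ x, 0 < (p.row x).length) (s : Corner) :
    p.numCorners s = 2 * (p.cuspsAt s).ncard +
      (if p.SameBoundary s ⟨false, 0, false⟩ then 2 else 0) +
      (if p.SameBoundary s ⟨false, (p.row false).length - 1, true⟩ then 2 else 0) := by
  have hr := ncard_corners_right p h s
  have h1 := same_right p false (i := (p.row false).length - 1)
    (j := (p.row true).length - 1) (Nat.sub_add_cancel (h _)) (Nat.sub_add_cancel (h true))
  have h2 := same_left p h false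
  rw [Bool.not_false] at h1 h2
  rw [ncard_pair_inter p (by simp) h1] at hr
  have hl := ncard_corners_left p h s
  rw [ncard_pair_inter p (by simp) h2] at hl
  have h0 : {t | p.ValidCorner t ∧ p.SameBoundary s t} =
      {t | t.right = true ∧ p.ValidCorner t ∧ p.SameBoundary s t} ∪
      {t | t.right = false ∧ p.ValidCorner t ∧ p.SameBoundary s t} := by
    ext t
    cases h : t.right <;> simp [h]
  rw [numCorners, h0, Set.ncard_union_eq ?_ ((finite_corners p).subset fun t ht => ht.2.1)
    ((finite_corners p).subset fun t ht => ht.2.1), hr, hl]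
  · ring
  · rw [Set.disjoint_left]
    rintro t ⟨h1, -⟩ ⟨h2, -⟩
    simp [h1] at h2

/-! ### Transport of boundary curves -/

/-- The map of corners induced by a map of ends, keeping the cyclic orientation. -/
def liftCorner (f : Bool × ℕ → Bool × ℕ) (s : Corner) : Corner :=
  ⟨(f (s.row, s.pos)).1, (f (s.row, s.pos)).2, s.right ^^ s.row ^^ (f (s.row, s.pos)).1⟩

open Classical in
/-- The lift of a map of ends, modified so as to send two given corners to a third one. -/
noncomputable def collapse (f : Bool × ℕ → Bool × ℕ) (s₁ s₂ z : Corner) (s : Corner) : Corner :=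
  if s = s₁ ∨ s = s₂ then z else liftCorner f s

theorem validCorner_iff {p : CombType d} {s : Corner} :
    p.ValidCorner s ↔ ∃ a, p.lab (s.row, s.pos) = some a := by
  simp only [ValidCorner, lab, List.getElem?_eq_some_iff]
  exact ⟨fun h => ⟨_, h, rfl⟩, fun ⟨_, h, _⟩ => h⟩

theorem ValidCorner.liftCorner {p q : CombType d} {f : Bool × ℕ → Bool × ℕ}
    (hf : ∀ e a, p.lab e = some a → q.lab (f e) = some a) {s : Corner} (h : p.ValidCorner s) :
    q.ValidCorner (liftCorner f s) := by
  obtain ⟨a, ha⟩ := validCorner_iff.1 h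
  exact validCorner_iff.2 ⟨a, hf _ _ ha⟩

theorem liftCorner_liftCorner {p : CombType d} {f g : Bool × ℕ → Bool × ℕ}
    (hfg : ∀ e a, p.lab e = some a → g (f e) = e) {s : Corner} (h : p.ValidCorner s) :
    liftCorner g (liftCorner f s) = s := by
  obtain ⟨a, ha⟩ := validCorner_iff.1 h
  have := hfg _ _ ha
  obtain ⟨x, i, o⟩ := s
  simp only [liftCorner, Prod.mk.eta] at this ⊢
  rw [this]
  simp

theorem BandJoined.valid {p : CombType d} {s t : Corner} (h : p.BandJoined s t) :
    p.ValidCorner s ∧ p.ValidCorner t := by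
  obtain ⟨a, h1, h2, -⟩ := bandJoined_iff.1 h
  exact ⟨validCorner_iff.2 ⟨a, h1⟩, validCorner_iff.2 ⟨a, h2⟩⟩

theorem BandJoined.symm {p : CombType d} {s t : Corner} (h : p.BandJoined s t) :
    p.BandJoined t s := by
  obtain ⟨a, h1, h2, h3, h4⟩ := bandJoined_iff.1 h
  exact bandJoined_iff.2 ⟨a, h2, h1, h3.symm, h4.symm⟩

theorem BandJoined.unique {p : CombType d} {s t u : Corner} (h : p.BandJoined s t)
    (h' : p.BandJoined s u) : t = u := by
  obtain ⟨a, h1, h2, h3, h4⟩ := bandJoined_iff.1 h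
  obtain ⟨a', h1', h2', h3', h4'⟩ := bandJoined_iff.1 h'
  obtain rfl : a = a' := by simpa [h1] using h1'
  have := (eq_or_eq_of_lab h1 h2 h3 h2').resolve_left h3'.symm
  obtain ⟨x, i, o⟩ := s
  obtain ⟨y, j, o'⟩ := t
  obtain ⟨y', j', o''⟩ := u
  simp only [Prod.mk.injEq] at this
  obtain ⟨rfl, rfl⟩ := this
  simp only at h4 h4'
  cases x <;> cases y' <;> cases o <;> cases o' <;> cases o'' <;> simp at h4 h4' ⊢

theorem BandJoined.liftCorner {p q : CombType d} {f g : Bool × ℕ → Bool × ℕ}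
    (hf : ∀ e a, p.lab e = some a → q.lab (f e) = some a)
    (hgf : ∀ e a, p.lab e = some a → g (f e) = e) {s t : Corner} (h : p.BandJoined s t) :
    q.BandJoined (liftCorner f s) (liftCorner f t) := by
  obtain ⟨a, h1, h2, h3, h4⟩ := bandJoined_iff.1 h
  refine bandJoined_iff.2 ⟨a, hf _ _ h1, hf _ _ h2, fun he => h3 ?_, ?_⟩
  · have := congrArg g he
    simpa only [CombType.liftCorner, Prod.mk.eta, hgf _ _ h1, hgf _ _ h2] using this
  · simp only [CombType.liftCorner]
    generalize (f (s.row, s.pos)).1 = x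
    generalize (f (t.row, t.pos)).1 = y
    revert h4
    cases s.row <;> cases t.row <;> cases s.right <;> cases t.right <;> cases x <;> cases y <;> simp

/-- The exceptional corners are the two ends of a single long side. A side therefore avoids both of
them, or is that side and collapses to a point. -/
theorem BandJoined.collapse {p q : CombType d} {f g : Bool × ℕ → Bool × ℕ} {s₁ s₂ z : Corner}
    (hf : ∀ e a, p.lab e = some a → q.lab (f e) = some a)
    (hgf : ∀ e a, p.lab e = some a → g (f e) = e) (h12 : p.BandJoined s₁ s₂) {s t : Corner}
    (h : p.BandJoined s t) : q.SameBoundary (collapse f s₁ s₂ z s) (collapse f s₁ s₂ z t) := by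
  have key : ∀ {s t}, p.BandJoined s t → (s = s₁ ∨ s = s₂) → (t = s₁ ∨ t = s₂) := by
    rintro s t h (rfl | rfl)
    · exact Or.inr (h.unique h12)
    · exact Or.inl (h.unique h12.symm)
  unfold CombType.collapse
  by_cases hs : s = s₁ ∨ s = s₂
  · rw [if_pos hs, if_pos (key h hs)]
    exact .refl _ _
  · rw [if_neg hs, if_neg fun ht => hs (key h.symm ht)]
    exact (BandJoined.liftCorner hf hgf h).same

-- `s₁` lies at the right vertical end, so the curve of `s₁` and `s₂` is the one through that end.
-- Discarding these two corners cancels exactly the contribution of the right end.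
open Classical in
theorem ncard_corners_ne (p : CombType d) (h : ∀ x, 0 < (p.row x).length) {s₁ s₂ : Corner}
    (h12 : p.BandJoined s₁ s₂) {r : Bool} (hs₁ : s₁ = ⟨r, (p.row r).length - 1, true⟩)
    (s : Corner) :
    {t | p.ValidCorner t ∧ t ≠ s₁ ∧ t ≠ s₂ ∧ p.SameBoundary s t}.ncard = 2 * (p.cuspsAt s).ncard +
      if p.SameBoundary s ⟨!r, 0, false⟩ then 2 else 0 := by
  have h0 := numCorners_eq p h s
  have hne : s₁ ≠ s₂ := by
    rintro rfl
    obtain ⟨a, -, -, h3, -⟩ := bandJoined_iff.1 h12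
    exact h3 rfl
  have h1 : p.SameBoundary s ⟨false, (p.row false).length - 1, true⟩ ↔ p.SameBoundary s s₁ := by
    have h2 := same_right p false (i := (p.row false).length - 1)
      (j := (p.row true).length - 1) (Nat.sub_add_cancel (h _)) (Nat.sub_add_cancel (h true))
    cases r
    · rw [hs₁]
    · rw [hs₁]
      exact ⟨fun h' => h'.trans h2, fun h' => h'.trans h2.symm⟩
  have h1' : p.SameBoundary s ⟨false, 0, false⟩ ↔ p.SameBoundary s ⟨!r, 0, false⟩ := by
    have h2 := same_left p h false
    cases r
    · exact ⟨fun h' => h'.trans h2, fun h' => h'.trans h2.symm⟩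
    · rfl
  have h3 : {t | p.ValidCorner t ∧ p.SameBoundary s t} =
      {t | p.ValidCorner t ∧ t ≠ s₁ ∧ t ≠ s₂ ∧ p.SameBoundary s t} ∪
      (({s₁, s₂} : Set Corner) ∩ {v | p.SameBoundary s v}) := by
    ext t
    simp only [Set.mem_ofPred_eq, Set.mem_union, Set.mem_inter_iff, Set.mem_insert_iff,
      Set.mem_singleton_iff]
    constructor
    · rintro ⟨h4, h5⟩
      by_cases h6 : t = s₁ ∨ t = s₂
      · exact Or.inr ⟨h6, h5⟩
      · rw [not_or] at h6
        exact Or.inl ⟨h4, h6.1, h6.2, h5⟩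
    · rintro (h4 | ⟨rfl | rfl, h4⟩)
      · exact ⟨h4.1, h4.2.2.2⟩
      · exact ⟨h12.valid.1, h4⟩
      · exact ⟨h12.valid.2, h4⟩
  rw [numCorners, h3, Set.ncard_union_eq ?_ ((finite_corners p).subset fun t ht => ht.1)
    ((Set.toFinite {s₁, s₂}).subset Set.inter_subset_left), ncard_pair_inter p hne h12.same] at h0
  · simp only [h1, h1'] at h0
    omega
  · rw [Set.disjoint_left]
    rintro t ⟨-, h4, h5, -⟩ ⟨h6 | h6, -⟩
    · exact h4 h6
    · exact h5 h6

/-- Completeness is inherited if all corners correspond, except for one side of a band which lies on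
the boundary curve of the right end. -/
theorem Complete.transport {p q : CombType d} {f g : Bool × ℕ → Bool × ℕ} {s₁ s₂ z z' : Corner}
    {r : Bool} (hp : p.Complete) (hpr : ∀ x, 0 < (p.row x).length)
    (hqr : ∀ x, 0 < (q.row x).length)
    (hf : ∀ e a, p.lab e = some a → q.lab (f e) = some a)
    (hg : ∀ e a, q.lab e = some a → p.lab (g e) = some a)
    (hgf : ∀ e a, p.lab e = some a → g (f e) = e)
    (hfg : ∀ e a, q.lab e = some a → f (g e) = e)
    (h12 : p.BandJoined s₁ s₂)
    (hs₁ : s₁ = ⟨r, (p.row r).length - 1, true⟩)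
    (hs₁' : liftCorner f s₁ = ⟨r, (q.row r).length - 1, true⟩)
    (hfm : ∀ s t, p.SameBoundary s t →
      q.SameBoundary (collapse f s₁ s₂ z s) (collapse f s₁ s₂ z t))
    (hgm : ∀ s t, q.SameBoundary s t → p.SameBoundary
      (collapse g (liftCorner f s₁) (liftCorner f s₂) z' s)
      (collapse g (liftCorner f s₁) (liftCorner f s₂) z' t))
    (hz' : p.ValidCorner z' ∧ z' ≠ s₁ ∧ z' ≠ s₂)
    (hz : q.SameBoundary (liftCorner f z') (liftCorner f s₁))
    (hl : (⟨!r, 0, false⟩ : Corner) ≠ s₁ ∧ (⟨!r, 0, false⟩ : Corner) ≠ s₂ ∧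
      liftCorner f ⟨!r, 0, false⟩ = ⟨!r, 0, false⟩) :
    q.Complete := by
  have h12' : q.BandJoined (liftCorner f s₁) (liftCorner f s₂) := h12.liftCorner hf hgf
  have hgf' : ∀ {t}, p.ValidCorner t → liftCorner g (liftCorner f t) = t :=
    fun h => liftCorner_liftCorner hgf h
  have hfg' : ∀ {t}, q.ValidCorner t → liftCorner f (liftCorner g t) = t :=
    fun h => liftCorner_liftCorner hfg h
  have hcf : ∀ {t}, t ≠ s₁ → t ≠ s₂ → collapse f s₁ s₂ z t = liftCorner f t :=
    fun h1 h2 => if_neg (not_or.2 ⟨h1, h2⟩)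
  have hcg : ∀ {t}, t ≠ liftCorner f s₁ → t ≠ liftCorner f s₂ →
      collapse g (liftCorner f s₁) (liftCorner f s₂) z' t = liftCorner g t :=
    fun h1 h2 => if_neg (not_or.2 ⟨h1, h2⟩)
  have hne : ∀ {t u}, p.ValidCorner t → p.ValidCorner u → t ≠ u →
      liftCorner f t ≠ liftCorner f u := fun ht hu h he => h (by rw [← hgf' ht, he, hgf' hu])
  have key : ∀ s, p.ValidCorner s → s ≠ s₁ → s ≠ s₂ →
      (q.cuspsAt (liftCorner f s)).ncard = (p.cuspsAt s).ncard := by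
    intro s hs hs1 hs2
    have hsame : ∀ {t}, p.ValidCorner t → t ≠ s₁ → t ≠ s₂ →
        (p.SameBoundary s t ↔ q.SameBoundary (liftCorner f s) (liftCorner f t)) := by
      intro t ht ht1 ht2
      constructor
      · intro h
        have := hfm _ _ h
        rwa [hcf hs1 hs2, hcf ht1 ht2] at this
      · intro h
        have := hgm _ _ h
        rwa [hcg (hne hs h12.valid.1 hs1) (hne hs h12.valid.2 hs2),
          hcg (hne ht h12.valid.1 ht1) (hne ht h12.valid.2 ht2), hgf' hs, hgf' ht] at this
    -- The remaining corners correspond bijectively and in the same classes, and the left end lies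
    -- on corresponding curves; hence the numbers of cusps agree.
    have e1 := ncard_corners_ne p hpr h12 hs₁ s
    have e2 := ncard_corners_ne q hqr h12' hs₁' (liftCorner f s)
    have e3 : {t | q.ValidCorner t ∧ t ≠ liftCorner f s₁ ∧ t ≠ liftCorner f s₂ ∧
        q.SameBoundary (liftCorner f s) t} =
        liftCorner f '' {t | p.ValidCorner t ∧ t ≠ s₁ ∧ t ≠ s₂ ∧ p.SameBoundary s t} := by
      ext t
      constructor
      · rintro ⟨h1, h2, h3, h4⟩
        have hv : p.ValidCorner (liftCorner g t) := h1.liftCorner hg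
        have hn1 : liftCorner g t ≠ s₁ := fun h => h2 (by rw [← h, hfg' h1])
        have hn2 : liftCorner g t ≠ s₂ := fun h => h3 (by rw [← h, hfg' h1])
        refine ⟨liftCorner g t, ⟨hv, hn1, hn2, ?_⟩, hfg' h1⟩
        rwa [hsame hv hn1 hn2, hfg' h1]
      · rintro ⟨t, ⟨h1, h2, h3, h4⟩, rfl⟩
        exact ⟨h1.liftCorner hf, hne h1 h12.valid.1 h2, hne h1 h12.valid.2 h3,
          (hsame h1 h2 h3).1 h4⟩
    have e4 : Set.InjOn (liftCorner f)
        {t | p.ValidCorner t ∧ t ≠ s₁ ∧ t ≠ s₂ ∧ p.SameBoundary s t} := by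
      rintro t ⟨h1, -⟩ u ⟨h2, -⟩ h
      rw [← hgf' h1, h, hgf' h2]
    rw [e3, e4.ncard_image, e1] at e2
    have h5 : p.SameBoundary s ⟨!r, 0, false⟩ ↔
        q.SameBoundary (liftCorner f s) ⟨!r, 0, false⟩ := by
      rw [hsame (t := ⟨!r, 0, false⟩) (hpr _) hl.1 hl.2.1, hl.2.2]
    by_cases h6 : p.SameBoundary s ⟨!r, 0, false⟩
    · rw [if_pos h6, if_pos (h5.1 h6)] at e2
      omega
    · rw [if_neg h6, if_neg (fun h => h6 (h5.2 h))] at e2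
      omega
  have main : ∀ s, p.ValidCorner s → s ≠ s₁ → s ≠ s₂ → ∀ t, q.SameBoundary t (liftCorner f s) →
      (q.cuspsAt t).ncard = 1 ∨ (q.cuspsAt t).ncard = 3 := by
    intro s hs hs1 hs2 t ht
    have : q.cuspsAt t = q.cuspsAt (liftCorner f s) := by
      ext c
      exact and_congr_right fun _ => ⟨fun h => ht.symm.trans h, fun h => ht.trans h⟩
    rw [this, key s hs hs1 hs2]
    exact hp s hs
  intro t ht
  -- The curve through the exceptional side also contains the image of the regular corner `z'`, so
  -- it is covered by `main`.
  by_cases h : t = liftCorner f s₁ ∨ t = liftCorner f s₂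
  · refine main z' hz'.1 hz'.2.1 hz'.2.2 t ?_
    rcases h with rfl | rfl
    · exact hz.symm
    · exact h12'.symm.same.trans hz.symm
  · rw [not_or] at h
    refine main (liftCorner g t) (ht.liftCorner hg) (fun h' => h.1 ?_) (fun h' => h.2 ?_) t ?_
    · rw [← h', hfg' ht]
    · rw [← h', hfg' ht]
    · rw [hfg' ht]
      exact .refl _ _

/-! ### Rauzy induction preserves completeness. -/

theorem _root_.List.getElem?_append_length_add {α : Type*} (v w : List α) (n : ℕ) :
    (v ++ w)[v.length + n]? = w[n]? := by
  rw [List.getElem?_append_right (by omega)]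
  congr 1
  omega

theorem _root_.List.getElem?_move {α : Type*} (v w : List α) (a b : α) {i : ℕ}
    (hi : i < v.length + w.length + 2) :
    (v ++ [a] ++ w ++ [b])[i]? = (v ++ [a, b] ++ w)[if i ≤ v.length then i else
      if i = v.length + w.length + 1 then v.length + 1 else i + 1]? := by
  simp only [List.append_assoc]
  rcases lt_trichotomy i v.length with h | rfl | h
  · simp [List.getElem?_append_left, h, h.le]
  · simp
  · obtain ⟨i, rfl⟩ := Nat.exists_eq_add_of_lt h
    rw [if_neg (by omega)]
    by_cases h' : i = w.length
    · rw [if_pos (by omega), add_assoc, List.getElem?_append_length_add,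
        List.getElem?_append_length_add]
      simp [h']
    · rw [if_neg (by omega), add_assoc, add_assoc, List.getElem?_append_length_add,
        List.getElem?_append_length_add]
      simp [List.getElem?_append_left, show i < w.length by omega]

theorem _root_.List.getElem?_append_insert {α : Type*} (u v : List α) (b : α) {i : ℕ} :
    (u ++ v)[i]? = (u ++ [b] ++ v)[if i < u.length then i else i + 1]? := by
  rw [List.append_assoc]
  by_cases h : i < u.length
  · rw [if_pos h, List.getElem?_append_left h, List.getElem?_append_left h]
  · obtain ⟨i, rfl⟩ := Nat.exists_eq_add_of_le (not_lt.1 h)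
    rw [if_neg h, add_assoc, List.getElem?_append_length_add, List.getElem?_append_length_add]
    simp

/-- A right inverse of a label preserving map of ends preserves labels. -/
theorem lab_of_rightInverse {p q : CombType d} {f g : Bool × ℕ → Bool × ℕ}
    (hf : ∀ e a, p.lab e = some a → q.lab (f e) = some a)
    (hv : ∀ e, e.2 < (q.row e.1).length → (g e).2 < (p.row (g e).1).length)
    (hfg : ∀ e a, q.lab e = some a → f (g e) = e) (e : Bool × ℕ) (a : Fin d)
    (h : q.lab e = some a) : p.lab (g e) = some a := by
  have h1 := hv e (List.getElem?_eq_some_iff.1 h).1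
  have h2 : p.lab (g e) = some ((p.row (g e).1)[(g e).2]) := List.getElem?_eq_getElem h1
  have h3 := hf _ _ h2
  rw [hfg _ _ h, h] at h3
  rw [h2, h3]

/-- Only the long side of the winner at the right end changes its place. Before the step it lies
between the right corner of the loser and the left corner of the first end of `w`; afterwards,
between the right corner of the last end of `w` and the left corner of the loser. In each case the
two neighbours form a cusp in the other type. -/
theorem Complete.of_preserving {p q : CombType d} {r : Bool} {a b : Fin d} {u v w : List (Fin d)}
    (hp : p.Complete) (hw : w ≠ [])
    (h1 : p.row r = u ++ [a]) (h2 : p.row (!r) = v ++ [a] ++ w ++ [b])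
    (h1' : q.row r = u ++ [a]) (h2' : q.row (!r) = v ++ [a, b] ++ w) : q.Complete := by
  have hk : 0 < w.length := List.length_pos_iff.2 hw
  obtain ⟨n, hn⟩ : ∃ n, n = u.length := ⟨_, rfl⟩
  obtain ⟨j, hj⟩ : ∃ j, j = v.length := ⟨_, rfl⟩
  obtain ⟨k, hk'⟩ : ∃ k, k = w.length := ⟨_, rfl⟩
  have l1 : (p.row r).length = n + 1 := by simp [h1, hn]
  have l2 : (p.row !r).length = j + k + 2 := by simp [h2, hj, hk']; omega
  have l1' : (q.row r).length = n + 1 := by simp [h1', hn]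
  have l2' : (q.row !r).length = j + k + 2 := by simp [h2', hj, hk']; omega
  have hx : ∀ x, x = r ∨ x = !r := by intro x; cases x <;> cases r <;> simp
  have hne : (!r) ≠ r := by cases r <;> simp
  have hpr : ∀ x, 0 < (p.row x).length := by
    intro x; rcases hx x with rfl | rfl <;> omega
  have hqr : ∀ x, 0 < (q.row x).length := by
    intro x; rcases hx x with rfl | rfl <;> omega
  let f : Bool × ℕ → Bool × ℕ := fun e => if e.1 = r then e else if e.2 ≤ j then e else
    if e.2 = j + k + 1 then (e.1, j + 1) else (e.1, e.2 + 1)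
  let g : Bool × ℕ → Bool × ℕ := fun e => if e.1 = r then e else if e.2 ≤ j then e else
    if e.2 = j + 1 then (e.1, j + k + 1) else (e.1, e.2 - 1)
  have hf : ∀ e c, p.lab e = some c → q.lab (f e) = some c := by
    rintro ⟨x, i⟩ c h
    rcases hx x with rfl | rfl
    · simpa [f, lab, h1, h1'] using h
    · have hi := (List.getElem?_eq_some_iff.1 h).1
      simp only [l2] at hi
      simp only [lab, h2] at h
      rw [List.getElem?_move _ _ _ _ (by omega), ← hj, ← hk'] at h
      simp only [f, hne, if_false]
      split_ifs at h ⊢ <;> simpa only [lab, h2'] using h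
  have hgf : ∀ e c, p.lab e = some c → g (f e) = e := by
    rintro ⟨x, i⟩ c h
    have hi := (List.getElem?_eq_some_iff.1 h).1
    rcases hx x with rfl | rfl
    · simp [f, g]
    · simp only [l2] at hi
      rcases lt_trichotomy i (j + k + 1) with h | rfl | h
      · by_cases h' : i ≤ j <;> simp [f, g, h.ne, h']
        rw [if_neg (by omega), if_neg (by omega)]
      · simp [f, g, show ¬ (j + k + 1 ≤ j) by omega]
      · omega
  have hfg : ∀ e c, q.lab e = some c → f (g e) = e := by
    rintro ⟨x, i⟩ c h
    have hi := (List.getElem?_eq_some_iff.1 h).1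
    rcases hx x with rfl | rfl
    · simp [f, g]
    · simp only [l2'] at hi
      rcases lt_trichotomy i (j + 1) with h | rfl | h
      · simp [f, g, show i ≤ j by omega]
      · simp [f, g, show ¬ (j + k + 1 ≤ j) by omega]
      · simp [f, g, h.ne', show ¬ (i ≤ j) by omega, show ¬ (i ≤ j + 1) by omega,
          show i - 1 ≠ j + k + 1 by omega]
        omega
  have hg := lab_of_rightInverse (g := g) hf (by
    rintro ⟨x, i⟩ hi
    rcases hx x with rfl | rfl
    · simp only [g, if_true, l1] at hi ⊢
      omega
    · simp only [g, hne, if_false, l2'] at hi ⊢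
      split_ifs <;> simp only [l2] <;> omega) hfg
  have h12 : p.BandJoined ⟨r, n, true⟩ ⟨!r, j, true⟩ :=
    bandJoined_iff.2 ⟨a, by simp [lab, h1, hn], by simp [lab, h2, hj], by simp,
      by cases r <;> simp⟩
  have h12' : q.BandJoined ⟨r, n, true⟩ ⟨!r, j, true⟩ :=
    bandJoined_iff.2 ⟨a, by simp [lab, h1', hn], by simp [lab, h2', hj], by simp,
      by cases r <;> simp⟩
  have e1 : liftCorner f ⟨r, n, true⟩ = ⟨r, n, true⟩ := by simp [liftCorner, f]
  have e2 : liftCorner f ⟨!r, j, true⟩ = ⟨!r, j, true⟩ := by simp [liftCorner, f]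
  have hr : p.SameBoundary ⟨r, n, true⟩ ⟨!r, j + k + 1, true⟩ := same_right p r l1.symm (by omega)
  have hr' : q.SameBoundary ⟨r, n, true⟩ ⟨!r, j + k + 1, true⟩ := same_right q r l1'.symm (by omega)
  -- The side collapses onto a neighbour: onto the right corner of the reinserted loser in `q`
  -- (`z`), and onto the left corner of the critical loser in `p` (`z'`).
  refine hp.transport (f := f) (g := g) (s₁ := ⟨r, n, true⟩) (s₂ := ⟨!r, j, true⟩)
    (z := ⟨!r, j + 1, true⟩) (z' := ⟨!r, j + k + 1, false⟩) (r := r) hpr hqr hf hg hgf hfg h12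
    (by simp [l1]) (by simp [l1', e1]) ?_ ?_ ?_ ?_ ?_
  · intro s t hst
    refine SameBoundary.map r (fun s t h => h12.collapse hf hgf h) ?_ ?_ ?_ hst
    · intro x i hi
      rcases hx x with rfl | rfl
      · have := same_cusp q x (i := i) (by omega)
        have hi' : i ≠ n := by omega
        simpa [collapse, liftCorner, f, hi'] using this
      · rw [l2] at hi
        rcases lt_trichotomy i j with h | rfl | h
        · have := same_cusp q (!r) (i := i) (by omega)
          simpa [collapse, liftCorner, f, h.ne, h.le, Nat.succ_le_of_lt h] using this
        · have := same_cusp q (!r) (i := i + 1) (by omega)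
          have hk0 : k ≠ 0 := by omega
          simpa [collapse, liftCorner, f, hk0, show i + 1 ≠ i + k + 1 by omega] using this
        · by_cases h3 : i = j + k
          · subst h3
            have c1 := same_cusp q (!r) (i := j) (by omega)
            have := hr'.symm.trans (h12'.same.trans c1)
            simpa [collapse, liftCorner, f, show k ≠ 0 by omega, show ¬ (k + 1 ≤ 0) by omega,
              show ¬ (j + k + 1 ≤ j) by omega] using this
          · have := same_cusp q (!r) (i := i + 1) (by omega)
            simpa [collapse, liftCorner, f, h.ne', h.not_ge, show ¬ (i + 1 ≤ j) by omega,
              show i ≠ j + k + 1 by omega, h3] using this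
    · have := same_left q hqr r
      simpa [collapse, liftCorner, f] using this
    · intro i i' hi hi'
      obtain rfl : i = n := by omega
      obtain rfl : i' = j + k + 1 := by omega
      simpa [collapse, liftCorner, f, show ¬ (j + k + 1 ≤ j) by omega] using
        SameBoundary.refl q _
  · rw [e1, e2]
    intro s t hst
    refine SameBoundary.map r (fun s t h => h12'.collapse hg hfg h) ?_ ?_ ?_ hst
    · intro x i hi
      rcases hx x with rfl | rfl
      · have := same_cusp p x (i := i) (by omega)
        have hi' : i ≠ n := by omega
        simpa [collapse, liftCorner, g, hi'] using this
      · rw [l2'] at hi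
        rcases lt_trichotomy i j with h | rfl | h
        · have := same_cusp p (!r) (i := i) (by omega)
          simpa [collapse, liftCorner, g, h.ne, h.le, Nat.succ_le_of_lt h] using this
        · simpa [collapse, liftCorner, g] using SameBoundary.refl p _
        · by_cases h3 : i = j + 1
          · subst h3
            have := hr.symm.trans (h12.same.trans (same_cusp p (!r) (i := j) (by omega)))
            simpa [collapse, liftCorner, g, show ¬ (j + 1 + 1 ≤ j) by omega] using this
          · have := same_cusp p (!r) (i := i - 1) (by omega)
            rw [Nat.sub_add_cancel (by omega)] at this
            simpa [collapse, liftCorner, g, h.ne', h.not_ge, show ¬ (i + 1 ≤ j) by omega, h3,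
              show i ≠ 0 by omega] using this
    · have := same_left p hpr r
      simpa [collapse, liftCorner, g] using this
    · intro i i' hi hi'
      obtain rfl : i = n := by omega
      obtain rfl : i' = j + k + 1 := by omega
      have := (same_cusp p (!r) (i := j + k) (by omega)).symm
      simpa [collapse, liftCorner, g, show ¬ (j + k + 1 ≤ j) by omega, show k ≠ 0 by omega,
        show j + k + 1 ≠ j by omega]
        using this
  · refine ⟨?_, by simp, by simp⟩
    simp only [ValidCorner]; omega
  · rw [e1]
    have := (same_cusp q (!r) (i := j) (by omega)).symm.trans h12'.same.symm
    simpa [liftCorner, f, show ¬ (j + k + 1 ≤ j) by omega] using this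
  · refine ⟨by simp, by simp, by simp [liftCorner, f]⟩

/-- As for an orientation preserving winner, one long side of the winner slides past the loser. The
loser changes row here, so `liftCorner` exchanges its left and right corners. The left vertical end
is tested in the row `!r`, because the loser may be inserted at the very beginning of row `r`. -/
theorem Complete.of_reversing {p q : CombType d} {r : Bool} {a b : Fin d} {u v w : List (Fin d)}
    (hp : p.Complete) (hw : w ≠ [])
    (h1 : p.row r = u ++ [a] ++ v ++ [a]) (h2 : p.row (!r) = w ++ [b])
    (h1' : q.row r = u ++ [b, a] ++ v ++ [a]) (h2' : q.row (!r) = w) : q.Complete := by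
  have hk : 0 < w.length := List.length_pos_iff.2 hw
  obtain ⟨j, hj⟩ : ∃ j, j = u.length := ⟨_, rfl⟩
  obtain ⟨n, hn⟩ : ∃ n, n = u.length + 1 + v.length := ⟨_, rfl⟩
  obtain ⟨k, hk'⟩ : ∃ k, k + 1 = w.length := ⟨w.length - 1, by omega⟩
  have hjn : j < n := by omega
  have l1 : (p.row r).length = n + 1 := by simp [h1, hn]; omega
  have l2 : (p.row !r).length = k + 2 := by simp [h2, ← hk']
  have l1' : (q.row r).length = n + 2 := by simp [h1', hn]; omega
  have l2' : (q.row !r).length = k + 1 := by simp [h2', ← hk']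
  have hx : ∀ x, x = r ∨ x = !r := by intro x; cases x <;> cases r <;> simp
  have hne : (!r) ≠ r := by cases r <;> simp
  have hpr : ∀ x, 0 < (p.row x).length := by
    intro x; rcases hx x with rfl | rfl <;> omega
  have hqr : ∀ x, 0 < (q.row x).length := by
    intro x; rcases hx x with rfl | rfl <;> omega
  let f : Bool × ℕ → Bool × ℕ := fun e => if e.1 = r then (if e.2 < j then e else (e.1, e.2 + 1))
    else if e.2 = k + 1 then (r, j) else e
  let g : Bool × ℕ → Bool × ℕ := fun e => if e.1 = r then (if e.2 < j then e else
    if e.2 = j then (!r, k + 1) else (e.1, e.2 - 1)) else e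
  have hf : ∀ e c, p.lab e = some c → q.lab (f e) = some c := by
    rintro ⟨x, i⟩ c h
    have hi := (List.getElem?_eq_some_iff.1 h).1
    rcases hx x with rfl | rfl
    · have h' : p.row x = u ++ ([a] ++ v ++ [a]) := by simp [h1]
      simp only [lab, h'] at h
      rw [List.getElem?_append_insert _ _ b, ← hj] at h
      simp only [f, if_true]
      split_ifs at h ⊢ <;> simpa [lab, h1'] using h
    · simp only [l2] at hi
      simp only [f, hne, if_false]
      split_ifs with hi'
      · simpa [lab, h2, h1', hi', hk', hj] using h
      · simp only [lab, h2, h2'] at h ⊢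
        rwa [List.getElem?_append_left (by omega)] at h
  have hgf : ∀ e c, p.lab e = some c → g (f e) = e := by
    rintro ⟨x, i⟩ c h
    rcases hx x with rfl | rfl
    · by_cases h' : i < j
      · simp [f, g, h']
      · simp [f, g, h', show ¬ (i + 1 < j) by omega, show i + 1 ≠ j by omega]
    · by_cases h' : i = k + 1 <;> simp [f, g, h']
  have hfg : ∀ e c, q.lab e = some c → f (g e) = e := by
    rintro ⟨x, i⟩ c h
    have hi := (List.getElem?_eq_some_iff.1 h).1
    rcases hx x with rfl | rfl
    · rcases lt_trichotomy i j with h | rfl | h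
      · simp [f, g, h]
      · simp [f, g]
      · simp [f, g, h.ne', h.not_gt, show ¬ (i - 1 < j) by omega]
        omega
    · simp only [l2'] at hi
      simp [f, g, show i ≠ k + 1 by omega]
  have hg := lab_of_rightInverse (g := g) hf (by
    rintro ⟨x, i⟩ hi
    rcases hx x with rfl | rfl
    · simp only [g, if_true, l1'] at hi ⊢
      split_ifs <;> simp only [l1, l2] <;> omega
    · simp only [g, hne, if_false, l2'] at hi ⊢
      simp only [l2]; omega) hfg
  have h12 : p.BandJoined ⟨r, n, true⟩ ⟨r, j, false⟩ :=
    bandJoined_iff.2 ⟨a, by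
    rw [lab, h1, hn, show u.length + 1 + v.length = (u ++ [a] ++ v).length + 0 by simp; omega,
      List.getElem?_append_length_add]; rfl, by simp [lab, h1, hj],
      by simp; omega, by cases r <;> simp⟩
  have h12' : q.BandJoined ⟨r, n + 1, true⟩ ⟨r, j + 1, false⟩ :=
    bandJoined_iff.2 ⟨a, by
    rw [lab, h1', hn, show u.length + 1 + v.length + 1 = (u ++ [b, a] ++ v).length + 0 by
      simp; omega, List.getElem?_append_length_add]; rfl, by simp [lab, h1', hj],
      by simp; omega, by cases r <;> simp⟩
  have e1 : liftCorner f ⟨r, n, true⟩ = ⟨r, n + 1, true⟩ := by simp [liftCorner, f, hjn.not_gt]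
  have e2 : liftCorner f ⟨r, j, false⟩ = ⟨r, j + 1, false⟩ := by simp [liftCorner, f]
  have hr : p.SameBoundary ⟨r, n, true⟩ ⟨!r, k + 1, true⟩ := same_right p r l1.symm (by omega)
  have hr' : q.SameBoundary ⟨r, n + 1, true⟩ ⟨!r, k, true⟩ := same_right q r l1'.symm (by omega)
  have hb : q.SameBoundary ⟨r, j, true⟩ ⟨r, j + 1, false⟩ := same_cusp q r (by omega)
  refine hp.transport (f := f) (g := g) (s₁ := ⟨r, n, true⟩) (s₂ := ⟨r, j, false⟩)
    (z := ⟨r, j, false⟩) (z' := ⟨!r, k + 1, false⟩) (r := r) hpr hqr hf hg hgf hfg h12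
    (by simp [l1]) (by simp [l1', e1]) ?_ ?_ ?_ ?_ ?_
  · intro s t hst
    refine SameBoundary.map r (fun s t h => h12.collapse hf hgf h) ?_ ?_ ?_ hst
    · intro x i hi
      rcases hx x with rfl | rfl
      · rw [l1] at hi
        have hi' : i ≠ n := by omega
        rcases lt_trichotomy (i + 1) j with h | rfl | h
        · have := same_cusp q x (i := i) (by omega)
          simpa [collapse, liftCorner, f, hi', h, h.ne, show i < j by omega] using this
        · have := same_cusp q x (i := i) (by omega)
          simpa [collapse, liftCorner, f, hi'] using this
        · have := same_cusp q x (i := i + 1) (by omega)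
          simpa [collapse, liftCorner, f, hi', h.ne', h.not_gt, show ¬ (i < j) by omega] using this
      · rw [l2] at hi
        by_cases h : i = k
        · subst h
          have := hr'.symm.trans (h12'.same.trans hb.symm)
          simpa [collapse, liftCorner, f] using this
        · have := same_cusp q (!r) (i := i) (by omega)
          simpa [collapse, liftCorner, f, h, show i ≠ k + 1 by omega] using this
    · have := same_left q hqr r
      rcases Nat.eq_zero_or_pos j with h | h
      · simpa [collapse, liftCorner, f, h] using this
      · simpa [collapse, liftCorner, f, h, h.ne] using this
    · intro i i' hi hi'
      obtain rfl : i = n := by omega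
      obtain rfl : i' = k + 1 := by omega
      simpa [collapse, liftCorner, f] using SameBoundary.refl q _
  · rw [e1, e2]
    intro s t hst
    refine SameBoundary.map r (fun s t h => h12'.collapse hg hfg h) ?_ ?_ ?_ hst
    · intro x i hi
      rcases hx x with rfl | rfl
      · rw [l1'] at hi
        have hi' : i ≠ n + 1 := by omega
        rcases lt_trichotomy i j with h | rfl | h
        · by_cases h3 : i + 1 = j
          · subst h3
            have := (same_cusp p x (i := i) (by omega)).trans (h12.symm.same.trans hr)
            simpa [collapse, liftCorner, g, hi', h12.symm] using this
          · have := same_cusp p x (i := i) (by omega)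
            simpa [collapse, liftCorner, g, hi', h, h.ne, h3, show i + 1 < j by omega] using this
        · simpa [collapse, liftCorner, g, hi'] using SameBoundary.refl p _
        · have := same_cusp p x (i := i - 1) (by omega)
          rw [Nat.sub_add_cancel (by omega)] at this
          simpa [collapse, liftCorner, g, hi', h.ne', h.not_gt, show ¬ (i + 1 < j) by omega,
            show i + 1 ≠ j by omega] using this
      · have := same_cusp p (!r) (i := i) (by omega)
        simpa [collapse, liftCorner, g] using this
    · have hl := same_left p hpr r
      -- If the loser is inserted in front of the whole row, the long side of the winner was
      -- attached in `p` to the left vertical end instead of a cusp.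
      rcases Nat.eq_zero_or_pos j with h | h
      · subst h
        have := hr.symm.trans (h12.same.trans hl)
        simpa [collapse, liftCorner, g] using this
      · simpa [collapse, liftCorner, g, h, h.ne] using hl
    · intro i i' hi hi'
      obtain rfl : i = n + 1 := by omega
      obtain rfl : i' = k := by omega
      have := (same_cusp p (!r) (i := i') (by omega)).symm
      simpa [collapse, liftCorner, g] using this
  · refine ⟨?_, by simp, by simp⟩
    simp only [ValidCorner]; omega
  · rw [e1]
    have := hb.trans h12'.symm.same
    simpa [liftCorner, f] using this
  · refine ⟨by simp, by simp, by simp [liftCorner, f]⟩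

/-- Rauzy induction preserves completeness. -/
theorem Complete.split {p q : CombType d} {a b : Fin d} (hp : p.Complete) (h : p.Split a b q)
    (hq : ∀ r, q.row r ≠ []) : q.Complete := by
  obtain ⟨r, ⟨u, v, w, h1, h2, h3, h4⟩ | ⟨u, v, w, h1, h2, h3, h4⟩⟩ := split_iff.1 h
  · by_cases hw : w = []
    -- The loser already stands directly to the right of the winner's other end, so it is put back
    -- where it was.
    · have : p = q := by
        subst hw
        cases r <;> simp [row] at h1 h2 h3 h4 <;> ext1 <;> simp [h1, h2, h3, h4]
      exact this ▸ hp
    · exact hp.of_preserving hw h1 h2 h3 h4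
  · exact hp.of_reversing (by rw [← h4]; exact hq _) h1 h2 h3 h4

/-! ### Blocks without orientation reversing bands -/

theorem exists_pos_of_sgn_eq_zero {p : CombType d} {a : Fin d} (h : p.sgn a = 0) (x : Bool) :
    ∃ i, ∀ j, p.lab (x, j) = some a ↔ j = i := by
  have h1 : (p.row x).count a = 1 := by
    have := p.count_add_count true a
    simp only [sgn, row] at h this
    cases x <;> simp [row] at this ⊢ <;> omega
  rw [List.count_eq_card_filter_range, Finset.card_eq_one] at h1
  obtain ⟨i, hi⟩ := h1
  refine ⟨i, fun j => ?_⟩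
  have h2 : j ∈ (Finset.range (p.row x).length).filter (fun i => (p.row x)[i]? = some a) ↔ j = i := by
    rw [hi, Finset.mem_singleton]
  rw [← h2, Finset.mem_filter, lab, iff_and_self]
  intro hj
  exact Finset.mem_range.2 (List.getElem?_eq_some_iff.1 hj).1

/-- The cusps inside a block on a given boundary curve. -/
def innerCusps (p : CombType d) (s : Corner) (k : Bool → ℕ) : Set (Bool × ℕ) :=
  {c | c.2 + 1 < k c.1 ∧ p.SameBoundary s ⟨c.1, c.2, true⟩}

open Classical in
/-- The ends of a block with a corner of given kind on a given boundary curve. -/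
noncomputable def blockCorners (p : CombType d) (s : Corner) (k : Bool → ℕ) (x o : Bool) : Finset ℕ :=
  (Finset.range (k x)).filter fun i => p.SameBoundary s ⟨x, i, o⟩

/-- Each band of the block has one end in each row, and its sides join left to left and right to
right. The bands with a corner of a given kind on the curve are thus the same in both rows. -/
theorem card_blockCorners {p : CombType d} {k : Bool → ℕ} {V : Fin d → Prop}
    (hk : ∀ x, k x ≤ (p.row x).length)
    (hV : ∀ x i a, p.lab (x, i) = some a → (V a ↔ i < k x))
    (hsgn : ∀ a, V a → p.sgn a = 0) (s : Corner) (o : Bool) :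
    ∃ A : Finset (Fin d), ∀ x, ∃ f : Fin d → ℕ, (∀ a ∈ A, p.lab (x, f a) = some a) ∧
      p.blockCorners s k x o = A.image f ∧ (p.blockCorners s k x o).card = A.card := by
  classical
  have h1 : ∀ x a, ∃ i, V a → ∀ j, p.lab (x, j) = some a ↔ j = i := by
    intro x a
    by_cases h : V a
    · obtain ⟨i, hi⟩ := exists_pos_of_sgn_eq_zero (hsgn a h) x
      exact ⟨i, fun _ => hi⟩
    · exact ⟨0, fun h' => absurd h' h⟩
  choose f hf using h1
  have hlab : ∀ x a, V a → p.lab (x, f x a) = some a := fun x a h => (hf x a h _).2 rfl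
  refine ⟨Finset.univ.filter fun a => V a ∧ p.SameBoundary s ⟨true, f true a, o⟩, fun x =>
    ⟨f x, fun a ha => hlab x a (Finset.mem_filter.1 ha).2.1, ?_⟩⟩
  have h2 : ∀ a, V a → (p.SameBoundary s ⟨true, f true a, o⟩ ↔ p.SameBoundary s ⟨x, f x a, o⟩) := by
    intro a ha
    cases x
    · have hb : p.BandJoined ⟨true, f true a, o⟩ ⟨false, f false a, o⟩ :=
        bandJoined_iff.2 ⟨a, hlab _ _ ha, hlab _ _ ha, by simp, by cases o <;> simp⟩
      exact ⟨fun h => h.trans hb.same, fun h => h.trans hb.same.symm⟩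
    · rfl
  have h3 : p.blockCorners s k x o = (Finset.univ.filter fun a =>
      V a ∧ p.SameBoundary s ⟨true, f true a, o⟩).image (f x) := by
    ext i
    simp only [blockCorners, Finset.mem_filter, Finset.mem_range, Finset.mem_image,
      Finset.mem_univ, true_and]
    constructor
    · rintro ⟨hi, hs⟩
      have hl : p.lab (x, i) = some ((p.row x)[i]'(hi.trans_le (hk x))) :=
        List.getElem?_eq_getElem _
      have hVa := (hV _ _ _ hl).2 hi
      have he := (hf x _ hVa i).1 hl
      exact ⟨_, ⟨hVa, (h2 _ hVa).2 (by rwa [← he])⟩, he.symm⟩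
    · rintro ⟨a, ⟨ha, hs⟩, rfl⟩
      exact ⟨(hV _ _ _ (hlab x a ha)).1 ha, (h2 a ha).1 hs⟩
  refine ⟨h3, ?_⟩
  rw [h3, Finset.card_image_of_injOn]
  intro a ha b hb hab
  have h4 := hlab x a (Finset.mem_filter.1 ha).2.1
  have h5 := hlab x b (Finset.mem_filter.1 hb).2.1
  rw [hab, h5] at h4
  exact (Option.some_injective _ h4).symm

/-- A complete type has no initial block closed under pairing which consists of bands joining top to
bottom. -/
theorem Complete.no_initial_block {p : CombType d} (hp : p.Complete) {k : Bool → ℕ}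
    {V : Fin d → Prop} (hk : (∀ x, k x < (p.row x).length) ∨ ∀ x, k x = (p.row x).length)
    (hV : ∀ x i a, p.lab (x, i) = some a → (V a ↔ i < k x))
    (hsgn : ∀ a, V a → p.sgn a = 0) (hex : ∃ a, V a) : False := by
  classical
  have hkl : ∀ x, k x ≤ (p.row x).length := fun x =>
    hk.elim (fun h => (h x).le) fun h => (h x).le
  have hpos : ∀ x, 0 < k x := by
    intro x
    obtain ⟨a, ha⟩ := hex
    obtain ⟨i, hi⟩ := exists_pos_of_sgn_eq_zero (hsgn a ha) x
    exact (Nat.zero_le i).trans_lt ((hV x i a ((hi i).2 rfl)).1 ha)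
  have hrow : ∀ x, 0 < (p.row x).length := fun x => (hpos x).trans_le (hkl x)
  set s : Corner := ⟨true, 0, false⟩ with hs
  have hs0 : ∀ x, p.SameBoundary s ⟨x, 0, false⟩ := by
    intro x
    cases x
    · exact same_left p hrow true
    · exact .refl p s
  let K : Bool → Finset ℕ := fun x =>
    (Finset.range (k x - 1)).filter fun i => p.SameBoundary s ⟨x, i, true⟩
  have hK : ∀ {x i}, i ∈ K x ↔ i + 1 < k x ∧ p.SameBoundary s ⟨x, i, true⟩ := by
    intro x i
    simp only [K, Finset.mem_filter, Finset.mem_range]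
    rw [Nat.lt_sub_iff_add_lt]
  have hleft : ∀ x, p.blockCorners s k x false = insert 0 ((K x).image Nat.succ) := by
    intro x
    ext i
    simp only [blockCorners, Finset.mem_filter, Finset.mem_range, Finset.mem_insert,
      Finset.mem_image, hK]
    constructor
    · rintro ⟨h1, h2⟩
      cases i with
      | zero => exact Or.inl rfl
      | succ i =>
        exact Or.inr ⟨i, ⟨h1, h2.trans (same_cusp p x (h1.trans_le (hkl x))).symm⟩, rfl⟩
    · rintro (rfl | ⟨i, ⟨h1, h2⟩, rfl⟩)
      · exact ⟨hpos x, hs0 x⟩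
      · exact ⟨h1, h2.trans (same_cusp p x (h1.trans_le (hkl x)))⟩
  have hright : ∀ x, p.blockCorners s k x true =
      if p.SameBoundary s ⟨x, k x - 1, true⟩ then insert (k x - 1) (K x) else K x := by
    intro x
    ext i
    have h0 := hpos x
    by_cases hi : i = k x - 1
    · subst hi
      have : k x - 1 ∉ K x := by rw [hK]; omega
      split_ifs with h <;> simp [blockCorners, h, this, h0]
    · have : (i < k x ∧ p.SameBoundary s ⟨x, i, true⟩) ↔ i ∈ K x := by
        rw [hK]
        exact and_congr_left fun _ => by omega
      split_ifs with h <;> simp [blockCorners, hi, this]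
  obtain ⟨A, hA⟩ := card_blockCorners hkl hV hsgn s false
  obtain ⟨B, hB⟩ := card_blockCorners hkl hV hsgn s true
  have hcardK : ∀ x, (K x).card + 1 = A.card := by
    intro x
    obtain ⟨f, -, -, h⟩ := hA x
    rw [← h, hleft, Finset.card_insert_of_notMem (by simp),
      Finset.card_image_of_injective _ Nat.succ_injective]
  -- Both rows have the same number of inner cusps and the same number of right corners on the
  -- curve. The last right corners of the two rows account for any difference, so both lie on the
  -- curve or neither does.
  have hbd : p.SameBoundary s ⟨true, k true - 1, true⟩ ↔
      p.SameBoundary s ⟨false, k false - 1, true⟩ := by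
    have h1 : ∀ x, (p.blockCorners s k x true).card = (K x).card +
        if p.SameBoundary s ⟨x, k x - 1, true⟩ then 1 else 0 := by
      intro x
      have h0 := hpos x
      rw [hright]
      split_ifs with h
      · rw [Finset.card_insert_of_notMem]
        rw [hK]; omega
      · rfl
    obtain ⟨f, -, -, h2⟩ := hB true
    obtain ⟨g, -, -, h3⟩ := hB false
    rw [h1] at h2 h3
    have h4 := hcardK true
    have h5 := hcardK false
    by_cases h6 : p.SameBoundary s ⟨true, k true - 1, true⟩ <;>
      by_cases h7 : p.SameBoundary s ⟨false, k false - 1, true⟩ <;>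
      simp only [h6, h7, if_true, if_false] at h2 h3 ⊢ <;> omega
  have hinner : (p.innerCusps s k).ncard = 2 * (A.card - 1) := by
    have h1 : p.innerCusps s k =
        ↑((K true).image (Prod.mk true) ∪ (K false).image (Prod.mk false)) := by
      ext ⟨x, i⟩
      cases x <;> simp [innerCusps, hK]
    rw [h1, Set.ncard_coe_finset, Finset.card_union_of_disjoint,
      Finset.card_image_of_injective _ (Prod.mk_right_injective _),
      Finset.card_image_of_injective _ (Prod.mk_right_injective _)]
    · have := hcardK true
      have := hcardK false
      omega
    · rw [Finset.disjoint_left]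
      simp
  have hsub : p.innerCusps s k ⊆ p.cuspsAt s := fun c hc => ⟨hc.1.trans_le (hkl _), hc.2⟩
  have hcases := hp s (hrow true)
  -- The inner cusps come in equal numbers from the two rows, while a complete type has an odd
  -- number of cusps on every curve.
  have heven : p.innerCusps s k ≠ p.cuspsAt s := by
    intro h
    rw [← h, hinner] at hcases
    omega
  rcases hk with hk | hk
  swap
  · exact heven (Set.ext fun c => by simp [innerCusps, cuspsAt, hk])
  by_cases hb : p.SameBoundary s ⟨true, k true - 1, true⟩
  · -- the only corners are those at the left end
    have h1 : insert (true, k true - 1) (insert (false, k false - 1) (p.innerCusps s k)) ⊆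
        p.cuspsAt s := by
      have e1 := hpos true
      have e2 := hpos false
      have e3 := hk true
      have e4 := hk false
      refine Set.insert_subset ⟨?_, hb⟩ (Set.insert_subset ⟨?_, hbd.1 hb⟩ hsub) <;> simp <;> omega
    have h2 := Set.ncard_le_ncard h1 (finite_cuspsAt p s)
    have hfin := (finite_cuspsAt p s).subset hsub
    rw [Set.ncard_insert_of_notMem _ (hfin.insert _), Set.ncard_insert_of_notMem _ hfin,
      hinner] at h2
    rotate_left
    · simp [innerCusps]; omega
    · simp [innerCusps]; omega
    -- The two cusps at the right edge of the block leave room for at most one of the evenly many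
    -- inner cusps, so there are none. One band then begins both rows, and its left side together
    -- with the left end is a closed curve without cusps.
    have hA1 : A.card = 1 := by
      have := hcardK true
      omega
    obtain ⟨a, rfl⟩ := Finset.card_eq_one.1 hA1
    have hlab : ∀ x, p.lab (x, 0) = some a := by
      intro x
      obtain ⟨f, h3, h4, -⟩ := hA x
      have h5 : (0 : ℕ) ∈ p.blockCorners s k x false := by rw [hleft]; simp
      rw [h4] at h5
      have h6 : f a = 0 := by simpa [eq_comm] using h5
      rw [← h6]
      exact h3 a (Finset.mem_singleton_self a)
    have hclosed : ∀ u v, p.SameBoundary u v →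
        ((u.pos = 0 ∧ u.right = false) ↔ (v.pos = 0 ∧ v.right = false)) := by
      intro u v huv
      induction huv with
      | refl => rfl
      | symm _ _ _ ih => exact ih.symm
      | trans _ _ _ _ _ ih1 ih2 => exact ih1.trans ih2
      | rel u v h =>
        rcases h with h | ⟨-, -, h1, h2, h3, h4⟩ | ⟨-, -, h1, h2 | h2⟩
        · have key : ∀ {u v}, p.BandJoined u v → (u.pos = 0 ∧ u.right = false) →
              (v.pos = 0 ∧ v.right = false) := by
            rintro ⟨x, i, o⟩ v h ⟨rfl, rfl⟩
            have hb : p.BandJoined ⟨x, 0, false⟩ ⟨!x, 0, false⟩ :=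
              bandJoined_iff.2 ⟨a, hlab _, hlab _, by simp, by simp⟩
            rw [h.unique hb]
            exact ⟨rfl, rfl⟩
          exact ⟨key h, key h.symm⟩
        · simp [h2, h3]
        · simp [h2]
        · simp [h2]
    have := (hclosed _ _ hb).1 ⟨rfl, rfl⟩
    simp at this
  · have hb' : ∀ x, ¬ p.SameBoundary s ⟨x, k x - 1, true⟩ := by
      intro x
      cases x
      · exact fun h => hb (hbd.2 h)
      · exact hb
    -- A curve could leave the block only through the cusps at its right edge, which this curve
    -- avoids; so all its cusps are inner ones.
    have hclosed : ∀ u v, p.SameBoundary u v → ((p.SameBoundary s u → (u.pos < k u.row ↔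
        v.pos < k v.row))) := by
      intro u v huv
      induction huv with
      | refl => exact fun _ => Iff.rfl
      | symm u v h ih => exact fun h' => (ih (SameBoundary.trans h' (SameBoundary.symm h))).symm
      | trans u v w h _ ih1 ih2 => exact fun h' => (ih1 h').trans (ih2 (SameBoundary.trans h' h))
      | rel u v h =>
        intro h'
        rcases h with h | ⟨-, -, h1, h2, h3, h4⟩ | ⟨-, -, h1, h2 | h2⟩
        · obtain ⟨a, h1, h2, -⟩ := bandJoined_iff.1 h
          rw [← hV _ _ _ h1, ← hV _ _ _ h2]
        · rw [h2, ← h1]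
          have h5 : u.pos + 1 ≠ k u.row := by
            intro h5
            apply hb' u.row
            rw [← h5, Nat.add_sub_cancel, ← h3]
            exact h'
          omega
        · have := hpos u.row
          have := hpos v.row
          omega
        · have := hk u.row
          have := hk v.row
          omega
    refine heven (hsub.antisymm ?_)
    rintro ⟨x, i⟩ ⟨h1, h2⟩
    have h3 := (hclosed _ _ h2 (.refl p s)).1 (hpos true)
    have h4 := h2.trans (same_cusp p x h1)
    have h5 := (hclosed _ _ h4 (.refl p s)).1 (hpos true)
    exact ⟨h5, h2⟩

/-! ### Reversing the rows -/

/-- Both rows read from right to left. -/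
def mirror (p : CombType d) : CombType d where
  top := p.top.reverse
  bot := p.bot.reverse
  two_ends a := by
    have := p.two_ends a
    simpa using this

theorem row_mirror (p : CombType d) (x : Bool) : p.mirror.row x = (p.row x).reverse := by
  cases x <;> rfl

theorem length_row_mirror (p : CombType d) (x : Bool) :
    (p.mirror.row x).length = (p.row x).length := by
  rw [row_mirror, List.length_reverse]

theorem mirror_mirror (p : CombType d) : p.mirror.mirror = p := by
  ext1 <;> simp [mirror]

theorem sgn_mirror (p : CombType d) (a : Fin d) : p.mirror.sgn a = p.sgn a := by
  simp [sgn, mirror]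

theorem lab_mirror (p : CombType d) (x : Bool) {i : ℕ} (hi : i < (p.row x).length) :
    p.mirror.lab (x, (p.row x).length - 1 - i) = p.lab (x, i) := by
  rw [lab, lab, row_mirror, List.getElem?_reverse (by simp only; omega)]
  congr 1
  simp only
  omega

/-- The mirror image of a corner. -/
def mirrorCorner (p : CombType d) (s : Corner) : Corner :=
  ⟨s.row, (p.row s.row).length - 1 - s.pos, !s.right⟩

theorem SameBoundary.mirror {p : CombType d} (hrow : ∀ x, 0 < (p.row x).length) {s t : Corner}
    (h : p.SameBoundary s t) :
    p.mirror.SameBoundary (p.mirrorCorner s) (p.mirrorCorner t) := by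
  have hrow' : ∀ x, 0 < (p.mirror.row x).length := fun x => by
    rw [length_row_mirror]; exact hrow x
  refine SameBoundary.map true (fun s t h => ?_) (fun x i hi => ?_) ?_ (fun i j hi hj => ?_) h
  · obtain ⟨a, h1, h2, h3, h4⟩ := bandJoined_iff.1 h
    have l1 := (List.getElem?_eq_some_iff.1 h1).1
    have l2 := (List.getElem?_eq_some_iff.1 h2).1
    refine BandJoined.same (bandJoined_iff.2 ⟨a, ?_, ?_, ?_, ?_⟩)
    · rw [← h1]; exact lab_mirror p _ l1
    · rw [← h2]; exact lab_mirror p _ l2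
    · obtain ⟨x, i, o⟩ := s
      obtain ⟨y, j, o'⟩ := t
      simp only [mirrorCorner, ne_eq, Prod.mk.injEq, not_and] at h3 l1 l2 ⊢
      rintro rfl
      have := h3 rfl
      omega
    · simpa [mirrorCorner] using h4
  · have := same_cusp p.mirror x (i := (p.row x).length - 1 - (i + 1))
      (by rw [length_row_mirror]; omega)
    rw [show (p.row x).length - 1 - (i + 1) + 1 = (p.row x).length - 1 - i by omega] at this
    simpa [mirrorCorner] using this.symm
  · have h1 := hrow true
    have h2 := hrow false
    exact same_right p.mirror true (by simp only [length_row_mirror]; omega)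
      (by simp only [length_row_mirror, Bool.not_true]; omega)
  · have := same_left p.mirror hrow' true
    have h1 : (p.row true).length - 1 - i = 0 := by omega
    have h2 : (p.row !true).length - 1 - j = 0 := by omega
    simp only [mirrorCorner, h1, h2]
    exact this

theorem mirrorCorner_mirrorCorner {p : CombType d} {s : Corner} (h : p.ValidCorner s) :
    p.mirror.mirrorCorner (p.mirrorCorner s) = s := by
  obtain ⟨x, i, o⟩ := s
  simp only [ValidCorner] at h
  simp only [mirrorCorner, length_row_mirror, Corner.mk.injEq, Bool.not_not, true_and, and_true]
  omega

theorem Complete.mirror {p : CombType d} (hp : p.Complete) (hrow : ∀ x, 0 < (p.row x).length) :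
    p.mirror.Complete := by
  have hrow' : ∀ x, 0 < (p.mirror.row x).length := fun x => by
    rw [length_row_mirror]; exact hrow x
  intro s hs
  have hs' : p.ValidCorner (p.mirrorCorner s) := by
    simp only [ValidCorner, mirrorCorner, length_row_mirror] at hs ⊢
    omega
  obtain ⟨s, hv, rfl⟩ : ∃ t, p.ValidCorner t ∧ s = p.mirrorCorner t := by
    refine ⟨_, hs', ?_⟩
    obtain ⟨x, i, o⟩ := s
    simp only [ValidCorner, length_row_mirror] at hs
    simp only [mirrorCorner, Corner.mk.injEq, Bool.not_not, true_and, and_true]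
    omega
  have hiff : ∀ t, p.ValidCorner t → (p.SameBoundary s t ↔
      p.mirror.SameBoundary (p.mirrorCorner s) (p.mirrorCorner t)) := by
    intro t ht
    refine ⟨fun h => h.mirror hrow, fun h => ?_⟩
    have := h.mirror hrow'
    rwa [mirrorCorner_mirrorCorner hv, mirrorCorner_mirrorCorner ht, mirror_mirror] at this
  have h1 : p.mirror.cuspsAt (p.mirrorCorner s) =
      (fun c : Bool × ℕ => (c.1, (p.row c.1).length - 2 - c.2)) '' p.cuspsAt s := by
    have key : ∀ x i, i + 1 < (p.row x).length → (p.SameBoundary s ⟨x, i, true⟩ ↔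
        p.mirror.SameBoundary (p.mirrorCorner s) ⟨x, (p.row x).length - 2 - i, true⟩) := by
      intro x i hi
      rw [hiff _ (by simp only [ValidCorner]; omega)]
      have := same_cusp p.mirror x (i := (p.row x).length - 2 - i)
        (by rw [length_row_mirror]; omega)
      rw [show (p.row x).length - 2 - i + 1 = (p.row x).length - 1 - i by omega] at this
      exact ⟨fun h => h.trans this.symm, fun h => h.trans this⟩
    ext ⟨x, i⟩
    constructor
    · rintro ⟨h1, h2⟩
      simp only [length_row_mirror] at h1
      refine ⟨(x, (p.row x).length - 2 - i), ⟨?_, ?_⟩, ?_⟩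
      · simp only; omega
      · simp only
        rw [key x _ (by omega), show (p.row x).length - 2 - ((p.row x).length - 2 - i) = i by omega]
        exact h2
      · simp only [Prod.mk.injEq, true_and]; omega
    · rintro ⟨⟨y, j⟩, ⟨h1, h2⟩, h3⟩
      simp only [Prod.mk.injEq] at h1 h2 h3
      obtain ⟨rfl, rfl⟩ := h3
      refine ⟨?_, (key _ _ h1).1 h2⟩
      simp only [length_row_mirror]
      omega
  rw [h1, Set.InjOn.ncard_image]
  · exact hp s hv
  · rintro ⟨x, i⟩ ⟨h1, -⟩ ⟨y, j⟩ ⟨h2, -⟩ h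
    simp only [Prod.mk.injEq] at h h1 h2
    obtain ⟨rfl, h⟩ := h
    simp only [Prod.mk.injEq, true_and]
    omega

/-- A complete type has no final block closed under pairing which consists of bands joining top to
bottom. -/
theorem Complete.no_final_block {p : CombType d} (hp : p.Complete) {k : Bool → ℕ}
    {V : Fin d → Prop} (hk0 : ∀ x, 0 < k x) (hk : ∀ x, k x ≤ (p.row x).length)
    (hV : ∀ x i a, p.lab (x, i) = some a → (V a ↔ k x ≤ i))
    (hsgn : ∀ a, V a → p.sgn a = 0) (hex : ∃ a, V a) : False := by
  have hrow : ∀ x, 0 < (p.row x).length := fun x => (hk0 x).trans_le (hk x)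
  refine (hp.mirror hrow).no_initial_block (k := fun x => (p.row x).length - k x) (V := V)
    (Or.inl fun x => ?_) (fun x i a h => ?_) (fun a ha => ?_) hex
  · rw [length_row_mirror]
    have := hk0 x
    have := hk x
    omega
  · have hi := (List.getElem?_eq_some_iff.1 h).1
    simp only [length_row_mirror] at hi
    have h1 := lab_mirror p x (i := (p.row x).length - 1 - i) (by omega)
    rw [show (p.row x).length - 1 - ((p.row x).length - 1 - i) = i by omega, h] at h1
    rw [hV x _ a h1.symm]
    have := hk x
    omega
  · rw [sgn_mirror, hsgn a ha]

/-- A complete type with at least one band has orientation reversing bands. -/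
theorem Complete.exists_sgn_ne_zero {p : CombType d} (hp : p.Complete) (hd : 0 < d) :
    ∃ a, p.sgn a ≠ 0 := by
  by_contra! h
  exact hp.no_initial_block (k := fun x => (p.row x).length) (V := fun _ => True)
    (Or.inr fun _ => rfl) (fun x i a h => by simpa using (List.getElem?_eq_some_iff.1 h).1)
    (fun a _ => h a) ⟨⟨0, hd⟩, trivial⟩

/-! ### Final segments of the rows -/

theorem _root_.List.rtakeWhile_append_of_all {α : Type*} {P : α → Bool} {l m : List α}
    (h : ∀ x ∈ m, P x) : (l ++ m).rtakeWhile P = l.rtakeWhile P ++ m := by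
  simp only [List.rtakeWhile, List.reverse_append]
  rw [List.takeWhile_append_of_pos (by simpa using h)]
  simp

theorem _root_.List.rtakeWhile_append_of_exists {α : Type*} {P : α → Bool} {l m : List α}
    (h : ∃ x ∈ m, ¬ P x) : (l ++ m).rtakeWhile P = m.rtakeWhile P := by
  simp only [List.rtakeWhile, List.reverse_append]
  rw [List.takeWhile_append, if_neg]
  intro h'
  obtain ⟨x, hx, hP⟩ := h
  have h1 : m.reverse.takeWhile P = m.reverse := (List.takeWhile_prefix P).eq_of_length h'
  rw [List.takeWhile_eq_self_iff] at h1
  exact hP (h1 x (by simpa using hx))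

/-- The number of ends with label `c` in the maximal final segments of the rows with labels
satisfying `P`. -/
def tailCount (P : Fin d → Bool) (p : CombType d) (c : Fin d) : ℕ :=
  ((p.row true).rtakeWhile P).count c + ((p.row false).rtakeWhile P).count c

theorem tailCount_eq (P : Fin d → Bool) (p : CombType d) (c : Fin d) (r : Bool) :
    tailCount P p c = ((p.row r).rtakeWhile P).count c + ((p.row !r).rtakeWhile P).count c := by
  cases r
  · exact add_comm _ _
  · rfl

/-- If all labels between the winner's other end and the critical position passed by that row
satisfy `P`, both ends of the winner lie in the final segments and the loser is reinserted inside
them. Otherwise the loser's end is lost behind a label outside `P`, which is the strict decrease. -/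
theorem SplitForm.tailCount {p q : CombType d} {r : Bool} {a b : Fin d} (h : p.SplitForm r a b q)
    {P : Fin d → Bool} (ha : P a) (hb : P b) :
    (2 ≤ tailCount P p a ∧ ∀ c, tailCount P q c = tailCount P p c) ∨
      (tailCount P q b < tailCount P p b ∧ ∀ c, tailCount P q c ≤ tailCount P p c) := by
  simp only [tailCount_eq P _ _ r]
  rcases h with ⟨u, v, w, h1, h2, h3, h4⟩ | ⟨u, v, w, h1, h2, h3, h4⟩
  · by_cases hw : ∀ x ∈ w, P x
    · left
      have e1 : (p.row r).rtakeWhile P = u.rtakeWhile P ++ [a] := by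
        rw [h1, List.rtakeWhile_append_of_all (by simpa using ha)]
      have e2 : (p.row !r).rtakeWhile P = v.rtakeWhile P ++ ([a] ++ w ++ [b]) := by
        rw [h2, List.append_assoc, List.append_assoc, List.rtakeWhile_append_of_all]
        · simp
        · simp only [List.mem_append, List.mem_singleton]
          rintro x (rfl | h | rfl) <;> simp_all
      have e4 : (q.row !r).rtakeWhile P = v.rtakeWhile P ++ ([a, b] ++ w) := by
        rw [h4, List.append_assoc, List.rtakeWhile_append_of_all]
        simp only [List.mem_append, List.mem_cons]
        rintro x ((rfl | rfl | h) | h) <;> simp_all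
      rw [h3, ← h1, e1, e2, e4]
      refine ⟨?_, fun c => ?_⟩ <;>
        simp only [List.count_append, List.count_cons, List.count_nil, beq_self_eq_true,
          if_true] <;> omega
    · right
      push Not at hw
      obtain ⟨x, hx, hPx⟩ := hw
      have e2 : (p.row !r).rtakeWhile P = w.rtakeWhile P ++ [b] := by
        rw [h2, List.rtakeWhile_append_of_all (by simpa using hb),
          List.rtakeWhile_append_of_exists ⟨x, hx, hPx⟩]
      have e4 : (q.row !r).rtakeWhile P = w.rtakeWhile P := by
        rw [h4, List.rtakeWhile_append_of_exists ⟨x, hx, hPx⟩]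
      rw [h3, ← h1, e2, e4]
      simp
  · by_cases hv : ∀ x ∈ v, P x
    · left
      have e1 : (p.row r).rtakeWhile P = u.rtakeWhile P ++ ([a] ++ v ++ [a]) := by
        rw [h1, List.append_assoc, List.append_assoc, List.rtakeWhile_append_of_all]
        · simp
        · simp only [List.mem_append, List.mem_singleton]
          rintro x (rfl | h | rfl) <;> simp_all
      have e2 : (p.row !r).rtakeWhile P = w.rtakeWhile P ++ [b] := by
        rw [h2, List.rtakeWhile_append_of_all (by simpa using hb)]
      have e3 : (q.row r).rtakeWhile P = u.rtakeWhile P ++ ([b, a] ++ v ++ [a]) := by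
        rw [h3, List.append_assoc, List.append_assoc, List.rtakeWhile_append_of_all]
        · simp
        · simp only [List.mem_append, List.mem_cons]
          rintro x ((rfl | rfl | h) | h | rfl | h) <;> simp_all
      rw [e1, e2, e3, h4]
      refine ⟨?_, fun c => ?_⟩ <;>
        simp only [List.count_append, List.count_cons, List.count_nil, beq_self_eq_true,
          if_true] <;> omega
    · right
      push Not at hv
      obtain ⟨x, hx, hPx⟩ := hv
      have hva : ∃ x ∈ v ++ [a], ¬ P x := ⟨x, by simp [hx], hPx⟩
      have e1 : (p.row r).rtakeWhile P = (v ++ [a]).rtakeWhile P := by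
        rw [h1, List.append_assoc, List.rtakeWhile_append_of_exists hva]
      have e3 : (q.row r).rtakeWhile P = (v ++ [a]).rtakeWhile P := by
        rw [h3, List.append_assoc, List.rtakeWhile_append_of_exists hva]
      have e2 : (p.row !r).rtakeWhile P = w.rtakeWhile P ++ [b] := by
        rw [h2, List.rtakeWhile_append_of_all (by simpa using hb)]
      rw [e1, e2, e3, h4]
      simp

/-- If all ends of the bands in `P` lie in the final segments, the rows split into blocks. -/
theorem exists_blocks_of_tailCount {P : Fin d → Bool} {p : CombType d}
    (h : ∀ c, P c → 2 ≤ tailCount P p c) :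
    ∃ k : Bool → ℕ, (∀ x, k x + ((p.row x).rtakeWhile P).length = (p.row x).length) ∧
      ∀ x i c, p.lab (x, i) = some c → (P c ↔ k x ≤ i) := by
  refine ⟨fun x => ((p.row x).rdropWhile P).length, fun x => ?_, fun x i c hc => ?_⟩
  · conv_rhs => rw [← List.rdropWhile_append_rtakeWhile (p := P) (l := p.row x)]
    rw [List.length_append]
  · have hdt := List.rdropWhile_append_rtakeWhile (p := P) (l := p.row x)
    rw [lab, ← hdt] at hc
    constructor
    · intro hP
      by_contra! hi
      rw [List.getElem?_append_left hi] at hc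
      have h1 : 0 < ((p.row x).rdropWhile P).count c :=
        List.count_pos_iff.2 (List.mem_of_getElem? hc)
      have h2 := h c hP
      have h3 := p.count_add_count x c
      rw [tailCount_eq P p c x] at h2
      have h4 : ((p.row !x).rtakeWhile P).count c ≤ (p.row !x).count c :=
        (List.rtakeWhile_suffix P _).sublist.count_le c
      rw [← hdt, List.count_append] at h3
      omega
    · intro hi
      rw [List.getElem?_append_right hi] at hc
      exact List.mem_rtakeWhile_imp (List.mem_of_getElem? hc)

/-! ### Infinite sequences of Rauzy induction -/

/-- An infinite sequence of steps of Rauzy induction: the types, the widths, and for any step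
the winner, the loser and the row of the winner. -/
structure RauzySeq (t : ℕ → CombType d) (w : ℕ → Fin d → ℝ) (a b : ℕ → Fin d) (r : ℕ → Bool) :
    Prop where
  split : ∀ n, (t n).SplitForm (r n) (a n) (b n) (t (n + 1))
  pos : ∀ n c, 0 < w n c
  width : ∀ n, w (n + 1) = Function.update (w n) (a n) (w n (a n) - w n (b n))

theorem SplitForm.getLast? {p q : CombType d} {r : Bool} {a b : Fin d} (h : p.SplitForm r a b q) :
    (p.row r).getLast? = some a ∧ (p.row !r).getLast? = some b ∧ (q.row r).getLast? = some a := by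
  rcases h with ⟨u, v, w, h1, h2, h3, h4⟩ | ⟨u, v, w, h1, h2, h3, h4⟩ <;>
    simp only [h1, h2, h3, List.getLast?_concat, and_self]

/-- The end of the winner keeps its critical position, so the winner is one of the next two
competitors. -/
theorem SplitForm.winner_stays {p q p' : CombType d} {r r' : Bool} {a b a' b' : Fin d}
    (h : p.SplitForm r a b q) (h' : q.SplitForm r' a' b' p') : a' = a ∨ b' = a := by
  have h1 := h.getLast?.2.2
  obtain ⟨h2, h3, -⟩ := h'.getLast?
  by_cases hr : r = r'
  · subst hr
    rw [h1] at h2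
    exact Or.inl (Option.some_injective _ h2).symm
  · have : r = !r' := by cases r <;> cases r' <;> simp at hr ⊢
    subst this
    rw [h1] at h3
    exact Or.inr (Option.some_injective _ h3).symm

theorem abs_sgn_le (p : CombType d) (c : Fin d) : |(p.sgn c : ℝ)| ≤ 1 := by
  have h := p.count_add_count true c
  simp only [row, Bool.not_true] at h
  have : |p.sgn c| ≤ 1 := by
    rw [abs_le, sgn]; omega
  exact_mod_cast this

namespace RauzySeq

variable {t : ℕ → CombType d} {w : ℕ → Fin d → ℝ} {a b : ℕ → Fin d} {r : ℕ → Bool}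

theorem width_of_ne (h : RauzySeq t w a b r) {n : ℕ} {c : Fin d} (hc : a n ≠ c) :
    w (n + 1) c = w n c := by
  rw [h.width, Function.update_of_ne hc.symm]

theorem antitone (h : RauzySeq t w a b r) (c : Fin d) : Antitone fun n => w n c := by
  refine antitone_nat_of_succ_le fun n => ?_
  by_cases hc : a n = c
  · subst hc
    rw [h.width, Function.update_self]
    linarith [h.pos n (b n)]
  · rw [h.width_of_ne hc]

theorem sum_width (h : RauzySeq t w a b r) (n : ℕ) :
    ∑ c, w n c - ∑ c, w (n + 1) c = w n (b n) := by
  rw [h.width, ← Finset.sum_sub_distrib, Finset.sum_eq_single (a n)]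
  · simp
  · intro c _ hc
    simp [Function.update_of_ne hc]
  · simp

/-- Each step lowers the total width by the width of the loser, and the total width is bounded
below. -/
theorem tendsto_loser (h : RauzySeq t w a b r) :
    Filter.Tendsto (fun n => w n (b n)) Filter.atTop (nhds 0) := by
  have hanti : Antitone fun n => ∑ c, w n c :=
    fun m n hmn => Finset.sum_le_sum fun c _ => h.antitone c hmn
  have hbdd : BddBelow (Set.range fun n => ∑ c, w n c) :=
    ⟨0, by rintro _ ⟨n, rfl⟩; exact Finset.sum_nonneg fun c _ => (h.pos n c).le⟩
  have h1 := tendsto_atTop_ciInf hanti hbdd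
  have h2 := h1.sub (h1.comp (Filter.tendsto_add_atTop_nat 1))
  rw [sub_self] at h2
  refine h2.congr fun n => ?_
  exact h.sum_width n

/-- The width of a band which wins finitely often is eventually a positive constant, whereas the
widths of losers tend to zero. -/
theorem eventually_ne_loser (h : RauzySeq t w a b r) {c : Fin d}
    (hc : ¬ ∃ᶠ n in Filter.atTop, a n = c) : ∀ᶠ n in Filter.atTop, b n ≠ c := by
  rw [Filter.not_frequently, Filter.eventually_atTop] at hc
  obtain ⟨N, hN⟩ := hc
  have hconst : ∀ n ≥ N, w n c = w N c := by
    intro n hn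
    induction n, hn using Nat.le_induction with
    | base => rfl
    | succ n hn ih => rw [h.width_of_ne (hN n hn), ih]
  filter_upwards [h.tendsto_loser.eventually_lt_const (h.pos N c), Filter.eventually_ge_atTop N]
    with n hn hNn hb
  rw [hb, hconst n hNn] at hn
  exact lt_irrefl _ hn

/-- A band which has just won and never loses again wins forever, since it stays critical. Its
opponents would then win only finitely often, hence would eventually not lose either. -/
theorem frequently_loses (h : RauzySeq t w a b r) {c : Fin d}
    (hc : ∃ᶠ n in Filter.atTop, a n = c) : ∃ᶠ n in Filter.atTop, b n = c := by
  by_contra hcon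
  rw [Filter.not_frequently] at hcon
  have h1 : ∀ᶠ n in Filter.atTop, ∀ e, (¬ ∃ᶠ n in Filter.atTop, a n = e) → b n ≠ e := by
    rw [Filter.eventually_all]
    intro e
    by_cases he : ∃ᶠ n in Filter.atTop, a n = e
    · exact Filter.Eventually.of_forall fun n h' => absurd he h'
    · filter_upwards [h.eventually_ne_loser he] with n hn _ using hn
  obtain ⟨N, hN⟩ := Filter.eventually_atTop.1 (hcon.and h1)
  obtain ⟨n, hn, hac⟩ := Filter.frequently_atTop.1 hc N
  have h2 : ∀ m ≥ n, a m = c := by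
    intro m hm
    induction m, hm using Nat.le_induction with
    | base => exact hac
    | succ m hm ih =>
      rcases (h.split m).winner_stays (h.split (m + 1)) with h3 | h3
      · rw [h3, ih]
      · exact absurd (h3.trans ih) (hN (m + 1) (by omega)).1
  have h3 : ∃ᶠ m in Filter.atTop, a m = b n := by
    by_contra h4
    exact (hN n hn).2 _ h4 rfl
  obtain ⟨m, hm, h4⟩ := Filter.frequently_atTop.1 h3 n
  exact (hN n hn).1 (h4.symm.trans (h2 m hm))

/-- The widths of the band decrease, and at the infinitely many times when it loses they are widths
of losers. -/
theorem tendsto_width (h : RauzySeq t w a b r) {c : Fin d}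
    (hc : ∃ᶠ n in Filter.atTop, a n = c) : Filter.Tendsto (fun n => w n c) Filter.atTop (nhds 0) := by
  have hbdd : BddBelow (Set.range fun n => w n c) :=
    ⟨0, by rintro _ ⟨n, rfl⟩; exact (h.pos n c).le⟩
  have h1 := tendsto_atTop_ciInf (h.antitone c) hbdd
  have h2 : ⨅ n, w n c = 0 := by
    refine le_antisymm (le_of_forall_pos_le_add fun ε hε => ?_)
      (le_ciInf fun n => (h.pos n c).le)
    obtain ⟨n, hb, hn⟩ := ((h.frequently_loses hc).and_eventually
      (h.tendsto_loser.eventually_lt_const hε)).exists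
    rw [hb] at hn
    rw [zero_add]
    exact (ciInf_le hbdd n).trans hn.le
  rwa [h2] at h1

/-- If some bands win only finitely often, then the rows eventually split into two blocks, the first
of which is balanced. -/
theorem exists_blocks (h : RauzySeq t w a b r) (hsw : ∀ n, (t n).SwitchCondition (w n)) :
    ∃ (n : ℕ) (V : Finset (Fin d)) (k : Bool → ℕ),
      (∀ c, c ∈ V ↔ ¬ ∃ᶠ n in Filter.atTop, a n = c) ∧ (∃ c, c ∉ V) ∧
      (∀ x, k x < ((t n).row x).length) ∧
      (∀ x i c, (t n).lab (x, i) = some c → (c ∈ V ↔ i < k x)) ∧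
      ∑ c ∈ V, ((t n).sgn c : ℝ) * w n c = 0 := by
  classical
  set V : Finset (Fin d) := Finset.univ.filter fun c => ¬ ∃ᶠ n in Filter.atTop, a n = c with hVdef
  have hV : ∀ c, c ∈ V ↔ ¬ ∃ᶠ n in Filter.atTop, a n = c := by simp [hVdef]
  have h1 : ∀ᶠ n in Filter.atTop, ∀ c ∈ V, a n ≠ c ∧ b n ≠ c := by
    rw [Filter.eventually_all_finset]
    intro c hc
    rw [hV] at hc
    exact (Filter.not_frequently.1 hc).and (h.eventually_ne_loser hc)
  obtain ⟨N, hN⟩ := Filter.eventually_atTop.1 h1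
  have haV : ∀ n ≥ N, a n ∉ V := fun n hn hc => (hN n hn _ hc).1 rfl
  have hbV : ∀ n ≥ N, b n ∉ V := fun n hn hc => (hN n hn _ hc).2 rfl
  let P : Fin d → Bool := fun c => decide (c ∉ V)
  have hP : ∀ c, P c ↔ c ∉ V := fun c => by simp [P]
  have hstep : ∀ n ≥ N, _ := fun n hn =>
    (h.split n).tailCount (P := P) ((hP _).2 (haV n hn)) ((hP _).2 (hbV n hn))
  -- From the time of the least total count on, no end can leave the final segments. Every later
  -- winner then has both its ends there, which covers all bands outside `V`.
  obtain ⟨m, hm, hmin⟩ : ∃ m ≥ N, ∀ n ≥ N,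
      ∑ c, tailCount P (t m) c ≤ ∑ c, tailCount P (t n) c := by
    let T : ℕ → ℕ := fun n => ∑ c, tailCount P (t n) c
    refine ⟨Function.argminOn T (Set.Ici N) ⟨N, Set.mem_Ici.2 le_rfl⟩,
      Function.argminOn_mem T (Set.Ici N) ⟨N, Set.mem_Ici.2 le_rfl⟩, fun n hn =>
      Function.argminOn_le T (Set.Ici N) hn⟩
  have hmono : ∀ n ≥ m, ∀ c, tailCount P (t n) c = tailCount P (t m) c := by
    intro n hn
    induction n, hn using Nat.le_induction with
    | base => exact fun _ => rfl
    | succ n hn ih =>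
      rcases hstep n (hm.trans hn) with ⟨-, h2⟩ | ⟨h2, h3⟩
      · exact fun c => (h2 c).trans (ih c)
      · have h4 := hmin (n + 1) (by omega)
        have h5 : ∑ c, tailCount P (t (n + 1)) c < ∑ c, tailCount P (t n) c :=
          Finset.sum_lt_sum (fun c _ => h3 c) ⟨_, Finset.mem_univ _, h2⟩
        have h6 : ∑ c, tailCount P (t n) c = ∑ c, tailCount P (t m) c :=
          Finset.sum_congr rfl fun c _ => ih c
        omega
  have h2m : ∀ c, P c → 2 ≤ tailCount P (t m) c := by
    intro c hc
    rw [hP, hV, not_not] at hc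
    obtain ⟨n, hn, rfl⟩ := Filter.frequently_atTop.1 hc m
    rcases hstep n (hm.trans hn) with ⟨h2, -⟩ | ⟨h2, -⟩
    · rwa [← hmono n hn]
    · rw [hmono n hn, hmono (n + 1) (by omega)] at h2
      exact absurd h2 (lt_irrefl _)
  obtain ⟨k, hk1, hk2⟩ := exists_blocks_of_tailCount h2m
  refine ⟨m, V, k, hV, ⟨_, haV m hm⟩, fun x => ?_, fun x i c hc => ?_, ?_⟩
  · have hlast : ∃ c, P c ∧ ((t m).row x).getLast? = some c := by
      obtain ⟨l1, l2, -⟩ := (h.split m).getLast?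
      by_cases hx : x = r m
      · subst hx
        exact ⟨_, (hP _).2 (haV m hm), l1⟩
      · have : x = !(r m) := by
          revert hx
          cases x <;> cases r m <;> simp
        subst this
        exact ⟨_, (hP _).2 (hbV m hm), l2⟩
    obtain ⟨c, hc, hl⟩ := hlast
    obtain ⟨l, hl⟩ := List.getLast?_eq_some_iff.1 hl
    have h5 := hk1 x
    rw [hl, List.rtakeWhile_concat_pos _ _ _ hc] at h5
    rw [hl]
    simp only [List.length_append, List.length_singleton] at h5 ⊢
    omega
  · have := hk2 x i c hc
    rw [hP] at this
    rw [← not_le, ← this, not_not]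
  · -- the sum is constant and tends to zero
    have hconst : ∀ n ≥ m, ∑ c ∈ V, ((t n).sgn c : ℝ) * w n c =
        ∑ c ∈ V, ((t m).sgn c : ℝ) * w m c := by
      intro n hn
      induction n, hn using Nat.le_induction with
      | base => rfl
      | succ n hn ih =>
        rw [← ih]
        refine Finset.sum_congr rfl fun c hc => ?_
        have h3 := hN n (hm.trans hn) c hc
        rw [h.width_of_ne h3.1, (h.split n).sgn_eq, if_neg h3.2.symm, add_zero]
    have hW : ∀ c, c ∉ V → Filter.Tendsto (fun n => ((t n).sgn c : ℝ) * w n c) Filter.atTop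
        (nhds 0) := by
      intro c hc
      rw [hV, not_not] at hc
      refine squeeze_zero_norm (fun n => ?_) (h.tendsto_width hc)
      rw [norm_mul, Real.norm_eq_abs, Real.norm_eq_abs, abs_of_pos (h.pos n c)]
      exact mul_le_of_le_one_left (h.pos n c).le (abs_sgn_le _ _)
    have hWs : Filter.Tendsto (fun n => ∑ c ∈ Vᶜ, ((t n).sgn c : ℝ) * w n c) Filter.atTop
        (nhds 0) := by
      have := tendsto_finsetSum (Vᶜ) fun c hc => hW c (Finset.mem_compl.1 hc)
      simpa using this
    have hVs : ∀ n ≥ m, ∑ c ∈ V, ((t m).sgn c : ℝ) * w m c =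
        - ∑ c ∈ Vᶜ, ((t n).sgn c : ℝ) * w n c := by
      intro n hn
      have h3 := ((t n).switchCondition_iff _).1 (hsw n)
      rw [← Finset.sum_add_sum_compl V, hconst n hn] at h3
      linarith
    have h4 : Filter.Tendsto (fun _ : ℕ => ∑ c ∈ V, ((t m).sgn c : ℝ) * w m c) Filter.atTop
        (nhds (-0)) := by
      refine hWs.neg.congr' ?_
      filter_upwards [Filter.eventually_ge_atTop m] with n hn
      rw [hVs n hn]
    rw [neg_zero] at h4
    exact tendsto_nhds_unique tendsto_const_nhds h4

/-- In a generic infinite sequence of complete types, every band wins infinitely often. -/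
theorem frequently_wins (h : RauzySeq t w a b r) (hsw : ∀ n, (t n).SwitchCondition (w n))
    (hc : ∀ n, (t n).Complete)
    (hgen : ∀ n (V : Finset (Fin d)), ∑ c ∈ V, ((t n).sgn c : ℝ) * w n c = 0 →
      (∀ c ∈ V, (t n).sgn c = 0) ∨ ∀ c ∉ V, (t n).sgn c = 0) (c : Fin d) :
    ∃ᶠ n in Filter.atTop, a n = c := by
  obtain ⟨n, V, k, hV, hW, hk, hlab, hsum⟩ := h.exists_blocks hsw
  by_contra hcV
  rw [← hV] at hcV
  rcases hgen n V hsum with h0 | h0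
  · exact (hc n).no_initial_block (Or.inl hk) hlab h0 ⟨c, hcV⟩
  -- If the initial block missed a row, all its bands would be reversing in the other row with a
  -- common sign, and their positive widths could not cancel.
  · have hk0 : ∀ x, 0 < k x := by
      intro x
      by_contra hx
      have hx0 : k x = 0 := by omega
      have h1 : ∀ e ∈ V, ((t n).row x).count e = 0 := by
        intro e he
        rw [List.count_eq_zero]
        intro hmem
        obtain ⟨i, hi⟩ := List.getElem?_of_mem hmem
        have := (hlab x i e hi).1 he
        omega
      have hne : ∑ e ∈ V, w n e ≠ 0 :=
        (Finset.sum_pos (fun e _ => h.pos n e) ⟨c, hcV⟩).ne'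
      have hx2 : ∀ e ∈ V, (t n).sgn e = if x then -1 else 1 := by
        intro e he
        have h2 := h1 e he
        have h3 := (t n).count_add_count x e
        cases x <;> simp [sgn, row] at h2 h3 ⊢ <;> omega
      apply hne
      have h4 : ∑ e ∈ V, ((t n).sgn e : ℝ) * w n e = (if x then -1 else 1) * ∑ e ∈ V, w n e := by
        rw [Finset.mul_sum]
        refine Finset.sum_congr rfl fun e he => ?_
        rw [hx2 e he]
        cases x <;> simp
      rw [hsum] at h4
      cases x <;> simpa using h4.symm
    refine (hc n).no_final_block (V := fun c => c ∉ V) hk0 (fun x => (hk x).le)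
      (fun x i e he => ?_) h0 hW
    rw [hlab x i e he, not_lt]

end RauzySeq

/-! ### Finiteness of the set of types, and the properties of sinks that are needed. -/

instance : Finite (CombType d) := by
  have hf : Function.Injective (fun p : CombType d => (p.top, p.bot)) := by
    intro p q h
    simp only [Prod.mk.injEq] at h
    exact CombType.ext h.1 h.2
  have hfin : (Set.range fun p : CombType d => (p.top, p.bot)).Finite := by
    refine ((List.finite_length_le (Fin d) (2 * d)).prod
      (List.finite_length_le (Fin d) (2 * d))).subset ?_
    rintro _ ⟨p, rfl⟩
    exact ⟨p.length_row_le true, p.length_row_le false⟩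
  exact (Set.finite_range_iff hf).1 hfin

/-- The labelled types of a set of non-classical types closed under Rauzy induction, on which Rauzy
induction is generically possible. -/
structure SinkSet (G : Set (CombType d)) : Prop where
  complete : ∀ p ∈ G, p.Complete
  recurrent : ∀ p ∈ G, p.Recurrent
  split : ∀ p ∈ G, ∀ a b q, p.Split a b q → q.Recurrent → q ∈ G
  exists_lt : ∀ p ∈ G, ∃ (r : Bool) (a b : Fin d) (w : Fin d → ℝ), (p.row r).getLast? = some a ∧
    (p.row !r).getLast? = some b ∧ (∀ c, 0 < w c) ∧ p.SwitchCondition w ∧ w b < w a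

/-- For the locus of equal critical widths to be null it suffices that the widths can differ, a
condition which does not distinguish the two rows. -/
theorem SinkSet.exists_getLast? {G : Set (CombType d)} (hG : SinkSet G) {p : CombType d}
    (hp : p ∈ G) (r : Bool) : ∃ a b, a ≠ b ∧ (p.row r).getLast? = some a ∧
      (p.row !r).getLast? = some b ∧
      ∃ w : Fin d → ℝ, p.SwitchCondition w ∧ w a ≠ w b := by
  obtain ⟨r', a, b, w, h1, h2, -, h3, h4⟩ := hG.exists_lt p hp
  have hab : a ≠ b := by rintro rfl; exact lt_irrefl _ h4
  by_cases hr : r = r'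
  · subst hr
    exact ⟨a, b, hab, h1, h2, w, h3, h4.ne'⟩
  · have : r' = !r := by
      revert hr
      cases r <;> cases r' <;> simp
    subst this
    rw [Bool.not_not] at h2
    exact ⟨b, a, hab.symm, h2, h1, w, h3, h4.ne⟩

end CombType

/-! ### Stages with integer matrices: widths, column norms and single steps. -/

open CombType

/-- A type together with the matrix of an expansion leading to it, and the inverse matrix. -/
structure RState (d : ℕ) where
  typ : CombType d
  mat : Matrix (Fin d) (Fin d) ℤ
  inv : Matrix (Fin d) (Fin d) ℤ

namespace RState

variable {d : ℕ}

instance : Countable (RState d) := by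
  have hf : Function.Injective (fun σ : RState d => (σ.typ, σ.mat, σ.inv)) := by
    rintro ⟨_, _, _⟩ ⟨_, _, _⟩ h
    simpa using h
  have : Countable (Matrix (Fin d) (Fin d) ℤ) := inferInstanceAs (Countable (Fin d → Fin d → ℤ))
  exact hf.countable

/-- The widths at a stage in terms of the initial widths. -/
def wd (σ : RState d) (x : Fin d → ℝ) : Fin d → ℝ :=
  ((Int.castRingHom ℝ).mapMatrix σ.inv).mulVec x

/-- The initial widths in terms of the widths at a stage. -/
def unwd (σ : RState d) (x : Fin d → ℝ) : Fin d → ℝ :=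
  ((Int.castRingHom ℝ).mapMatrix σ.mat).mulVec x

/-- The norms of the columns. -/
def colNorm (σ : RState d) (c : Fin d) : ℝ := ∑ i, (σ.mat i c : ℝ)

/-- The states which occur in expansions starting at `p₀`, with types in `G`. -/
structure Valid (p₀ : CombType d) (G : Set (CombType d)) (σ : RState d) : Prop where
  mem : σ.typ ∈ G
  mat_inv : σ.mat * σ.inv = 1
  inv_mat : σ.inv * σ.mat = 1
  nonneg : ∀ i j, 0 ≤ σ.mat i j
  sgn : ∀ c, ∑ i, p₀.sgn i * σ.mat i c = σ.typ.sgn c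

theorem wd_add (σ : RState d) (x y : Fin d → ℝ) : σ.wd (x + y) = σ.wd x + σ.wd y :=
  Matrix.mulVec_add _ _ _

theorem wd_smul (σ : RState d) (s : ℝ) (x : Fin d → ℝ) : σ.wd (s • x) = s • σ.wd x :=
  Matrix.mulVec_smul _ _ _

/-- The initial state. -/
def root (p₀ : CombType d) : RState d := ⟨p₀, 1, 1⟩

theorem wd_root (p₀ : CombType d) (x : Fin d → ℝ) : (root p₀).wd x = x := by
  simp [wd, root]

theorem valid_root {p₀ : CombType d} {G : Set (CombType d)} (h : p₀ ∈ G) : Valid p₀ G (root p₀) where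
  mem := h
  mat_inv := by simp [root]
  inv_mat := by simp [root]
  nonneg i j := by
    simp only [root, Matrix.one_apply]
    split_ifs <;> simp
  sgn c := by simp [root, Matrix.one_apply]

/-- One step of Rauzy induction in which the band at the end of row `r` wins against the other
critical band. -/
def IsChild (r : Bool) (a b : Fin d) (σ τ : RState d) : Prop :=
  σ.typ.SplitForm r a b τ.typ ∧ τ.mat = σ.mat * (1 + Matrix.single a b 1) ∧
    τ.inv = (1 - Matrix.single a b 1) * σ.inv

open Classical in
/-- A type obtained by one step of Rauzy induction in which the end of row `r` wins. -/
noncomputable def next (r : Bool) (p : CombType d) : CombType d :=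
  if h : ∃ q a b, p.SplitForm r a b q then h.choose else p

theorem splitForm_next {r : Bool} {a b : Fin d} {p : CombType d} (ha : (p.row r).getLast? = some a)
    (hb : (p.row !r).getLast? = some b) (hab : a ≠ b) : p.SplitForm r a b (next r p) := by
  have h : ∃ q a b, p.SplitForm r a b q := by
    obtain ⟨x, hx⟩ := List.getLast?_eq_some_iff.1 ha
    obtain ⟨y, hy⟩ := List.getLast?_eq_some_iff.1 hb
    obtain ⟨q, hq⟩ := p.exists_splitForm r hx hy hab
    exact ⟨q, a, b, hq⟩
  have h1 : next r p = h.choose := dif_pos h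
  obtain ⟨a', b', h2⟩ := h.choose_spec
  rw [← h1] at h2
  obtain ⟨h3, h4, -⟩ := h2.getLast?
  rw [ha] at h3
  rw [hb] at h4
  rwa [Option.some_injective _ h3, Option.some_injective _ h4]

open Classical in
/-- The state obtained by one step of Rauzy induction in which the end of row `r` wins. -/
noncomputable def child (r : Bool) (σ : RState d) : RState d :=
  if h : ∃ τ a b, IsChild r a b σ τ ∧ τ.typ = next r σ.typ then h.choose else σ

theorem isChild_child {r : Bool} {a b : Fin d} {σ : RState d} (ha : (σ.typ.row r).getLast? = some a)
    (hb : (σ.typ.row !r).getLast? = some b) (hab : a ≠ b) :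
    IsChild r a b σ (child r σ) ∧ (child r σ).typ = next r σ.typ := by
  have h : ∃ τ a b, IsChild r a b σ τ ∧ τ.typ = next r σ.typ :=
    ⟨⟨next r σ.typ, _, _⟩, a, b, ⟨splitForm_next ha hb hab, rfl, rfl⟩, rfl⟩
  have h1 : child r σ = h.choose := dif_pos h
  obtain ⟨a', b', h2, h5⟩ := h.choose_spec
  rw [← h1] at h2 h5
  obtain ⟨h3, h4, -⟩ := h2.1.getLast?
  rw [ha] at h3
  rw [hb] at h4
  refine ⟨?_, h5⟩
  rwa [Option.some_injective _ h3, Option.some_injective _ h4]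

theorem IsChild.wd {r : Bool} {a b : Fin d} {σ τ : RState d} (h : IsChild r a b σ τ)
    (x : Fin d → ℝ) : τ.wd x = Function.update (σ.wd x) a (σ.wd x a - σ.wd x b) := by
  rw [RState.wd, h.2.2, map_mul, ← Matrix.mulVec_mulVec]
  rw [show ((Int.castRingHom ℝ).mapMatrix σ.inv).mulVec x = σ.wd x from rfl]
  have h1 : (Int.castRingHom ℝ).mapMatrix (1 - Matrix.single a b 1) = 1 - Matrix.single a b (1 : ℝ) := by
    rw [map_sub, map_one]
    congr 1
    ext i j
    simp [Matrix.single_apply]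
  rw [h1, Matrix.sub_mulVec, Matrix.one_mulVec]
  ext c
  by_cases hc : c = a
  · subst hc
    simp [Matrix.single_mulVec]
  · simp [Matrix.single_mulVec, hc]

theorem IsChild.mat_apply {r : Bool} {a b : Fin d} {σ τ : RState d} (h : IsChild r a b σ τ)
    (i c : Fin d) : τ.mat i c = σ.mat i c + if c = b then σ.mat i a else 0 := by
  rw [h.2.1, mul_add, mul_one, Matrix.add_apply]
  congr 1
  by_cases hc : c = b
  · subst hc
    simp
  · simp [hc]

theorem IsChild.colNorm {r : Bool} {a b : Fin d} {σ τ : RState d} (h : IsChild r a b σ τ)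
    (c : Fin d) : τ.colNorm c = σ.colNorm c + if c = b then σ.colNorm a else 0 := by
  simp only [RState.colNorm, h.mat_apply, Int.cast_add, Finset.sum_add_distrib]
  congr 1
  split_ifs <;> simp

variable {p₀ : CombType d} {G : Set (CombType d)}

theorem IsChild.valid {r : Bool} {a b : Fin d} {σ τ : RState d} (h : IsChild r a b σ τ)
    (hσ : Valid p₀ G σ) (hτ : τ.typ ∈ G) : Valid p₀ G τ where
  mem := hτ
  mat_inv := by
    have h1 : (1 + Matrix.single a b (1 : ℤ)) * (1 - Matrix.single a b 1) = 1 := by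
      rw [show (1 + Matrix.single a b (1 : ℤ)) * (1 - Matrix.single a b 1) =
        1 - Matrix.single a b 1 * Matrix.single a b 1 by noncomm_ring,
        Matrix.single_mul_single_of_ne _ _ _ _ h.1.ne.symm, sub_zero]
    rw [h.2.1, h.2.2, mul_assoc, ← mul_assoc _ _ σ.inv, h1, one_mul, hσ.mat_inv]
  inv_mat := by
    have h1 : (1 - Matrix.single a b (1 : ℤ)) * (1 + Matrix.single a b 1) = 1 := by
      rw [show (1 - Matrix.single a b (1 : ℤ)) * (1 + Matrix.single a b 1) =
        1 - Matrix.single a b 1 * Matrix.single a b 1 by noncomm_ring,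
        Matrix.single_mul_single_of_ne _ _ _ _ h.1.ne.symm, sub_zero]
    rw [h.2.1, h.2.2, mul_assoc, ← mul_assoc σ.inv, hσ.inv_mat, one_mul, h1]
  nonneg i j := by
    rw [h.mat_apply]
    have := hσ.nonneg i j
    have := hσ.nonneg i a
    split_ifs <;> omega
  sgn c := by
    simp only [h.mat_apply, h.1.sgn_eq, mul_add, Finset.sum_add_distrib, hσ.sgn]
    congr 1
    split_ifs
    · exact hσ.sgn a
    · simp

theorem Valid.wd_unwd {σ : RState d} (h : Valid p₀ G σ) (x : Fin d → ℝ) : σ.wd (σ.unwd x) = x := by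
  rw [wd, unwd, Matrix.mulVec_mulVec, ← map_mul, h.inv_mat, map_one, Matrix.one_mulVec]

theorem Valid.unwd_wd {σ : RState d} (h : Valid p₀ G σ) (x : Fin d → ℝ) : σ.unwd (σ.wd x) = x := by
  rw [wd, unwd, Matrix.mulVec_mulVec, ← map_mul, h.mat_inv, map_one, Matrix.one_mulVec]

theorem sum_unwd (σ : RState d) (x : Fin d → ℝ) : ∑ i, σ.unwd x i = ∑ c, σ.colNorm c * x c := by
  simp only [unwd, Matrix.mulVec, dotProduct, RingHom.mapMatrix_apply, Matrix.map_apply,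
    Int.coe_castRingHom, colNorm, Finset.sum_mul]
  exact Finset.sum_comm

/-- This identity converts lower bounds for columns into upper bounds for widths and conversely; all
estimates of probabilities rest on it. -/
theorem Valid.sum_eq {σ : RState d} (h : Valid p₀ G σ) (x : Fin d → ℝ) :
    ∑ i, x i = ∑ c, σ.colNorm c * σ.wd x c := by
  rw [← sum_unwd, h.unwd_wd]

theorem Valid.switch_unwd {σ : RState d} (h : Valid p₀ G σ) (x : Fin d → ℝ) :
    p₀.SwitchCondition (σ.unwd x) ↔ σ.typ.SwitchCondition x := by
  rw [switchCondition_iff, switchCondition_iff]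
  have : ∑ i, (p₀.sgn i : ℝ) * σ.unwd x i = ∑ c, (σ.typ.sgn c : ℝ) * x c := by
    simp only [← h.sgn, unwd, Matrix.mulVec, dotProduct, RingHom.mapMatrix_apply, Matrix.map_apply,
      Int.coe_castRingHom, Finset.mul_sum, Int.cast_sum, Int.cast_mul, Finset.sum_mul]
    rw [Finset.sum_comm]
    simp only [mul_assoc]
  rw [this]

theorem Valid.switch_wd {σ : RState d} (h : Valid p₀ G σ) (x : Fin d → ℝ) :
    σ.typ.SwitchCondition (σ.wd x) ↔ p₀.SwitchCondition x := by
  rw [← h.switch_unwd, h.unwd_wd]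

theorem Valid.colNorm_nonneg {σ : RState d} (h : Valid p₀ G σ) (c : Fin d) : 0 ≤ σ.colNorm c :=
  Finset.sum_nonneg fun i _ => by exact_mod_cast h.nonneg i c

theorem Valid.colNorm_pos {σ : RState d} (h : Valid p₀ G σ) (c : Fin d) : 0 < σ.colNorm c := by
  refine (h.colNorm_nonneg c).lt_of_ne fun h0 => ?_
  have h1 : ∀ i, σ.mat i c = 0 := by
    intro i
    have := (Finset.sum_eq_zero_iff_of_nonneg fun i _ => by exact_mod_cast h.nonneg i c).1 h0.symm
      i (Finset.mem_univ i)
    exact_mod_cast this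
  have h2 := congrFun (congrFun h.inv_mat c) c
  simp [Matrix.mul_apply, h1] at h2

theorem Valid.unwd_nonneg {σ : RState d} (h : Valid p₀ G σ) {x : Fin d → ℝ} (hx : ∀ c, 0 ≤ x c)
    (i : Fin d) : 0 ≤ σ.unwd x i := by
  simp only [unwd, Matrix.mulVec, dotProduct, RingHom.mapMatrix_apply, Matrix.map_apply,
    Int.coe_castRingHom]
  exact Finset.sum_nonneg fun c _ => mul_nonneg (by exact_mod_cast h.nonneg i c) (hx c)

end RState

/-- The hyperplane of the switch condition. -/
noncomputable def switchSpace {d : ℕ} (p : CombType d) : Submodule ℝ (EuclideanSpace ℝ (Fin d)) where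
  carrier := {x | ∑ a, (p.sgn a : ℝ) * x a = 0}
  add_mem' := by
    intro x y hx hy
    simp only [Set.mem_ofPred_eq, PiLp.add_apply, mul_add, Finset.sum_add_distrib] at hx hy ⊢
    rw [hx, hy, add_zero]
  zero_mem' := by simp
  smul_mem' := by
    intro c x hx
    simp only [Set.mem_ofPred_eq, PiLp.smul_apply, smul_eq_mul, mul_left_comm _ c,
      ← Finset.mul_sum] at hx ⊢
    rw [hx, mul_zero]

theorem mem_switchSpace {d : ℕ} {p : CombType d} {x : EuclideanSpace ℝ (Fin d)} :
    x ∈ switchSpace p ↔ p.SwitchCondition fun a => x a := by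
  rw [switchCondition_iff]
  rfl

/-! ### Trees of cells -/

/-- A binary tree of measurable cells: up to null sets, every cell is the disjoint union of the cells
of its two children. Only states with nonempty cell are required to be valid. -/
structure CellTree {X S : Type*} [MeasurableSpace X] (μ : Measure X) (cell : S → Set X)
    (valid : S → Prop) (ch : Bool → S → S) : Prop where
  meas : ∀ σ, MeasurableSet (cell σ)
  sub : ∀ σ, valid σ → ∀ r, cell (ch r σ) ⊆ cell σ
  disj : ∀ σ, valid σ → Disjoint (cell (ch true σ)) (cell (ch false σ))
  cover : ∀ σ, valid σ → μ (cell σ \ (cell (ch true σ) ∪ cell (ch false σ))) = 0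
  child : ∀ σ, valid σ → ∀ r, (cell (ch r σ)).Nonempty → valid (ch r σ)

namespace CellTree

variable {X S : Type*} {cell : S → Set X}
  {valid : S → Prop} {ch : Bool → S → S}

open Classical in
/-- The points whose path reaches a state in `T` within `n` steps. -/
noncomputable def hit (cell : S → Set X) (ch : Bool → S → S) (T : S → Prop) : ℕ → S → Set X
  | 0, σ => if T σ then cell σ else ∅
  | n + 1, σ => if T σ then cell σ else
      ⋃ r, cell (ch r σ) ∩ hit cell ch T n (ch r σ)

/-- The points whose path reaches a state in `T`. -/
noncomputable def hits (cell : S → Set X) (ch : Bool → S → S) (T : S → Prop) (σ : S) : Set X :=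
  ⋃ n, hit cell ch T n σ

variable {T : S → Prop}

theorem hit_of_mem {σ : S} (h : T σ) (n : ℕ) : hit cell ch T n σ = cell σ := by
  cases n <;> simp [hit, h]

theorem hits_of_mem {σ : S} (h : T σ) : hits cell ch T σ = cell σ := by
  simp [hits, hit_of_mem h, Set.iUnion_const]

theorem hit_succ {σ : S} (h : ¬ T σ) (n : ℕ) : hit cell ch T (n + 1) σ =
    (cell (ch true σ) ∩ hit cell ch T n (ch true σ)) ∪
      (cell (ch false σ) ∩ hit cell ch T n (ch false σ)) := by
  rw [hit, if_neg h, Set.union_eq_iUnion]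
  congr 1
  ext r
  cases r <;> rfl

/-- The path of a point in the tree. -/
structure Path (cell : S → Set X) (ch : Bool → S → S) (x : X) (s : ℕ → S) (r : ℕ → Bool) : Prop where
  mem : ∀ n, x ∈ cell (s n)
  succ : ∀ n, s (n + 1) = ch (r n) (s n)

theorem Path.shift {x : X} {s : ℕ → S} {r : ℕ → Bool} (h : Path cell ch x s r) (m : ℕ) :
    Path cell ch x (fun n => s (m + n)) fun n => r (m + n) :=
  ⟨fun _ => h.mem _, fun _ => h.succ _⟩

theorem Path.mem_hits {x : X} {s : ℕ → S} {r : ℕ → Bool} (h : Path cell ch x s r) {n : ℕ}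
    (hn : T (s n)) : x ∈ hits cell ch T (s 0) := by
  suffices h' : x ∈ hit cell ch T n (s 0) from Set.mem_iUnion.2 ⟨n, h'⟩
  induction n generalizing s r with
  | zero => rw [hit_of_mem hn]; exact h.mem 0
  | succ n ih =>
    by_cases h0 : T (s 0)
    · rw [hit_of_mem h0]; exact h.mem 0
    · have h1 := ih (s := fun n => s (n + 1)) (r := fun n => r (n + 1))
        ⟨fun _ => h.mem _, fun _ => h.succ _⟩ hn
      have h2 := h.succ 0
      have h3 := h.mem (0 + 1)
      simp only [zero_add] at h1 h2 h3
      rw [hit_succ h0]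
      rw [h2] at h1 h3
      cases hr : r 0 <;> rw [hr] at h1 h3
      · exact Or.inr ⟨h3, h1⟩
      · exact Or.inl ⟨h3, h1⟩

variable [MeasurableSpace X] {μ : Measure X} (H : CellTree μ cell valid ch)
include H

theorem measurableSet_hit (n : ℕ) (σ : S) : MeasurableSet (hit cell ch T n σ) := by
  induction n generalizing σ with
  | zero =>
    rw [hit]
    split_ifs
    · exact H.meas σ
    · exact MeasurableSet.empty
  | succ n ih =>
    by_cases h : T σ
    · rw [hit_of_mem h]; exact H.meas σ
    · rw [hit_succ h]
      exact ((H.meas _).inter (ih _)).union ((H.meas _).inter (ih _))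

theorem measurableSet_hits (σ : S) : MeasurableSet (hits cell ch T σ) :=
  MeasurableSet.iUnion fun n => H.measurableSet_hit n σ

theorem hit_mono {m n : ℕ} (hmn : m ≤ n) {σ : S} (hσ : valid σ) :
    hit cell ch T m σ ⊆ hit cell ch T n σ := by
  induction m generalizing n σ with
  | zero =>
    by_cases h : T σ
    · rw [hit_of_mem h, hit_of_mem h]
    · simp [hit, h]
  | succ m ih =>
    obtain ⟨n, rfl⟩ := Nat.exists_eq_add_of_le' (Nat.le_of_add_left_le hmn : 1 ≤ n)
    by_cases h : T σ
    · rw [hit_of_mem h, hit_of_mem h]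
    · rw [hit_succ h, hit_succ h]
      have key : ∀ r, cell (ch r σ) ∩ hit cell ch T m (ch r σ) ⊆
          cell (ch r σ) ∩ hit cell ch T n (ch r σ) :=
        fun r x hx => ⟨hx.1, ih (by omega) (H.child σ hσ r ⟨x, hx.1⟩) hx.2⟩
      exact Set.union_subset_union (key _) (key _)

theorem inter_hits_child {σ : S} (hσ : valid σ) (r : Bool) :
    cell (ch r σ) ∩ hits cell ch T (ch r σ) ⊆ hits cell ch T σ := by
  rintro x ⟨h1, h2⟩
  by_cases h : T σ
  · rw [hits_of_mem h]
    exact H.sub σ hσ r h1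
  · obtain ⟨n, hn⟩ := Set.mem_iUnion.1 h2
    refine Set.mem_iUnion.2 ⟨n + 1, ?_⟩
    rw [hit_succ h]
    cases r
    · exact Or.inr ⟨h1, hn⟩
    · exact Or.inl ⟨h1, hn⟩

theorem hit_subset (n : ℕ) {σ : S} (hσ : valid σ) : hit cell ch T n σ ⊆ cell σ := by
  by_cases h : T σ
  · rw [hit_of_mem h]
  · cases n with
    | zero => simp [hit, h]
    | succ n =>
      rw [hit_succ h]
      exact Set.union_subset (Set.inter_subset_left.trans (H.sub σ hσ _))
        (Set.inter_subset_left.trans (H.sub σ hσ _))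

theorem hits_subset {σ : S} (hσ : valid σ) : hits cell ch T σ ⊆ cell σ :=
  Set.iUnion_subset fun n => H.hit_subset n hσ

theorem tendsto_hit [IsFiniteMeasure μ] {σ : S} (hσ : valid σ) :
    Filter.Tendsto (fun n => μ.real (hit cell ch T n σ)) Filter.atTop
      (nhds (μ.real (hits cell ch T σ))) := by
  have := tendsto_measure_iUnion_atTop (μ := μ) (s := fun n => hit cell ch T n σ)
    fun m n hmn => H.hit_mono hmn hσ
  exact (ENNReal.tendsto_toReal (measure_ne_top μ _)).comp this

/-- If `T₂` is reached from `T₁` with probability at least `ε`, it is reached from anywhere with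
probability at least `ε` times that of reaching `T₁`. -/
theorem mul_measureReal_hits_le [IsFiniteMeasure μ] {T₁ T₂ : S → Prop} {ε : ℝ} (hε : 0 ≤ ε)
    (h : ∀ τ, valid τ → T₁ τ → ε * μ.real (cell τ) ≤ μ.real (hits cell ch T₂ τ)) {σ : S}
    (hσ : valid σ) : ε * μ.real (hits cell ch T₁ σ) ≤ μ.real (hits cell ch T₂ σ) := by
  have key : ∀ n σ, valid σ → ε * μ.real (hit cell ch T₁ n σ) ≤ μ.real (hits cell ch T₂ σ) := by
    intro n
    induction n with
    | zero =>
      intro σ hσ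
      by_cases h1 : T₁ σ
      · rw [hit_of_mem h1]
        exact h σ hσ h1
      · simp [hit, h1]
    | succ n ih =>
      intro σ hσ
      by_cases h1 : T₁ σ
      · rw [hit_of_mem h1]
        exact h σ hσ h1
      · rw [hit_succ h1]
        have h2 : ∀ r, ε * μ.real (cell (ch r σ) ∩ hit cell ch T₁ n (ch r σ)) ≤
            μ.real (cell (ch r σ) ∩ hits cell ch T₂ (ch r σ)) := by
          intro r
          rcases Set.eq_empty_or_nonempty (cell (ch r σ)) with h0 | h0
          · simp [h0]
          · have hv := H.child σ hσ r h0
            rw [Set.inter_eq_right.2 (H.hits_subset hv), Set.inter_eq_right.2 (H.hit_subset n hv)]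
            exact ih _ hv
        have h3 : μ.real ((cell (ch true σ) ∩ hits cell ch T₂ (ch true σ)) ∪
            (cell (ch false σ) ∩ hits cell ch T₂ (ch false σ))) ≤ μ.real (hits cell ch T₂ σ) :=
          measureReal_mono (Set.union_subset (H.inter_hits_child hσ _) (H.inter_hits_child hσ _))
        rw [measureReal_union ((H.disj σ hσ).mono Set.inter_subset_left Set.inter_subset_left)
          ((H.meas _).inter (H.measurableSet_hits _))] at h3
        have h4 := measureReal_union_le (μ := μ) (cell (ch true σ) ∩ hit cell ch T₁ n (ch true σ))
          (cell (ch false σ) ∩ hit cell ch T₁ n (ch false σ))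
        have h5 := mul_le_mul_of_nonneg_left h4 hε
        rw [mul_add] at h5
        linarith [h2 true, h2 false]
  exact le_of_tendsto ((H.tendsto_hit hσ).const_mul ε)
    (Filter.Eventually.of_forall fun n => key n σ hσ)

/-- If `T` is reached from anywhere with probability at least `ε`, it is reached almost surely. -/
theorem measure_diff_hits_eq_zero [IsFiniteMeasure μ] {ε : ℝ} (hε : 0 < ε) (hε1 : ε ≤ 1)
    (h : ∀ τ, valid τ → ε * μ.real (cell τ) ≤ μ.real (hits cell ch T τ)) {σ : S} (hσ : valid σ) :
    μ (cell σ \ hits cell ch T σ) = 0 := by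
  -- The hypothesis is applied at depth `n` below `σ`, in the cells not yet stopped. For large `n`
  -- these exhaust the missed set itself, which is then at most 1 - ε times as large as itself.
  have key : ∀ n σ, valid σ → μ.real (cell σ \ hits cell ch T σ) ≤
      (1 - ε) * μ.real (cell σ \ hit cell ch T n σ) := by
    intro n
    induction n with
    | zero =>
      intro σ hσ
      by_cases h1 : T σ
      · simp [hits_of_mem h1, hit_of_mem h1]
      · rw [measureReal_sdiff (H.hits_subset hσ) (H.measurableSet_hits σ)]
        simp only [hit, h1, if_false, Set.sdiff_empty]
        linarith [h σ hσ]
    | succ n ih =>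
      intro σ hσ
      by_cases h1 : T σ
      · simp [hits_of_mem h1, hit_of_mem h1]
      · have h2 : ∀ r, μ.real (cell (ch r σ) \ hits cell ch T (ch r σ)) ≤
            (1 - ε) * μ.real (cell (ch r σ) \ hit cell ch T n (ch r σ)) := by
          intro r
          rcases Set.eq_empty_or_nonempty (cell (ch r σ)) with h0 | h0
          · simp [h0]
          · exact ih _ (H.child σ hσ r h0)
        have h3 : cell σ \ hits cell ch T σ ⊆
            (cell σ \ (cell (ch true σ) ∪ cell (ch false σ))) ∪
            ((cell (ch true σ) \ hits cell ch T (ch true σ)) ∪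
              (cell (ch false σ) \ hits cell ch T (ch false σ))) := by
          rintro x ⟨hx, hn⟩
          by_cases h4 : x ∈ cell (ch true σ)
          · exact Or.inr (Or.inl ⟨h4, fun h5 => hn (H.inter_hits_child hσ _ ⟨h4, h5⟩)⟩)
          · by_cases h6 : x ∈ cell (ch false σ)
            · exact Or.inr (Or.inr ⟨h6, fun h5 => hn (H.inter_hits_child hσ _ ⟨h6, h5⟩)⟩)
            · exact Or.inl ⟨hx, by simp [h4, h6]⟩
        have h4 : (cell (ch true σ) \ hit cell ch T n (ch true σ)) ∪
            (cell (ch false σ) \ hit cell ch T n (ch false σ)) ⊆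
            cell σ \ hit cell ch T (n + 1) σ := by
          have hd := Set.disjoint_left.1 (H.disj σ hσ)
          rw [hit_succ h1]
          rintro x (⟨hx, hn⟩ | ⟨hx, hn⟩)
          · refine ⟨H.sub σ hσ _ hx, ?_⟩
            rintro (h5 | h5)
            · exact hn h5.2
            · exact hd hx h5.1
          · refine ⟨H.sub σ hσ _ hx, ?_⟩
            rintro (h5 | h5)
            · exact hd h5.1 hx
            · exact hn h5.2
        have h5 := (measureReal_mono (μ := μ) h3).trans (measureReal_union_le _ _)
        have h6 : μ.real (cell σ \ (cell (ch true σ) ∪ cell (ch false σ))) = 0 := by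
          rw [measureReal_def, H.cover σ hσ, ENNReal.toReal_zero]
        have h7 := measureReal_union_le (μ := μ) (cell (ch true σ) \ hits cell ch T (ch true σ))
          (cell (ch false σ) \ hits cell ch T (ch false σ))
        have h8 := measureReal_mono (μ := μ) h4
        rw [measureReal_union ((H.disj σ hσ).mono Set.sdiff_subset Set.sdiff_subset)
          ((H.meas _).diff (H.measurableSet_hit n _))] at h8
        have h9 := mul_le_mul_of_nonneg_left h8 (sub_nonneg.2 hε1)
        rw [mul_add] at h9
        linarith [h2 true, h2 false]
  have h1 : Filter.Tendsto (fun n => μ.real (cell σ \ hit cell ch T n σ)) Filter.atTop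
      (nhds (μ.real (cell σ \ hits cell ch T σ))) := by
    rw [measureReal_sdiff (H.hits_subset hσ) (H.measurableSet_hits σ)]
    refine ((H.tendsto_hit hσ).const_sub _).congr fun n => ?_
    rw [measureReal_sdiff (H.hit_subset n hσ) (H.measurableSet_hit n σ)]
  have h2 := ge_of_tendsto (h1.const_mul (1 - ε)) (Filter.Eventually.of_forall fun n => key n σ hσ)
  have h3 : μ.real (cell σ \ hits cell ch T σ) = 0 := by
    have h4 : 0 ≤ μ.real (cell σ \ hits cell ch T σ) := measureReal_nonneg
    nlinarith
  exact (measureReal_eq_zero_iff).1 h3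

theorem Path.exists_of_mem_hits {x : X} {s : ℕ → S} {r : ℕ → Bool} (h : Path cell ch x s r)
    (hv : ∀ n, valid (s n)) (hx : x ∈ hits cell ch T (s 0)) : ∃ n, T (s n) := by
  obtain ⟨k, hk⟩ := Set.mem_iUnion.1 hx
  clear hx
  induction k generalizing s r with
  | zero =>
    by_cases h0 : T (s 0)
    · exact ⟨0, h0⟩
    · simp [hit, h0] at hk
  | succ k ih =>
    by_cases h0 : T (s 0)
    · exact ⟨0, h0⟩
    · have h2 := h.succ 0
      have h3 := h.mem (0 + 1)
      rw [h2] at h3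
      have hd := Set.disjoint_left.1 (H.disj _ (hv 0))
      have h4 : x ∈ hit cell ch T k (ch (r 0) (s 0)) := by
        rw [hit_succ h0] at hk
        rcases hk with hk | hk <;> cases hr : r 0 <;> rw [hr] at h3
        · exact absurd h3 (hd hk.1)
        · exact hk.2
        · exact hk.2
        · exact absurd hk.1 (hd h3)
      rw [← h2] at h4
      obtain ⟨n, hn⟩ := ih (s := fun n => s (n + 1)) (r := fun n => r (n + 1))
        ⟨fun _ => h.mem _, fun _ => h.succ _⟩ (fun n => hv _) h4
      exact ⟨n + 1, hn⟩

end CellTree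

/-! ### The cells as cones in the switch hyperplane, and estimates of their measures. -/

open CombType RState

variable {d : ℕ}

/-- The coordinates of a point of the hyperplane. -/
def crd {p₀ : CombType d} (x : switchSpace p₀) : Fin d → ℝ := x.1.ofLp

/-- The sum of the coordinates. -/
def tot {p₀ : CombType d} (x : switchSpace p₀) : ℝ := ∑ i, crd x i

namespace RState

/-- The points whose widths at the given stage are positive. -/
def cell (p₀ : CombType d) (σ : RState d) : Set (switchSpace p₀) := {x | ∀ c, 0 < σ.wd (crd x) c}

end RState

/-- The points with nonnegative coordinates of sum at most one. -/
def unitCone (p₀ : CombType d) : Set (switchSpace p₀) := {x | (∀ i, 0 ≤ crd x i) ∧ tot x ≤ 1}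

section

variable {p₀ : CombType d} {G : Set (CombType d)}

theorem crd_add (x y : switchSpace p₀) : crd (x + y) = crd x + crd y := rfl

theorem crd_smul (s : ℝ) (x : switchSpace p₀) : crd (s • x) = s • crd x := rfl

theorem tot_add (x y : switchSpace p₀) : tot (x + y) = tot x + tot y := by
  simp [tot, crd_add, Finset.sum_add_distrib]

theorem tot_smul (s : ℝ) (x : switchSpace p₀) : tot (s • x) = s * tot x := by
  simp [tot, crd_smul, Finset.mul_sum]

theorem switch_crd (x : switchSpace p₀) : p₀.SwitchCondition (crd x) := mem_switchSpace.1 x.2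

theorem continuous_crd (i : Fin d) : Continuous fun x : switchSpace p₀ => crd x i :=
  (PiLp.continuous_apply 2 (fun _ : Fin d => ℝ) i).comp continuous_subtype_val

theorem continuous_tot : Continuous (tot : switchSpace p₀ → ℝ) :=
  continuous_finsetSum _ fun i _ => continuous_crd i

theorem continuous_wd (σ : RState d) (c : Fin d) :
    Continuous fun x : switchSpace p₀ => σ.wd (crd x) c := by
  have : (fun x : switchSpace p₀ => σ.wd (crd x) c) = fun x => ∑ j, (σ.inv c j : ℝ) * crd x j := by
    ext
    simp [wd, Matrix.mulVec, dotProduct]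
  rw [this]
  exact continuous_finsetSum _ fun i _ => continuous_const.mul (continuous_crd i)

theorem measurableSet_cell (σ : RState d) : MeasurableSet (cell p₀ σ) := by
  have : cell p₀ σ = ⋂ c, {x | 0 < σ.wd (crd x) c} := by ext; simp [cell]
  rw [this]
  exact MeasurableSet.iInter fun c => (isOpen_lt continuous_const (continuous_wd σ c)).measurableSet

theorem measurableSet_unitCone : MeasurableSet (unitCone p₀) := by
  have : unitCone p₀ = (⋂ i, {x | 0 ≤ crd x i}) ∩ {x | tot x ≤ 1} := by
    ext; simp [unitCone]
  rw [this]
  exact (MeasurableSet.iInter fun i =>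
    (isClosed_le continuous_const (continuous_crd i)).measurableSet).inter
      (isClosed_le continuous_tot continuous_const).measurableSet

theorem isBounded_unitCone : Bornology.IsBounded (unitCone p₀) := by
  refine (isBounded_iff_forall_norm_le).2 ⟨Real.sqrt d, ?_⟩
  rintro x ⟨h0, h1⟩
  rw [Submodule.coe_norm, EuclideanSpace.norm_eq]
  refine Real.sqrt_le_sqrt ?_
  have h2 : ∀ i ∈ Finset.univ, ‖x.1 i‖ ^ 2 ≤ (1 : ℝ) := by
    intro i _
    have h3 : crd x i ≤ 1 :=
      (Finset.single_le_sum (fun j _ => h0 j) (Finset.mem_univ i)).trans h1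
    have h4 : ‖x.1 i‖ ≤ 1 := by
      rw [Real.norm_eq_abs, abs_le]
      exact ⟨by linarith [show 0 ≤ x.1 i from h0 i], h3⟩
    exact pow_le_one₀ (norm_nonneg _) h4
  simpa using Finset.sum_le_sum h2

instance : IsFiniteMeasure ((volume : Measure (switchSpace p₀)).restrict (unitCone p₀)) :=
  isFiniteMeasure_restrict.2 isBounded_unitCone.measure_lt_top.ne

theorem finrank_switchSpace_le : Module.finrank ℝ (switchSpace p₀) ≤ d := by
  simpa using Submodule.finrank_le (switchSpace p₀)

variable {σ : RState d}

theorem cell_subset_pos (h : Valid p₀ G σ) {x : switchSpace p₀} (hx : x ∈ cell p₀ σ) (i : Fin d) :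
    0 ≤ crd x i := by
  rw [← h.unwd_wd (crd x)]
  exact h.unwd_nonneg (fun c => (hx c).le) i

theorem inter_unitCone (h : Valid p₀ G σ) {S : Set (switchSpace p₀)} (hS : S ⊆ cell p₀ σ) :
    S ∩ unitCone p₀ = S ∩ {x | tot x ≤ 1} := by
  ext x
  exact and_congr_right fun hx => ⟨fun h1 => h1.2, fun h1 => ⟨cell_subset_pos h (hS hx), h1⟩⟩

theorem measureReal_eq (h : Valid p₀ G σ) {S : Set (switchSpace p₀)} (hS : S ⊆ cell p₀ σ) :
    (volume.restrict (unitCone p₀)).real S = volume.real (S ∩ {x | tot x ≤ 1}) := by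
  rw [measureReal_restrict_apply' measurableSet_unitCone, inter_unitCone h hS]

-- A cell is a cone, so raising the bound on the total width is a dilation. The exponent `d` only
-- bounds the dimension of the hyperplane, which is why `1 ≤ c` is required.
open Pointwise in
theorem volume_inter_le {c : ℝ} (hc : 1 ≤ c) :
    volume (cell p₀ σ ∩ {x | tot x ≤ c}) ≤
      ENNReal.ofReal (c ^ d) * volume (cell p₀ σ ∩ {x | tot x ≤ 1}) := by
  have hc0 : 0 < c := by linarith
  have h1 : cell p₀ σ ∩ {x | tot x ≤ c} ⊆ c • (cell p₀ σ ∩ {x | tot x ≤ 1}) := by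
    rintro x ⟨h1, h2⟩
    refine ⟨c⁻¹ • x, ⟨fun e => ?_, ?_⟩, ?_⟩
    · rw [crd_smul, wd_smul]
      exact mul_pos (inv_pos.2 hc0) (h1 e)
    · simp only [Set.mem_ofPred_eq, tot_smul] at h2 ⊢
      rw [inv_mul_le_iff₀ hc0]
      linarith
    · simp [smul_smul, hc0.ne']
  refine (measure_mono h1).trans ?_
  rw [Measure.addHaar_smul]
  gcongr
  rw [abs_of_pos (by positivity)]
  exact pow_le_pow_right₀ hc finrank_switchSpace_le

theorem measureReal_inter_le (h : Valid p₀ G σ) {c : ℝ} (hc : 1 ≤ c) :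
    volume (cell p₀ σ ∩ {x | tot x ≤ c}) ≠ ⊤ ∧
    volume.real (cell p₀ σ ∩ {x | tot x ≤ c}) ≤
      c ^ d * (volume.restrict (unitCone p₀)).real (cell p₀ σ) := by
  have h1 := volume_inter_le (p₀ := p₀) (σ := σ) hc
  have h2 : volume (cell p₀ σ ∩ {x | tot x ≤ 1}) ≠ ⊤ := by
    rw [← inter_unitCone h subset_rfl]
    exact ((measure_mono Set.inter_subset_right).trans_lt isBounded_unitCone.measure_lt_top).ne
  have h3 : ENNReal.ofReal (c ^ d) * volume (cell p₀ σ ∩ {x | tot x ≤ 1}) ≠ ⊤ :=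
    ENNReal.mul_ne_top ENNReal.ofReal_ne_top h2
  refine ⟨(h1.trans_lt h3.lt_top).ne, ?_⟩
  have h4 := ENNReal.toReal_mono h3 h1
  rw [ENNReal.toReal_mul, ENNReal.toReal_ofReal (by positivity)] at h4
  rwa [measureReal_eq h subset_rfl]

/-- Prescribed widths at a stage are realised by a vector of the hyperplane. Translating by it
changes these widths in a controlled way and preserves Lebesgue measure. -/
theorem exists_crd_eq (h : Valid p₀ G σ) {v : Fin d → ℝ} (hv : σ.typ.SwitchCondition v) :
    ∃ y : switchSpace p₀, σ.wd (crd y) = v ∧ tot y = ∑ c, σ.colNorm c * v c := by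
  refine ⟨⟨WithLp.toLp 2 (σ.unwd v), mem_switchSpace.2 ((h.switch_unwd v).2 hv)⟩,
    h.wd_unwd v, ?_⟩
  exact sum_unwd σ v

theorem colNorm_mul_wd_le (h : Valid p₀ G σ) {x : switchSpace p₀} (hx : x ∈ cell p₀ σ) (c : Fin d) :
    σ.colNorm c * σ.wd (crd x) c ≤ tot x := by
  rw [tot, h.sum_eq]
  exact Finset.single_le_sum (f := fun c => σ.colNorm c * σ.wd (crd x) c)
    (fun e _ => mul_nonneg (h.colNorm_nonneg e) (hx e).le) (Finset.mem_univ c)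

theorem mem_cell_isChild {r : Bool} {a b : Fin d} {τ : RState d} (h : IsChild r a b σ τ)
    {x : switchSpace p₀} : x ∈ cell p₀ τ ↔ x ∈ cell p₀ σ ∧ σ.wd (crd x) b < σ.wd (crd x) a := by
  simp only [cell, Set.mem_ofPred_eq, h.wd]
  constructor
  · intro h1
    have h2 := h1 a
    have h3 := h1 b
    rw [Function.update_self, sub_pos] at h2
    rw [Function.update_of_ne h.1.ne.symm] at h3
    refine ⟨fun c => ?_, h2⟩
    by_cases hc : c = a
    · rw [hc]; exact h3.trans h2
    · have := h1 c
      rwa [Function.update_of_ne hc] at this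
  · rintro ⟨h1, h2⟩ c
    by_cases hc : c = a
    · rw [hc, Function.update_self, sub_pos]; exact h2
    · rw [Function.update_of_ne hc]; exact h1 c

/-- A step in which the loser has a large column has probability bounded from below. -/
theorem measureReal_child_ge {r : Bool} {a b : Fin d} {τ : RState d} (h : Valid p₀ G σ)
    (hτ : Valid p₀ G τ) (hch : IsChild r a b σ τ) {M C B : ℝ} (hM : 0 < M) (hC : 0 ≤ C)
    (hq : ∀ c, σ.colNorm c ≤ C * M) (hb : M ≤ σ.colNorm b) {v : Fin d → ℝ} (hv0 : ∀ c, 0 < v c)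
    (hv : σ.typ.SwitchCondition v) (hva : v b + 1 = v a) (hvB : ∑ c, v c ≤ B) :
    (volume.restrict (unitCone p₀)).real (cell p₀ σ) ≤
      (1 + C * B) ^ d * (volume.restrict (unitCone p₀)).real (cell p₀ τ) := by
  obtain ⟨y, hy1, hy2⟩ := exists_crd_eq h hv
  have hB : 0 ≤ B := (Finset.sum_nonneg fun c _ => (hv0 c).le).trans hvB
  have hy3 : tot y ≤ C * M * B := by
    rw [hy2]
    calc ∑ c, σ.colNorm c * v c ≤ ∑ c, C * M * v c :=
          Finset.sum_le_sum fun c _ => mul_le_mul_of_nonneg_right (hq c) (hv0 c).le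
      _ = C * M * ∑ c, v c := by rw [Finset.mul_sum]
      _ ≤ C * M * B := mul_le_mul_of_nonneg_left hvB (by positivity)
  have h1 := measureReal_inter_le hτ (c := 1 + C * B) (by nlinarith)
  rw [measureReal_eq h subset_rfl]
  refine le_trans ?_ h1.2
  -- The loser has width at most `M⁻¹`, because its column norm is at least `M`. The translation
  -- raises the difference of the critical widths by exactly `M⁻¹`, so the band `a` wins, and it
  -- costs at most `C * B` in total width.
  have h2 : (fun x => M⁻¹ • y + x) '' (cell p₀ σ ∩ {x | tot x ≤ 1}) ⊆
      cell p₀ τ ∩ {x | tot x ≤ 1 + C * B} := by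
    rintro _ ⟨x, ⟨hx, hx1⟩, rfl⟩
    have hw : σ.wd (crd (M⁻¹ • y + x)) = M⁻¹ • v + σ.wd (crd x) := by
      rw [crd_add, crd_smul, wd_add, wd_smul, hy1]
    refine ⟨(mem_cell_isChild hch).2 ⟨fun c => ?_, ?_⟩, ?_⟩
    · simp only [hw, Pi.add_apply, Pi.smul_apply, smul_eq_mul]
      have := hx c
      have := hv0 c
      positivity
    · simp only [hw, Pi.add_apply, Pi.smul_apply, smul_eq_mul, ← hva]
      have e1 := (colNorm_mul_wd_le h hx b).trans hx1
      have e2 : M * σ.wd (crd x) b ≤ 1 :=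
        (mul_le_mul_of_nonneg_right hb (hx b).le).trans e1
      have e3 : σ.wd (crd x) b ≤ M⁻¹ := by
        rw [← one_div, le_div_iff₀ hM]; linarith
      have := hx a
      linarith
    · simp only [Set.mem_ofPred_eq, tot_add, tot_smul] at hx1 ⊢
      have : M⁻¹ * tot y ≤ C * B := by
        rw [inv_mul_le_iff₀ hM]; linarith
      linarith
  calc volume.real (cell p₀ σ ∩ {x | tot x ≤ 1})
      = volume.real ((fun x => M⁻¹ • y + x) '' (cell p₀ σ ∩ {x | tot x ≤ 1})) := by
        rw [measureReal_def, measureReal_def, Set.image_add_left, measure_preimage_add]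
    _ ≤ _ := measureReal_mono h2 h1.1

/-- A band with a large column is rarely thin. -/
theorem measureReal_thin_le (h : Valid p₀ G σ) {j : Fin d} {M C B : ℝ} (hM : 0 < M) (hC : 0 ≤ C)
    (hq : ∀ c, σ.colNorm c ≤ C * M) {v : Fin d → ℝ} (hv0 : ∀ c, 0 < v c)
    (hv : σ.typ.SwitchCondition v) (hvj : v j = 1) (hvB : ∑ c, v c ≤ B) {N : ℕ} (hN : 0 < N) :
    N * (volume.restrict (unitCone p₀)).real
        {x | x ∈ cell p₀ σ ∧ σ.wd (crd x) j ≤ 1 / (N * M)} ≤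
      (1 + C * B) ^ d * (volume.restrict (unitCone p₀)).real (cell p₀ σ) := by
  obtain ⟨y, hy1, hy2⟩ := exists_crd_eq h hv
  have hB : 0 ≤ B := (Finset.sum_nonneg fun c _ => (hv0 c).le).trans hvB
  have hN' : (0 : ℝ) < N := by exact_mod_cast hN
  have hy3 : tot y ≤ C * M * B := by
    rw [hy2]
    calc ∑ c, σ.colNorm c * v c ≤ ∑ c, C * M * v c :=
          Finset.sum_le_sum fun c _ => mul_le_mul_of_nonneg_right (hq c) (hv0 c).le
      _ = C * M * ∑ c, v c := by rw [Finset.mul_sum]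
      _ ≤ C * M * B := mul_le_mul_of_nonneg_left hvB (by positivity)
  have hy0 : 0 ≤ tot y := by
    rw [hy2]
    exact Finset.sum_nonneg fun c _ => mul_nonneg (h.colNorm_nonneg c) (hv0 c).le
  have h1 := measureReal_inter_le h (c := 1 + C * B) (by nlinarith)
  set D : Set (switchSpace p₀) := {x | x ∈ cell p₀ σ ∧ σ.wd (crd x) j ≤ 1 / (N * M)} with hD
  have hDm : MeasurableSet (D ∩ {x | tot x ≤ 1}) :=
    ((measurableSet_cell σ).inter (isClosed_le (continuous_wd σ j) continuous_const).measurableSet).inter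
      (isClosed_le continuous_tot continuous_const).measurableSet
  rw [measureReal_eq h (fun x hx => hx.1)]
  refine le_trans ?_ h1.2
  -- Shifting by multiples of the threshold gives `N` disjoint copies of the thin set, since the
  -- width of `j` then lies in disjoint intervals. All shifts are at most 1 / `M`, so the copies fit
  -- into a cell of boundedly larger measure.
  let s : ℕ → ℝ := fun i => i / (N * M)
  let F : ℕ → Set (switchSpace p₀) := fun i => (fun x => s i • y + x) '' (D ∩ {x | tot x ≤ 1})
  have hF : ∀ i, volume.real (F i) = volume.real (D ∩ {x | tot x ≤ 1}) := by
    intro i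
    simp only [F]
    rw [measureReal_def, measureReal_def, Set.image_add_left, measure_preimage_add]
  have hs0 : ∀ i, 0 ≤ s i := fun i => by positivity
  have hw : ∀ i x, σ.wd (crd (s i • y + x)) = s i • v + σ.wd (crd x) := by
    intro i x
    rw [crd_add, crd_smul, wd_add, wd_smul, hy1]
  have hFj : ∀ i, ∀ z ∈ F i, s i < σ.wd (crd z) j ∧ σ.wd (crd z) j ≤ s (i + 1) := by
    rintro i _ ⟨x, ⟨⟨hx, hxj⟩, hx1⟩, rfl⟩
    simp only [hw, Pi.add_apply, Pi.smul_apply, smul_eq_mul, hvj, mul_one]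
    have := hx j
    refine ⟨by linarith, ?_⟩
    have : s (i + 1) = s i + 1 / (N * M) := by simp only [s]; push_cast; ring
    linarith
  have hdisj : ∀ i k, i < k → Disjoint (F i) (F k) := by
    intro i k hik
    rw [Set.disjoint_left]
    intro z hz hz'
    have e1 := (hFj i z hz).2
    have e2 := (hFj k z hz').1
    have e3 : s (i + 1) ≤ s k := by
      have : ((i + 1 : ℕ) : ℝ) ≤ k := by exact_mod_cast hik
      exact div_le_div_of_nonneg_right this (by positivity)
    linarith
  have hsub : ⋃ i ∈ Finset.range N, F i ⊆ cell p₀ σ ∩ {x | tot x ≤ 1 + C * B} := by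
    refine Set.iUnion₂_subset fun i hi => ?_
    rintro _ ⟨x, ⟨⟨hx, hxj⟩, hx1⟩, rfl⟩
    refine ⟨fun c => ?_, ?_⟩
    · simp only [hw, Pi.add_apply, Pi.smul_apply, smul_eq_mul]
      have := hx c
      have := mul_nonneg (hs0 i) (hv0 c).le
      linarith
    · simp only [Set.mem_ofPred_eq, tot_add, tot_smul] at hx1 ⊢
      have hi' : (i : ℝ) ≤ N := by exact_mod_cast (Finset.mem_range.1 hi).le
      have e1 : s i ≤ 1 / M := by
        simp only [s]
        rw [div_le_div_iff₀ (by positivity) hM]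
        nlinarith
      have e2 : s i * tot y ≤ 1 / M * (C * M * B) := mul_le_mul e1 hy3 hy0 (by positivity)
      have e3 : 1 / M * (C * M * B) = C * B := by field_simp
      linarith
  have h2 := measureReal_mono hsub h1.1
  rw [measureReal_biUnion_finset (h := fun i hi => measure_ne_top_of_subset
    ((Set.subset_biUnion_of_mem (s := (Finset.range N : Set ℕ)) (u := F) hi).trans (by simpa using hsub)) h1.1)] at h2
  · simpa [hF] using h2
  · intro i _ k _ hik
    rcases lt_or_gt_of_ne hik with h' | h'
    · exact hdisj i k h'
    · exact (hdisj k i h').symm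
  · intro i _
    simp only [F]
    exact (MeasurableEquiv.addLeft (s i • y)).measurableSet_image.2 hDm

/-- Uniformly bounded test vectors. -/
theorem exists_test_vectors (d : ℕ) : ∃ B : ℝ, 0 ≤ B ∧
    (∀ (p : CombType d) (a b : Fin d),
      (∃ w : Fin d → ℝ, (∀ c, 0 < w c) ∧ p.SwitchCondition w ∧ w b < w a) →
      ∃ v : Fin d → ℝ, (∀ c, 0 < v c) ∧ p.SwitchCondition v ∧ v b + 1 = v a ∧ ∑ c, v c ≤ B) ∧
    ∀ (p : CombType d) (j : Fin d), p.Recurrent →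
      ∃ v : Fin d → ℝ, (∀ c, 0 < v c) ∧ p.SwitchCondition v ∧ v j = 1 ∧ ∑ c, v c ≤ B := by
  have hscale : ∀ (p : CombType d) (w : Fin d → ℝ) (s : ℝ), p.SwitchCondition w →
      p.SwitchCondition (fun c => s * w c) := by
    intro p w s hw
    rw [switchCondition_iff] at hw ⊢
    simp only [mul_left_comm _ s, ← Finset.mul_sum, hw, mul_zero]
  have h1 : ∀ z : CombType d × Fin d × Fin d, ∃ B : ℝ,
      (∃ w : Fin d → ℝ, (∀ c, 0 < w c) ∧ z.1.SwitchCondition w ∧ w z.2.2 < w z.2.1) →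
      ∃ v : Fin d → ℝ, (∀ c, 0 < v c) ∧ z.1.SwitchCondition v ∧ v z.2.2 + 1 = v z.2.1 ∧
        ∑ c, v c ≤ B := by
    intro z
    by_cases h : ∃ w : Fin d → ℝ, (∀ c, 0 < w c) ∧ z.1.SwitchCondition w ∧ w z.2.2 < w z.2.1
    · obtain ⟨w, hw0, hw, hlt⟩ := h
      have hpos : 0 < (w z.2.1 - w z.2.2)⁻¹ := inv_pos.2 (sub_pos.2 hlt)
      refine ⟨_, fun _ => ⟨fun c => (w z.2.1 - w z.2.2)⁻¹ * w c, fun c => mul_pos hpos (hw0 c),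
        hscale _ _ _ hw, ?_, le_rfl⟩⟩
      have : (w z.2.1 - w z.2.2)⁻¹ * (w z.2.1 - w z.2.2) = 1 :=
        inv_mul_cancel₀ (sub_pos.2 hlt).ne'
      linarith
    · exact ⟨0, fun h' => absurd h' h⟩
  have h2 : ∀ z : CombType d × Fin d, ∃ B : ℝ, z.1.Recurrent →
      ∃ v : Fin d → ℝ, (∀ c, 0 < v c) ∧ z.1.SwitchCondition v ∧ v z.2 = 1 ∧ ∑ c, v c ≤ B := by
    intro z
    by_cases h : z.1.Recurrent
    · obtain ⟨w, hw0, hw⟩ := h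
      exact ⟨_, fun _ => ⟨fun c => (w z.2)⁻¹ * w c, fun c => mul_pos (inv_pos.2 (hw0 _)) (hw0 c),
        hscale _ _ _ hw, inv_mul_cancel₀ (hw0 _).ne', le_rfl⟩⟩
    · exact ⟨0, fun h' => absurd h' h⟩
  choose B₁ hB₁ using h1
  choose B₂ hB₂ using h2
  obtain ⟨M₁, hM₁⟩ := Finite.exists_le B₁
  obtain ⟨M₂, hM₂⟩ := Finite.exists_le B₂
  refine ⟨max 0 (max M₁ M₂), le_max_left _ _, fun p a b h => ?_, fun p j h => ?_⟩
  · obtain ⟨v, hv0, hv, hva, hvB⟩ := hB₁ (p, a, b) h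
    exact ⟨v, hv0, hv, hva, hvB.trans ((hM₁ _).trans
      ((le_max_left _ _).trans (le_max_right _ _)))⟩
  · obtain ⟨v, hv0, hv, hva, hvB⟩ := hB₂ (p, j) h
    exact ⟨v, hv0, hv, hva, hvB.trans ((hM₂ _).trans
      ((le_max_right _ _).trans (le_max_right _ _)))⟩

end

/-! ### Generic points and their paths in the tree of cells. -/

variable {p₀ : CombType d} {G : Set (CombType d)} {σ : RState d}

/-- A linear form which does not vanish identically on the hyperplane has a proper subspace as its
zero set. -/
theorem volume_functional_eq_zero (h : Valid p₀ G σ) {u w : Fin d → ℝ}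
    (hw : σ.typ.SwitchCondition w) (hu : ∑ c, u c * w c ≠ 0) :
    volume {x : switchSpace p₀ | ∑ c, u c * σ.wd (crd x) c = 0} = 0 := by
  let s : Submodule ℝ (switchSpace p₀) :=
    { carrier := {x | ∑ c, u c * σ.wd (crd x) c = 0}
      add_mem' := by
        intro x y hx hy
        simp only [Set.mem_ofPred_eq] at hx hy ⊢
        simp only [crd_add, wd_add, Pi.add_apply, mul_add, Finset.sum_add_distrib, hx, hy, add_zero]
      zero_mem' := by
        have : σ.wd (crd (0 : switchSpace p₀)) = 0 := by
          rw [← zero_smul ℝ (0 : switchSpace p₀), crd_smul, wd_smul, zero_smul]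
        simp [this]
      smul_mem' := by
        intro t x hx
        simp only [Set.mem_ofPred_eq] at hx ⊢
        simp only [crd_smul, wd_smul, Pi.smul_apply, smul_eq_mul, mul_left_comm _ t,
          ← Finset.mul_sum, hx, mul_zero] }
  have hs : s ≠ ⊤ := by
    intro hs
    obtain ⟨y, hy, -⟩ := exists_crd_eq h hw
    have : y ∈ s := hs ▸ Submodule.mem_top
    have h1 : ∑ c, u c * σ.wd (crd y) c = 0 := this
    rw [hy] at h1
    exact hu h1
  exact Measure.addHaar_submodule volume s hs

theorem exists_isChild (hG : SinkSet G) (h : Valid p₀ G σ) : ∃ a b,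
    IsChild true a b σ (child true σ) ∧ IsChild false b a σ (child false σ) ∧
      ∃ w : Fin d → ℝ, σ.typ.SwitchCondition w ∧ w a ≠ w b := by
  obtain ⟨a, b, hab, ha, hb, hw⟩ := hG.exists_getLast? h.mem true
  exact ⟨a, b, (isChild_child ha hb hab).1, (isChild_child hb ha hab.symm).1, hw⟩

theorem exists_isChild_of_bool (hG : SinkSet G) (h : Valid p₀ G σ) (r : Bool) :
    ∃ a b, IsChild r a b σ (child r σ) := by
  obtain ⟨a, b, h1, h2, -⟩ := exists_isChild hG h
  cases r
  · exact ⟨b, a, h2⟩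
  · exact ⟨a, b, h1⟩

/-- A point of the new cell supplies positive widths satisfying the switch condition, so the new
type is recurrent and stays in `G`. -/
theorem valid_child (hG : SinkSet G) (h : Valid p₀ G σ) {r : Bool} {a b : Fin d} {τ : RState d}
    (hτ : IsChild r a b σ τ) (hne : (cell p₀ τ).Nonempty) : Valid p₀ G τ := by
  obtain ⟨x, hx⟩ := hne
  -- The transport of the switch condition is needed before the new type is known to lie in `G`.
  have h' : Valid p₀ Set.univ σ := { h with mem := trivial }
  have h1 := hτ.valid h' trivial
  exact hτ.valid h (hG.split _ h.mem a b _ (split_iff.2 ⟨r, hτ.1⟩)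
    ⟨_, hx, (h1.switch_wd _).2 (switch_crd x)⟩)

/-- The measure on the hyperplane of the switch condition used for probabilities. -/
noncomputable def coneMeasure (p₀ : CombType d) : Measure (switchSpace p₀) :=
  volume.restrict (unitCone p₀)

instance : IsFiniteMeasure (coneMeasure p₀) :=
  inferInstanceAs (IsFiniteMeasure (volume.restrict (unitCone p₀)))

theorem ae_coneMeasure {P : switchSpace p₀ → Prop} (h : ∀ᵐ x, P x) : ∀ᵐ x ∂coneMeasure p₀, P x :=
  ae_restrict_of_ae h

theorem ae_mem_child (hG : SinkSet G) (h : Valid p₀ G σ) :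
    ∀ᵐ x : switchSpace p₀, x ∈ cell p₀ σ → ∃ r, x ∈ cell p₀ (child r σ) := by
  obtain ⟨a, b, h1, h2, w, hw, hab⟩ := exists_isChild hG h
  have hu : ∑ c, (Pi.single a (1 : ℝ) - Pi.single b 1 : Fin d → ℝ) c * w c ≠ 0 := by
    simp [sub_mul, Finset.sum_sub_distrib, Pi.single_apply, sub_eq_zero, hab]
  have h3 : ∀ᵐ x : switchSpace p₀, σ.wd (crd x) a ≠ σ.wd (crd x) b := by
    have h4 := volume_functional_eq_zero h hw hu
    rw [ae_iff]
    refine measure_mono_null (fun x hx => ?_) h4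
    simp only [ne_eq, not_not, Set.mem_ofPred_eq] at hx
    simp [sub_mul, Finset.sum_sub_distrib, Pi.single_apply, sub_eq_zero, hx]
  filter_upwards [h3] with x hx hxc
  rcases lt_or_gt_of_ne hx with h4 | h4
  · exact ⟨false, (mem_cell_isChild h2).2 ⟨hxc, h4⟩⟩
  · exact ⟨true, (mem_cell_isChild h1).2 ⟨hxc, h4⟩⟩

theorem cellTree (hG : SinkSet G) :
    CellTree (coneMeasure p₀) (cell p₀) (Valid p₀ G) child where
  meas := measurableSet_cell
  sub σ h r := by
    obtain ⟨a, b, h1⟩ := exists_isChild_of_bool hG h r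
    exact fun x hx => ((mem_cell_isChild h1).1 hx).1
  disj σ h := by
    obtain ⟨a, b, h1, h2, -⟩ := exists_isChild hG h
    exact Set.disjoint_left.2 fun x hx hx' =>
      lt_asymm ((mem_cell_isChild h1).1 hx).2 ((mem_cell_isChild h2).1 hx').2
  cover σ h := by
    refine measure_mono_null (fun x hx => ?_) (ae_iff.1 (ae_coneMeasure (ae_mem_child hG h)))
    simp only [Set.mem_sdiff, Set.mem_union, not_or, Set.mem_ofPred_eq, not_forall] at hx ⊢
    refine ⟨hx.1, ?_⟩
    rintro ⟨r, hr⟩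
    cases r
    · exact hx.2.2 hr
    · exact hx.2.1 hr
  child σ h r hne := by
    obtain ⟨a, b, h1⟩ := exists_isChild_of_bool hG h r
    exact valid_child hG h h1 hne

/-- The points which never meet a step with equal widths nor an unexpected linear relation. -/
def Generic (p₀ : CombType d) (G : Set (CombType d)) (x : switchSpace p₀) : Prop :=
  ∀ σ, Valid p₀ G σ → x ∈ cell p₀ σ → (∃ r, x ∈ cell p₀ (child r σ)) ∧
    ∀ V : Finset (Fin d), ∑ c ∈ V, (σ.typ.sgn c : ℝ) * σ.wd (crd x) c = 0 →
      (∀ c ∈ V, σ.typ.sgn c = 0) ∨ ∀ c ∉ V, σ.typ.sgn c = 0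

/-- On the switch hyperplane the partial signed sum vanishes identically only if it is zero or the
whole switch form. If reversing bands `e` in `V` and `f` outside `V` exist, the vector supported on
these two satisfies the switch condition but not the partial one. -/
theorem ae_alternative (h : Valid p₀ G σ) (V : Finset (Fin d)) : ∀ᵐ x : switchSpace p₀,
    ∑ c ∈ V, (σ.typ.sgn c : ℝ) * σ.wd (crd x) c = 0 →
      (∀ c ∈ V, σ.typ.sgn c = 0) ∨ ∀ c ∉ V, σ.typ.sgn c = 0 := by
  classical
  by_cases hV : (∀ c ∈ V, σ.typ.sgn c = 0) ∨ ∀ c ∉ V, σ.typ.sgn c = 0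
  · exact Filter.Eventually.of_forall fun x _ => hV
  push Not at hV
  obtain ⟨⟨e, he, he0⟩, f, hf, hf0⟩ := hV
  have hef : e ≠ f := by rintro rfl; exact hf he
  have he1 : (σ.typ.sgn e : ℝ) ≠ 0 := by exact_mod_cast he0
  have hf1 : (σ.typ.sgn f : ℝ) ≠ 0 := by exact_mod_cast hf0
  have hw : σ.typ.SwitchCondition
      (Pi.single e (σ.typ.sgn e : ℝ)⁻¹ - Pi.single f (σ.typ.sgn f : ℝ)⁻¹) := by
    rw [switchCondition_iff]
    simp [mul_sub, Finset.sum_sub_distrib, Pi.single_apply, he1, hf1]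
  have hu : ∑ c, (if c ∈ V then (σ.typ.sgn c : ℝ) else 0) *
      (Pi.single e (σ.typ.sgn e : ℝ)⁻¹ - Pi.single f (σ.typ.sgn f : ℝ)⁻¹ : Fin d → ℝ) c ≠ 0 := by
    simp [mul_sub, Finset.sum_sub_distrib, Pi.single_apply, he1, he, hf]
  rw [ae_iff]
  refine measure_mono_null (fun x hx => ?_) (volume_functional_eq_zero h hw hu)
  simp only [Set.mem_ofPred_eq, Classical.not_imp] at hx ⊢
  refine Eq.trans ?_ hx.1
  simp [ite_mul, Finset.sum_ite_mem]

theorem ae_generic (hG : SinkSet G) : ∀ᵐ x : switchSpace p₀, Generic p₀ G x := by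
  refine ae_all_iff.2 fun σ => ?_
  by_cases h : Valid p₀ G σ
  · have h2 := ae_all_iff.2 (ae_alternative h)
    filter_upwards [ae_mem_child hG h, h2] with x h3 h4 _ hx using ⟨h3 hx, h4⟩
  · exact Filter.Eventually.of_forall fun x h' => absurd h' h

/-- The expansion of a point, as a sequence of valid states. -/
structure RPath (p₀ : CombType d) (G : Set (CombType d)) (x : switchSpace p₀) (s : ℕ → RState d)
    (a b : ℕ → Fin d) (r : ℕ → Bool) : Prop where
  path : CellTree.Path (cell p₀) child x s r
  valid : ∀ n, Valid p₀ G (s n)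
  child : ∀ n, IsChild (r n) (a n) (b n) (s n) (s (n + 1))

namespace RPath

variable {x : switchSpace p₀} {s : ℕ → RState d} {a b : ℕ → Fin d} {r : ℕ → Bool}

/-- Genericity yields a child cell containing the point, and this child is again valid; a choice of
children is iterated. -/
theorem _root_.Generic.exists_rPath (hG : SinkSet G) (hx : Generic p₀ G x) (h : Valid p₀ G σ)
    (hxσ : x ∈ cell p₀ σ) : ∃ s a b r, s 0 = σ ∧ RPath p₀ G x s a b r := by
  have hstep : ∀ τ : {τ // Valid p₀ G τ ∧ x ∈ cell p₀ τ}, ∃ (z : {τ // Valid p₀ G τ ∧ x ∈ cell p₀ τ})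
      (a b : Fin d) (r : Bool), z.1 = RState.child r τ.1 ∧ IsChild r a b τ.1 z.1 := by
    rintro ⟨τ, h1, h2⟩
    obtain ⟨r, hr⟩ := (hx τ h1 h2).1
    obtain ⟨a, b, h3⟩ := exists_isChild_of_bool hG h1 r
    exact ⟨⟨RState.child r τ, valid_child hG h1 h3 ⟨x, hr⟩, hr⟩, a, b, r, rfl, h3⟩
  choose f a b r h1 h2 using hstep
  let S : ℕ → {τ // Valid p₀ G τ ∧ x ∈ cell p₀ τ} := fun n => f^[n] ⟨σ, h, hxσ⟩
  have hS : ∀ n, S (n + 1) = f (S n) := fun n => Function.iterate_succ_apply' _ _ _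
  refine ⟨fun n => (S n).1, fun n => a (S n), fun n => b (S n), fun n => r (S n), rfl,
    ⟨fun n => (S n).2.2, fun n => ?_⟩, fun n => (S n).2.1, fun n => ?_⟩
  · simp only [hS]
    exact h1 _
  · simp only [hS]
    exact h2 _

theorem shift (h : RPath p₀ G x s a b r) (m : ℕ) : RPath p₀ G x (fun n => s (m + n))
    (fun n => a (m + n)) (fun n => b (m + n)) (fun n => r (m + n)) :=
  ⟨h.path.shift m, fun _ => h.valid _, fun _ => h.child _⟩

theorem lt (h : RPath p₀ G x s a b r) (n : ℕ) :
    (s n).wd (crd x) (b n) < (s n).wd (crd x) (a n) :=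
  ((mem_cell_isChild (h.child n)).1 (h.path.mem (n + 1))).2

theorem rauzySeq (h : RPath p₀ G x s a b r) :
    RauzySeq (fun n => (s n).typ) (fun n => (s n).wd (crd x)) a b r where
  split n := (h.child n).1
  pos n := h.path.mem n
  width n := (h.child n).wd _

theorem frequently_wins (hG : SinkSet G) (hx : Generic p₀ G x) (h : RPath p₀ G x s a b r)
    (c : Fin d) : ∃ᶠ n in Filter.atTop, a n = c :=
  h.rauzySeq.frequently_wins (fun n => ((h.valid n).switch_wd _).2 (switch_crd x))
    (fun n => hG.complete _ (h.valid n).mem)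
    (fun n V hV => ((hx _ (h.valid n) (h.path.mem n)).2 V hV)) c

theorem colNorm_mono (h : RPath p₀ G x s a b r) (c : Fin d) : Monotone fun n => (s n).colNorm c := by
  refine monotone_nat_of_le_succ fun n => ?_
  rw [(h.child n).colNorm]
  have := (h.valid n).colNorm_nonneg (a n)
  split_ifs <;> linarith

end RPath

/-! ### Growth of the number of large columns with probability bounded below. -/

open CellTree

/-- Some critical band lies outside of `J`. -/
def CriticalOutside (J : Finset (Fin d)) (p : CombType d) : Prop :=
  ∃ r c, (p.row r).getLast? = some c ∧ c ∉ J

theorem CombType.SplitForm.criticalOutside_iff {p q : CombType d} {r : Bool} {a b : Fin d}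
    (h : p.SplitForm r a b q) {J : Finset (Fin d)} : CriticalOutside J p ↔ a ∉ J ∨ b ∉ J := by
  obtain ⟨h1, h2, -⟩ := h.getLast?
  constructor
  · rintro ⟨r', c, hc, hcJ⟩
    by_cases hr : r' = r
    · subst hr
      rw [h1] at hc
      exact Or.inl (Option.some_injective _ hc ▸ hcJ)
    · have : r' = !r := by revert hr; cases r <;> cases r' <;> simp
      subst this
      rw [h2] at hc
      exact Or.inr (Option.some_injective _ hc ▸ hcJ)
  · rintro (h | h)
    · exact ⟨r, a, h1, h⟩
    · exact ⟨!r, b, h2, h⟩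

/-- A type from which at most `n` suitable steps among bands of `J` lead to a critical band
outside of `J`. -/
inductive Escape (J : Finset (Fin d)) : ℕ → CombType d → Prop
  | done (n : ℕ) (p : CombType d) (h : CriticalOutside J p) : Escape J n p
  | step (n : ℕ) (p : CombType d) (r : Bool) (a b : Fin d) (w : Fin d → ℝ)
      (ha : (p.row r).getLast? = some a) (hb : (p.row !r).getLast? = some b) (hbJ : b ∈ J)
      (hw0 : ∀ c, 0 < w c) (hw : p.SwitchCondition w) (hlt : w b < w a)
      (h : Escape J n (RState.next r p)) : Escape J (n + 1) p

theorem Escape.mono {J : Finset (Fin d)} {n : ℕ} {p : CombType d} (h : Escape J n p) {m : ℕ}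
    (hnm : n ≤ m) : Escape J m p := by
  induction h generalizing m with
  | done n p h => exact .done _ _ h
  | step n p r a b w ha hb hbJ hw0 hw hlt h ih =>
    obtain ⟨m, rfl⟩ := Nat.exists_eq_add_of_le' (Nat.le_of_add_left_le hnm : 1 ≤ m)
    exact .step m p r a b w ha hb hbJ hw0 hw hlt (ih (by omega))

theorem coneMeasure_cell_pos (h : Valid p₀ G σ) (hr : σ.typ.Recurrent) :
    0 < coneMeasure p₀ (cell p₀ σ) := by
  obtain ⟨w, hw0, hw⟩ := hr
  obtain ⟨y, hy, hyt⟩ := exists_crd_eq h hw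
  have hy0 : 0 ≤ tot y := by
    rw [hyt]
    exact Finset.sum_nonneg fun c _ => mul_nonneg (h.colNorm_nonneg c) (hw0 c).le
  have ho : IsOpen (cell p₀ σ ∩ {x | tot x < 1}) := by
    have : cell p₀ σ = ⋂ c, {x | 0 < σ.wd (crd x) c} := by ext; simp [cell]
    rw [this]
    exact (isOpen_iInter_of_finite fun c => isOpen_lt continuous_const (continuous_wd σ c)).inter
      (isOpen_lt continuous_tot continuous_const)
  have hne : (cell p₀ σ ∩ {x | tot x < 1}).Nonempty := by
    refine ⟨(1 + tot y)⁻¹ • y, fun c => ?_, ?_⟩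
    · rw [crd_smul, wd_smul, hy]
      have := hw0 c
      simp only [Pi.smul_apply, smul_eq_mul]
      positivity
    · simp only [Set.mem_ofPred_eq, tot_smul]
      rw [inv_mul_lt_iff₀ (by positivity)]
      linarith
  rw [coneMeasure, Measure.restrict_apply' measurableSet_unitCone, inter_unitCone h subset_rfl]
  exact (ho.measure_pos volume hne).trans_le
    (measure_mono (Set.inter_subset_inter_right _ fun x (hx : tot x < 1) => hx.le))

/-- A generic point started at `p` itself has a path on which a band outside `J` wins at some time.
Until a band outside `J` becomes critical, all losers lie in `J`. Since `next` depends on the type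
alone, this finite sequence of types is available at every state with type `p`. -/
theorem exists_escape (hG : SinkSet G) {p : CombType d} (hp : p ∈ G) {J : Finset (Fin d)}
    (hJ : J ≠ Finset.univ) : ∃ n, Escape J n p := by
  have hv : Valid p G (root p) := valid_root hp
  obtain ⟨x, hx, hxg⟩ : ∃ x ∈ cell p (root p), Generic p G x := by
    by_contra! h
    refine (coneMeasure_cell_pos hv (hG.recurrent p hp)).ne' ?_
    exact measure_mono_null (fun x hx => h x hx) (ae_iff.1 (ae_coneMeasure (ae_generic hG)))
  obtain ⟨s, a, b, r, hs, h⟩ := hxg.exists_rPath hG hv hx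
  obtain ⟨c, hc⟩ : ∃ c, c ∉ J := by
    by_contra! h'
    exact hJ (Finset.eq_univ_iff_forall.2 h')
  obtain ⟨n, hn⟩ := (h.frequently_wins hG hxg c).exists
  have key : ∀ n m, CriticalOutside J (s (m + n)).typ → Escape J n (s m).typ := by
    intro n
    induction n with
    | zero => exact fun m hm => .done _ _ hm
    | succ n ih =>
      intro m hm
      by_cases h0 : CriticalOutside J (s m).typ
      · exact .done _ _ h0
      · have hsplit := (h.child m).1
        rw [hsplit.criticalOutside_iff] at h0
        push Not at h0
        obtain ⟨h1, h2, -⟩ := hsplit.getLast?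
        refine .step n _ (r m) (a m) (b m) _ h1 h2 h0.2 (h.path.mem m)
          (((h.valid m).switch_wd _).2 (switch_crd x)) (h.lt m) ?_
        have h3 := (isChild_child h1 h2 hsplit.ne).2
        rw [← h3, ← h.path.succ m]
        exact ih (m + 1) (by rwa [add_assoc, add_comm 1 n])
  have h1 := key n 0 (by
    rw [zero_add, (h.child n).1.criticalOutside_iff]
    exact Or.inl (hn ▸ hc))
  rw [hs] at h1
  exact ⟨n, h1⟩

theorem exists_escape_bound (hG : SinkSet G) : ∃ L, ∀ p ∈ G, ∀ J : Finset (Fin d),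
    J ≠ Finset.univ → Escape J L p := by
  have h : ∀ z : CombType d × Finset (Fin d), ∃ n, z.1 ∈ G → z.2 ≠ Finset.univ → Escape z.2 n z.1 := by
    rintro ⟨p, J⟩
    by_cases hp : p ∈ G
    · by_cases hJ : J = Finset.univ
      · exact ⟨0, fun _ h => absurd hJ h⟩
      · obtain ⟨n, hn⟩ := exists_escape hG hp hJ
        exact ⟨n, fun _ _ => hn⟩
    · exact ⟨0, fun h => absurd h hp⟩
  choose f hf using h
  obtain ⟨L, hL⟩ := Finite.exists_le f
  exact ⟨L, fun p hp J hJ => (hf (p, J) hp hJ).mono (hL _)⟩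

/-- All columns have norm at most `C * M`, those of `J` at least `M`. -/
def Near (C M : ℝ) (J : Finset (Fin d)) (σ : RState d) : Prop :=
  (∀ c, σ.colNorm c ≤ C * M) ∧ ∀ c ∈ J, M ≤ σ.colNorm c

/-- From any state a critical band outside of `J` is reached with probability bounded below,
without the columns getting much larger. -/
theorem exists_measureReal_hits_criticalOutside (hG : SinkSet G) (L : ℕ) {C : ℝ} (hC : 0 ≤ C) :
    ∃ ε > 0, ∃ C' ≥ 0, ∀ (J : Finset (Fin d)) (M : ℝ), 0 < M → ∀ σ, Valid p₀ G σ →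
      Escape J L σ.typ → Near C M J σ →
      ε * (coneMeasure p₀).real (cell p₀ σ) ≤
        (coneMeasure p₀).real (hits (cell p₀) child
          (fun τ => Near C' M J τ ∧ CriticalOutside J τ.typ) σ) := by
  obtain ⟨B, hB, hB1, -⟩ := exists_test_vectors d
  have H := cellTree (p₀ := p₀) hG
  induction L generalizing C with
  | zero =>
    refine ⟨1, one_pos, C, hC, fun J M hM σ hσ he hn => ?_⟩
    cases he with
    | done _ _ h => rw [hits_of_mem ⟨hn, h⟩, one_mul]
  | succ L ih =>
    -- One step adds one column to another, so the largest norm at most doubles.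
    obtain ⟨ε, hε, C', hC', h⟩ := ih (C := 2 * C) (by positivity)
    have hCB : 0 < (1 + C * B) ^ d := by positivity
    refine ⟨min 1 (ε * ((1 + C * B) ^ d)⁻¹), by positivity, max C C', le_max_of_le_left hC,
      fun J M hM σ hσ he hn => ?_⟩
    cases he with
    | done _ _ hcr =>
      have hnear : Near (max C C') M J σ := ⟨fun c => (hn.1 c).trans
        (mul_le_mul_of_nonneg_right (le_max_left _ _) hM.le), hn.2⟩
      rw [hits_of_mem ⟨hnear, hcr⟩]
      exact mul_le_of_le_one_left measureReal_nonneg (min_le_left _ _)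
    | step _ _ r a b w ha hb hbJ hw0 hw hlt hesc =>
      have hab : a ≠ b := by rintro rfl; exact lt_irrefl _ hlt
      obtain ⟨hch, htyp⟩ := isChild_child ha hb hab
      have hne : (cell p₀ (child r σ)).Nonempty := by
        obtain ⟨y, hy, -⟩ := exists_crd_eq hσ hw
        refine ⟨y, (mem_cell_isChild hch).2 ?_⟩
        simp only [cell, Set.mem_ofPred_eq, hy]
        exact ⟨hw0, hlt⟩
      have hv := valid_child hG hσ hch hne
      obtain ⟨v, hv0, hv1, hva, hvB⟩ := hB1 σ.typ a b ⟨w, hw0, hw, hlt⟩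
      have e1 := measureReal_child_ge hσ hv hch hM hC hn.1 (hn.2 b hbJ) hv0 hv1 hva hvB
      have e2 := h J M hM _ hv (by rwa [htyp]) ⟨fun c => ?_, fun c hc => ?_⟩
      · have e3 : (coneMeasure p₀).real (hits (cell p₀) child
            (fun τ => Near C' M J τ ∧ CriticalOutside J τ.typ) (child r σ)) ≤
            (coneMeasure p₀).real (hits (cell p₀) child
            (fun τ => Near (max C C') M J τ ∧ CriticalOutside J τ.typ) (child r σ)) := by
          have := H.mul_measureReal_hits_le (ε := 1) zero_le_one
            (T₁ := fun τ => Near C' M J τ ∧ CriticalOutside J τ.typ)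
            (T₂ := fun τ => Near (max C C') M J τ ∧ CriticalOutside J τ.typ) (fun τ _ hτ => by
              rw [hits_of_mem ⟨⟨fun c => (hτ.1.1 c).trans
                (mul_le_mul_of_nonneg_right (le_max_right _ _) hM.le), hτ.1.2⟩, hτ.2⟩, one_mul]) hv
          rwa [one_mul] at this
        have e4 : (coneMeasure p₀).real (hits (cell p₀) child
            (fun τ => Near (max C C') M J τ ∧ CriticalOutside J τ.typ) (child r σ)) ≤
            (coneMeasure p₀).real (hits (cell p₀) child
            (fun τ => Near (max C C') M J τ ∧ CriticalOutside J τ.typ) σ) := by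
          refine measureReal_mono ?_
          rw [← Set.inter_eq_right.2 (H.hits_subset hv)]
          exact H.inter_hits_child hσ r
        refine le_trans ?_ ((e2.trans e3).trans e4)
        calc min 1 (ε * ((1 + C * B) ^ d)⁻¹) * (coneMeasure p₀).real (cell p₀ σ)
            ≤ ε * ((1 + C * B) ^ d)⁻¹ * ((1 + C * B) ^ d *
              (coneMeasure p₀).real (cell p₀ (child r σ))) :=
              mul_le_mul (min_le_right _ _) e1 measureReal_nonneg (by positivity)
          _ = ε * (coneMeasure p₀).real (cell p₀ (child r σ)) := by
              field_simp
      · rw [hch.colNorm]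
        have := hn.1 c
        have := hn.1 a
        have : 0 ≤ C * M := by positivity
        split_ifs <;> linarith
      · rw [hch.colNorm]
        have := hn.2 c hc
        have := hσ.colNorm_nonneg a
        split_ifs <;> linarith

/-- All columns have norm at most `C * M`, and at least `k` of them have norm at least `M`. -/
def Bal (M C : ℝ) (k : ℕ) (σ : RState d) : Prop :=
  (∀ c, σ.colNorm c ≤ C * M) ∧ ∃ J : Finset (Fin d), k ≤ J.card ∧ ∀ c ∈ J, M ≤ σ.colNorm c

/-- The path is stopped when a column outside `J` first reaches norm `M`. Before that, no band of
`J` wins and their widths do not change; as these are thick, the columns of `J` are bounded by `N *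
M`. The last step at most doubles the bound, whence `2 * N`; the summand `C` covers stopping at time
zero. -/
theorem RPath.exists_bal (hG : SinkSet G) {x : switchSpace p₀} {s : ℕ → RState d}
    {a b : ℕ → Fin d} {r : ℕ → Bool} (hx : Generic p₀ G x) (h : RPath p₀ G x s a b r)
    (hx1 : tot x ≤ 1) {C M N : ℝ} (hC : 0 ≤ C) (hM : 0 < M) (hN : 1 ≤ N) {J : Finset (Fin d)} (hJ : J.Nonempty)
    (hn : Near C M J (s 0)) (hcr : CriticalOutside J (s 0).typ)
    (hthick : ∀ j ∈ J, 1 / (N * M) < (s 0).wd (crd x) j) :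
    ∃ n, Bal M (C + 2 * N) (J.card + 1) (s n) := by
  classical
  have hNM : 0 < N * M := by positivity
  have hmono : ∀ n, ∀ c ∈ J, M ≤ (s n).colNorm c := fun n c hc =>
    (hn.2 c hc).trans (h.colNorm_mono c (Nat.zero_le n))
  have hbal : ∀ n, (∀ c, (s n).colNorm c ≤ (C + 2 * N) * M) →
      (∃ c ∉ J, M ≤ (s n).colNorm c) → Bal M (C + 2 * N) (J.card + 1) (s n) := by
    rintro n h1 ⟨c, hc, hcM⟩
    refine ⟨h1, insert c J, (Finset.card_insert_of_notMem hc).ge, fun e he => ?_⟩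
    rcases Finset.mem_insert.1 he with rfl | he
    · exact hcM
    · exact hmono n e he
  -- A winner in `J` would add its large column to that of the critical band outside `J`, which is
  -- exactly the stopping event. Hence the winner lies outside `J` and, remaining critical,
  -- preserves the assumption for the next step.
  have hwin : ∀ n, CriticalOutside J (s n).typ → (¬ ∃ c ∉ J, M ≤ (s (n + 1)).colNorm c) →
      a n ∉ J := by
    intro n hcr hno ha
    have hb : b n ∉ J := by
      rcases (h.child n).1.criticalOutside_iff.1 hcr with h1 | h1
      · exact absurd ha h1
      · exact h1
    refine hno ⟨b n, hb, ?_⟩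
    rw [(h.child n).colNorm, if_pos rfl]
    have := hmono n _ ha
    have := (h.valid n).colNorm_nonneg (b n)
    linarith
  have hcrit : ∀ n, (∀ m ≤ n, ¬ ∃ c ∉ J, M ≤ (s m).colNorm c) → CriticalOutside J (s n).typ := by
    intro n hno
    induction n with
    | zero => exact hcr
    | succ n ih =>
      have h1 := hwin n (ih fun m hm => hno m (by omega)) (hno (n + 1) le_rfl)
      refine (h.child (n + 1)).1.criticalOutside_iff.2 ?_
      rcases (h.child n).1.winner_stays (h.child (n + 1)).1 with h2 | h2
      · exact Or.inl (h2 ▸ h1)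
      · exact Or.inr (h2 ▸ h1)
  have hex : ∃ n, ∃ c ∉ J, M ≤ (s n).colNorm c := by
    by_contra hno
    simp only [not_exists] at hno
    obtain ⟨j, hj⟩ := hJ
    obtain ⟨n, hn⟩ := (h.frequently_wins hG hx j).exists
    refine hwin n (hcrit n fun m _ h' => ?_) (fun h' => ?_) (hn ▸ hj)
    · obtain ⟨c, hc⟩ := h'
      exact hno m c hc
    · obtain ⟨c, hc⟩ := h'
      exact hno (n + 1) c hc
  obtain ⟨n, hn1, hn2⟩ : ∃ n, (∃ c ∉ J, M ≤ (s n).colNorm c) ∧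
      ∀ m < n, ¬ ∃ c ∉ J, M ≤ (s m).colNorm c :=
    ⟨Nat.find hex, Nat.find_spec hex, fun m hm => Nat.find_min hex hm⟩
  refine ⟨n, hbal n (fun c => ?_) hn1⟩
  rcases n with _ | n
  · have := hn.1 c
    nlinarith
  · have hwd : ∀ m ≤ n, ∀ j ∈ J, (s m).wd (crd x) j = (s 0).wd (crd x) j := by
      intro m hm j hj
      induction m with
      | zero => rfl
      | succ m ih =>
        have h1 := hwin m (hcrit m fun i hi => hn2 i (by omega)) (hn2 (m + 1) (by omega))
        rw [(h.child m).wd, Function.update_of_ne (by rintro rfl; exact h1 hj)]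
        exact ih (by omega)
    have hle : ∀ e, (s n).colNorm e ≤ N * M := by
      intro e
      by_cases he : e ∈ J
      · have h1 := (colNorm_mul_wd_le (h.valid n) (h.path.mem n) e).trans hx1
        rw [hwd n le_rfl e he] at h1
        have h2 := hthick e he
        have h3 : (s n).colNorm e * (1 / (N * M)) ≤ 1 :=
          (mul_le_mul_of_nonneg_left h2.le ((h.valid n).colNorm_nonneg e)).trans h1
        rwa [mul_one_div, div_le_one hNM] at h3
      · have h1 : ¬ M ≤ (s n).colNorm e := fun h' => hn2 n (by omega) ⟨e, he, h'⟩
        nlinarith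
    rw [(h.child n).colNorm]
    have h1 := hle c
    have h2 := hle (a n)
    have h3 : 0 ≤ C * M := by positivity
    split_ifs <;> linarith

/-- From a state with a critical band outside of `J`, the number of large columns grows with
probability bounded below. -/
theorem exists_measureReal_hits_bal_of_criticalOutside (hG : SinkSet G) {C : ℝ} (hC : 0 ≤ C) :
    ∃ C' ≥ 0, ∀ (J : Finset (Fin d)) (M : ℝ), J.Nonempty → 0 < M → ∀ σ, Valid p₀ G σ →
      Near C M J σ → CriticalOutside J σ.typ →
      1 / 2 * (coneMeasure p₀).real (cell p₀ σ) ≤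
        (coneMeasure p₀).real (hits (cell p₀) child (Bal M C' (J.card + 1)) σ) := by
  obtain ⟨B, hB, -, hB2⟩ := exists_test_vectors d
  have H := cellTree (p₀ := p₀) hG
  have hCB : 0 < (1 + C * B) ^ d := by positivity
  -- There are at most `d` thin sets, each a fraction at most `(1 + C * B) ^ d / N` of the cell;
  -- this choice makes their union at most half of it.
  obtain ⟨N, hN⟩ := exists_nat_ge (2 * d * (1 + C * B) ^ d + 1)
  have hN1 : (1 : ℝ) ≤ N := le_trans (by nlinarith [(Nat.cast_nonneg d : (0 : ℝ) ≤ d)]) hN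
  have hN0 : 0 < N := by
    have : (0 : ℝ) < N := by linarith
    exact_mod_cast this
  refine ⟨C + 2 * N, by positivity, fun J M hJ hM σ hσ hn hcr => ?_⟩
  let D : Fin d → Set (switchSpace p₀) := fun j =>
    {x | x ∈ cell p₀ σ ∧ σ.wd (crd x) j ≤ 1 / (N * M)}
  set m := (coneMeasure p₀).real (cell p₀ σ) with hm
  have hm0 : 0 ≤ m := measureReal_nonneg
  have hD : ∀ j, (coneMeasure p₀).real (D j) ≤ (1 + C * B) ^ d * m / N := by
    intro j
    obtain ⟨v, hv0, hv, hvj, hvB⟩ := hB2 σ.typ j (hG.recurrent _ hσ.mem)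
    have := measureReal_thin_le hσ hM hC hn.1 hv0 hv hvj hvB hN0
    rw [le_div_iff₀' (by positivity)]
    exact this
  have h1 : (coneMeasure p₀).real (⋃ j ∈ J, D j) ≤ 1 / 2 * m := by
    calc (coneMeasure p₀).real (⋃ j ∈ J, D j) ≤ ∑ j ∈ J, (coneMeasure p₀).real (D j) :=
          measureReal_biUnion_finset_le _ _
      _ ≤ ∑ j ∈ J, (1 + C * B) ^ d * m / N := Finset.sum_le_sum fun j _ => hD j
      _ = J.card * ((1 + C * B) ^ d * m / N) := by rw [Finset.sum_const, nsmul_eq_mul]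
      _ ≤ d * ((1 + C * B) ^ d * m / N) := by
          gcongr
          simpa using Finset.card_le_univ J
      _ ≤ 1 / 2 * m := by
          rw [← mul_div_assoc, div_le_iff₀ (by positivity)]
          nlinarith
  have h2 : ∀ᵐ x ∂coneMeasure p₀, x ∈ cell p₀ σ → x ∈
      (⋃ j ∈ J, D j) ∪ hits (cell p₀) child (Bal M (C + 2 * N) (J.card + 1)) σ := by
    filter_upwards [ae_coneMeasure (ae_generic (p₀ := p₀) hG),
      ae_restrict_mem measurableSet_unitCone] with x hx hx1 hxσ
    by_cases hxD : x ∈ ⋃ j ∈ J, D j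
    · exact Or.inl hxD
    · refine Or.inr ?_
      obtain ⟨s, a, b, r, rfl, h⟩ := hx.exists_rPath hG hσ hxσ
      obtain ⟨n, hbal⟩ := h.exists_bal hG hx hx1.2 hC hM hN1 hJ hn hcr fun j hj => by
        by_contra hle
        exact hxD (Set.mem_biUnion hj ⟨hxσ, not_lt.1 hle⟩)
      exact h.path.mem_hits hbal
  have h3 : m ≤ (coneMeasure p₀).real
      ((⋃ j ∈ J, D j) ∪ hits (cell p₀) child (Bal M (C + 2 * N) (J.card + 1)) σ) :=
    ENNReal.toReal_mono (measure_ne_top _ _) (measure_mono_ae h2)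
  have h4 := h3.trans (measureReal_union_le _ _)
  linarith

theorem Bal.mono {M C C' : ℝ} {k : ℕ} (hM : 0 ≤ M) (hC : C ≤ C') (h : Bal M C k σ) : Bal M C' k σ :=
  ⟨fun c => (h.1 c).trans (mul_le_mul_of_nonneg_right hC hM), h.2⟩

/-- The two stages are composed: first a critical band outside `J` is produced, then a new large
column. The lower bounds multiply by `CellTree.mul_measureReal_hits_le`. -/
theorem exists_measureReal_hits_bal_succ (hG : SinkSet G) {k : ℕ} (hk : 0 < k) (hkd : k < d) {C : ℝ}
    (hC : 0 ≤ C) : ∃ ε > 0, ∃ C' ≥ 0, ∀ M : ℝ, 0 < M → ∀ σ, Valid p₀ G σ → Bal M C k σ →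
      ε * (coneMeasure p₀).real (cell p₀ σ) ≤
        (coneMeasure p₀).real (hits (cell p₀) child (Bal M C' (k + 1)) σ) := by
  have H := cellTree (p₀ := p₀) hG
  obtain ⟨L, hL⟩ := exists_escape_bound hG
  obtain ⟨ε, hε, C₁, hC₁, h1⟩ := exists_measureReal_hits_criticalOutside (p₀ := p₀) hG L hC
  obtain ⟨C₂, hC₂, h2⟩ := exists_measureReal_hits_bal_of_criticalOutside (p₀ := p₀) hG hC₁
  refine ⟨min 1 (1 / 2 * ε), by positivity, max C C₂, le_max_of_le_left hC,
    fun M hM σ hσ hb => ?_⟩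
  obtain ⟨hb1, J, hJk, hJ⟩ := hb
  -- No column remains to be enlarged, but then all `d ≥ k + 1` columns are already large.
  by_cases hJu : J = Finset.univ
  · have hb : Bal M (max C C₂) (k + 1) σ :=
      ⟨fun c => (hb1 c).trans (mul_le_mul_of_nonneg_right (le_max_left _ _) hM.le), J, by
        simp [hJu]; omega, hJ⟩
    rw [hits_of_mem hb]
    exact mul_le_of_le_one_left measureReal_nonneg (min_le_left _ _)
  · have hJ0 : J.Nonempty := Finset.card_pos.1 (by omega)
    have e1 := h1 J M hM σ hσ (hL _ hσ.mem J hJu) ⟨hb1, hJ⟩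
    have e2 := H.mul_measureReal_hits_le (ε := 1 / 2) (by norm_num)
      (T₁ := fun τ => Near C₁ M J τ ∧ CriticalOutside J τ.typ)
      (T₂ := Bal M C₂ (J.card + 1)) (fun τ hτ hT => h2 J M hJ0 hM τ hτ hT.1 hT.2) hσ
    have e3 := H.mul_measureReal_hits_le (ε := 1) zero_le_one
      (T₁ := Bal M C₂ (J.card + 1)) (T₂ := Bal M (max C C₂) (k + 1)) (fun τ hτ hT => by
        have hT' : Bal M (max C C₂) (k + 1) τ := by
          obtain ⟨h3, J', h4, h5⟩ := hT.mono hM.le (le_max_right C C₂)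
          exact ⟨h3, J', by omega, h5⟩
        rw [hits_of_mem hT', one_mul]) hσ
    rw [one_mul] at e3
    have e4 : min 1 (1 / 2 * ε) * (coneMeasure p₀).real (cell p₀ σ) ≤
        1 / 2 * ε * (coneMeasure p₀).real (cell p₀ σ) :=
      mul_le_mul_of_nonneg_right (min_le_right _ _) measureReal_nonneg
    linarith

/-- The scale `M` may depend on the state, but ε and `C` may not. `M` is the largest column norm at
the start and is kept throughout the induction. -/
theorem exists_measureReal_hits_bal (hG : SinkSet G) {k : ℕ} (hk : 0 < k) (hkd : k ≤ d) :
    ∃ ε > 0, ∃ C ≥ 0, ∀ σ, Valid p₀ G σ → ∃ M > 0,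
      ε * (coneMeasure p₀).real (cell p₀ σ) ≤
        (coneMeasure p₀).real (hits (cell p₀) child (Bal M C k) σ) := by
  have H := cellTree (p₀ := p₀) hG
  induction k, hk using Nat.le_induction with
  | base =>
    refine ⟨1, one_pos, 1, zero_le_one, fun σ hσ => ?_⟩
    have : Nonempty (Fin d) := ⟨⟨0, hkd⟩⟩
    obtain ⟨c, hc⟩ := Finite.exists_max σ.colNorm
    refine ⟨σ.colNorm c, hσ.colNorm_pos c, ?_⟩
    have hb : Bal (σ.colNorm c) 1 (0 + 1) σ :=
      ⟨fun e => by rw [one_mul]; exact hc e, {c}, by simp, by simp⟩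
    rw [hits_of_mem hb, one_mul]
  | succ k hk ih =>
    obtain ⟨ε, hε, C, hC, h⟩ := ih (by omega)
    obtain ⟨ε', hε', C', hC', h'⟩ := exists_measureReal_hits_bal_succ (p₀ := p₀) hG hk
      (by omega) hC
    refine ⟨ε' * ε, by positivity, C', hC', fun σ hσ => ?_⟩
    obtain ⟨M, hM, h1⟩ := h σ hσ
    refine ⟨M, hM, ?_⟩
    have h2 := H.mul_measureReal_hits_le hε'.le (T₁ := Bal M C k) (T₂ := Bal M C' (k + 1))
      (fun τ hτ hT => h' M hM τ hτ hT) hσ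
    have h3 := mul_le_mul_of_nonneg_left h1 hε'.le
    linarith

/-- Almost every point has an expansion which is balanced infinitely often. -/
theorem exists_ae_frequently_bal (hG : SinkSet G) (hp₀ : p₀ ∈ G) (hd : 0 < d) : ∃ C : ℝ, 0 ≤ C ∧
    ∀ᵐ x ∂coneMeasure p₀, x ∈ cell p₀ (root p₀) → ∃ s a b r, s 0 = root p₀ ∧
      RPath p₀ G x s a b r ∧
      ∃ᶠ n in Filter.atTop, ∃ M > 0, ∀ c, M ≤ (s n).colNorm c ∧ (s n).colNorm c ≤ C * M := by
  have H := cellTree (p₀ := p₀) hG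
  obtain ⟨ε, hε, C, hC, h⟩ := exists_measureReal_hits_bal (p₀ := p₀) hG hd le_rfl
  refine ⟨C, hC, ?_⟩
  let T : RState d → Prop := fun τ => ∃ M > 0, Bal M C d τ
  have hT : ∀ τ, Valid p₀ G τ → min 1 ε * (coneMeasure p₀).real (cell p₀ τ) ≤
      (coneMeasure p₀).real (hits (cell p₀) child T τ) := by
    intro τ hτ
    obtain ⟨M, hM, h1⟩ := h τ hτ
    have h2 := H.mul_measureReal_hits_le (ε := 1) zero_le_one (T₁ := Bal M C d) (T₂ := T)
      (fun τ hτ hb => by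
        rw [hits_of_mem (show T τ from ⟨M, hM, hb⟩), one_mul]) hτ
    rw [one_mul] at h2
    exact (mul_le_mul_of_nonneg_right (min_le_right _ _) measureReal_nonneg).trans (h1.trans h2)
  -- Almost every point hits `T` from every one of the countably many states through which it may
  -- pass; restarting along its path gives infinitely many hits.
  have h1 : ∀ᵐ x ∂coneMeasure p₀, ∀ τ, Valid p₀ G τ → x ∈ cell p₀ τ →
      x ∈ hits (cell p₀) child T τ := by
    refine ae_all_iff.2 fun τ => ?_
    by_cases hτ : Valid p₀ G τ
    · have h2 := H.measure_diff_hits_eq_zero (by positivity) (min_le_left 1 ε) hT hτ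
      rw [ae_iff]
      refine measure_mono_null (fun x hx => ?_) h2
      simp only [Set.mem_ofPred_eq, Classical.not_imp] at hx
      exact hx.2
    · exact Filter.Eventually.of_forall fun x h' => absurd h' hτ
  filter_upwards [h1, ae_coneMeasure (ae_generic (p₀ := p₀) hG)] with x hx hxg hxr
  obtain ⟨s, a, b, r, hs, hp⟩ := hxg.exists_rPath hG (valid_root hp₀) hxr
  refine ⟨s, a, b, r, hs, hp, Filter.frequently_atTop.2 fun m => ?_⟩
  have h2 := hp.shift m
  obtain ⟨n, M, hM, hb, J, hJ, hJM⟩ := h2.path.exists_of_mem_hits H h2.valid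
    (hx _ (h2.valid 0) (h2.path.mem 0))
  refine ⟨m + n, Nat.le_add_right _ _, M, hM, fun c => ⟨hJM c ?_, hb c⟩⟩
  have : J = Finset.univ := by
    rw [← Finset.card_eq_iff_eq_univ]
    exact le_antisymm (Finset.card_le_univ J) (by simpa using hJ)
  rw [this]
  exact Finset.mem_univ c

/-! ### Sinks -/

theorem CombType.Recurrent.row_ne_nil {p : CombType d} (h : p.Recurrent) (hd : 0 < d) (r : Bool) :
    p.row r ≠ [] := by
  intro hr
  obtain ⟨w, hw0, hw⟩ := h
  rw [switchCondition_iff] at hw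
  have hne : (Finset.univ : Finset (Fin d)).Nonempty := ⟨⟨0, hd⟩, Finset.mem_univ _⟩
  have hsum : 0 < ∑ c, w c := Finset.sum_pos (fun c _ => hw0 c) hne
  cases r
  · have h1 : ∀ c, p.sgn c = 1 := by
      intro c
      have h2 := p.count_add_count true c
      rw [Bool.not_true, hr, List.count_nil, add_zero] at h2
      simp [sgn, show p.top.count c = 2 from h2]
    simp [h1] at hw
    linarith
  · have h1 : ∀ c, p.sgn c = -1 := by
      intro c
      have : p.top = [] := hr
      simp [sgn, this]
    simp [h1] at hw
    linarith

/-- The labelled types of a set of nodes of the reduced Rauzy diagram. -/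
def labelledTypes (G₀ : Set (RauzyNode d)) : Set (CombType d) :=
  {p | ∃ hp : p.NonClassical, rauzyNode p hp ∈ G₀}

/-- Every node of a sink has an arrow leaving it. Its target is recurrent, and undoing the step on
positive widths makes the winner strictly wider than the loser. The arrow belongs to some labelling
of the node, so the widths are relabelled by `π`. -/
theorem IsSink.sinkSet {G₀ : Set (RauzyNode d)} (h : IsSink G₀) (hd : 0 < d) :
    SinkSet (labelledTypes G₀) where
  complete := fun p ⟨hp, _⟩ => hp.2
  recurrent := fun p ⟨hp, _⟩ => hp.1
  split := by
    rintro p ⟨hp, hpG⟩ a b q hs hq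
    have hq' : q.NonClassical := ⟨hq, hp.2.split hs (hq.row_ne_nil hd)⟩
    exact ⟨hq', h.2 _ hpG _ ⟨p, q, hp, hq', a, b, rfl, rfl, hs⟩⟩
  exists_lt := by
    rintro p ⟨hp, hpG⟩
    obtain ⟨Q, ⟨p', q, hp', hq, a, b, hP, -, hs⟩⟩ : ∃ Q, RauzyArrow (rauzyNode p hp) Q := by
      rcases Relation.TransGen.head'_iff.1 (h.1 _ hpG _ hpG) with ⟨Q, hQ, -⟩
      exact ⟨Q, hQ⟩
    obtain ⟨π, ht, hb⟩ : SameUnlabelled p' p := Quotient.exact hP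
    have hrow : ∀ r, p.row r = (p'.row r).map π := by rintro (_ | _); exacts [hb, ht]
    have hsgn : ∀ c, p.sgn (π c) = p'.sgn c := by
      intro c
      simp only [sgn, ht, List.count_map_of_injective _ _ π.injective]
    obtain ⟨r, hs⟩ := split_iff.1 hs
    obtain ⟨w, hw0, hw⟩ := hq.1
    obtain ⟨h1, h2, -⟩ := hs.getLast?
    -- These are the widths before the step: the winner regains the width of the loser.
    let w' : Fin d → ℝ := fun c => w c + if c = a then w b else 0
    have hw' : ∀ c, 0 < w' c := by
      intro c
      have := hw0 c
      have := hw0 b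
      simp only [w']
      split_ifs <;> linarith
    refine ⟨r, π a, π b, fun c => w' (π.symm c), by simp [hrow, h1], by simp [hrow, h2],
      fun c => hw' _, ?_, ?_⟩
    · rw [switchCondition_iff] at hw ⊢
      rw [← Equiv.sum_comp π]
      simp only [hsgn, Equiv.symm_apply_apply]
      rw [← hw]
      simp only [hs.sgn_eq, w', Int.cast_add, add_mul, mul_add, Finset.sum_add_distrib]
      congr 1
      rw [Finset.sum_eq_single a, Finset.sum_eq_single b]
      · simp
      · intro c _ hc; simp [hc]
      · simp
      · intro c _ hc; simp [hc]
      · simp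
    · have := hw0 a
      simp only [Equiv.symm_apply_apply, w', if_neg hs.ne.symm, if_true]
      linarith

/-! ### From paths to expansions -/

/-- The expansion of `x` is infinite and `C`-distributed infinitely often. -/
def GoodPoint (p₀ : CombType d) (C : ℝ) (x : EuclideanSpace ℝ (Fin d)) : Prop :=
  ∃ s : ℕ → Stage d, IsExpansion p₀ x s ∧ ∃ᶠ n in Filter.atTop, (s n).IsCDistributed C

/-- Rauzy induction compares and subtracts widths homogeneously, so the matrices do not depend on
the scale. -/
theorem GoodPoint.smul {p₀ : CombType d} {C : ℝ} {x : EuclideanSpace ℝ (Fin d)}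
    (h : GoodPoint p₀ C x) {t : ℝ} (ht : 0 < t) : GoodPoint p₀ C (t • x) := by
  obtain ⟨s, ⟨h0, hs⟩, hC⟩ := h
  refine ⟨fun n => ⟨(s n).type, t • (s n).width, (s n).mat⟩, ⟨?_, fun n => ?_⟩, hC⟩
  · simp only [h0]
    rfl
  · obtain ⟨a, b, h1, h2, h3, h4⟩ := hs n
    refine ⟨a, b, ?_, h2, ?_, h4⟩
    · simpa using mul_lt_mul_of_pos_left h1 ht
    · simp only [h3]
      ext c
      by_cases hc : c = a
      · subst hc
        simp [mul_sub]
      · simp [hc]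

theorem RPath.goodPoint {p₀ : CombType d} {G : Set (CombType d)} {x : switchSpace p₀}
    {s : ℕ → RState d} {a b : ℕ → Fin d} {r : ℕ → Bool} (h : RPath p₀ G x s a b r)
    (h0 : s 0 = root p₀) {C C' : ℝ} (hC0 : 0 ≤ C) (hC : C < C')
    (hb : ∃ᶠ n in Filter.atTop, ∃ M > 0, ∀ c, M ≤ (s n).colNorm c ∧ (s n).colNorm c ≤ C * M) :
    GoodPoint p₀ C' x.1 := by
  have hl1 : ∀ n c, l1norm (((s n).mat.map (fun z : ℤ => (z : ℝ))).col c) = (s n).colNorm c := by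
    intro n c
    refine Finset.sum_congr rfl fun i _ => ?_
    rw [Matrix.col_apply, Matrix.map_apply, abs_of_nonneg]
    exact_mod_cast (h.valid n).nonneg i c
  refine ⟨fun n => ⟨(s n).typ, (s n).wd (crd x), (s n).mat.map fun z : ℤ => (z : ℝ)⟩,
    ⟨?_, fun n => ⟨a n, b n, h.lt n, split_iff.2 ⟨r n, (h.child n).1⟩, (h.child n).wd _, ?_⟩⟩, ?_⟩
  · simp only [h0, wd_root]
    congr 1
    simp [root]
  · ext i c
    simp only [Matrix.map_apply, (h.child n).mat_apply, mul_add, mul_one, Matrix.add_apply]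
    by_cases hc : c = b n
    · subst hc
      simp
    · simp [hc]
  · refine hb.mono ?_
    rintro n ⟨M, hM, hn⟩ i j
    simp only [hl1]
    have hi := hn i
    have hj := hn j
    have hi0 : 0 < (s n).colNorm i := hM.trans_le hi.1
    have hj0 : 0 < (s n).colNorm j := hM.trans_le hj.1
    have e1 : C * M ≤ C * (s n).colNorm i := mul_le_mul_of_nonneg_left hi.1 hC0
    have e2 : C * M ≤ C * (s n).colNorm j := mul_le_mul_of_nonneg_left hj.1 hC0
    have e3 : C * (s n).colNorm i < C' * (s n).colNorm i := mul_lt_mul_of_pos_right hC hi0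
    have e4 : C * (s n).colNorm j < C' * (s n).colNorm j := mul_lt_mul_of_pos_right hC hj0
    rw [div_lt_div_iff₀ (hC0.trans_lt hC) hj0, div_lt_iff₀ hj0]
    constructor <;> linarith

/-! ### The measure on the configuration space -/

theorem ae_goodPoint {p₀ : CombType d} {G : Set (CombType d)} (hG : SinkSet G) (hp₀ : p₀ ∈ G)
    (hd : 0 < d) : ∃ C : ℝ, 0 ≤ C ∧ ∀ C' > C, ∀ᵐ y : switchSpace p₀,
      y ∈ unitCone p₀ → GoodPoint p₀ C' y.1 := by
  obtain ⟨C, hC, h⟩ := exists_ae_frequently_bal hG hp₀ hd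
  refine ⟨C, hC, fun C' hC' => ?_⟩
  obtain ⟨w, hw0, hw⟩ := hG.recurrent p₀ hp₀
  have h1 : ∀ i, ∀ᵐ y : switchSpace p₀, crd y i ≠ 0 := by
    intro i
    have h2 := volume_functional_eq_zero (valid_root hp₀) (u := Pi.single i 1) hw
      (by simpa [Pi.single_apply] using (hw0 i).ne')
    rw [ae_iff]
    refine measure_mono_null (fun y hy => ?_) h2
    simp only [ne_eq, not_not, Set.mem_ofPred_eq] at hy
    simp [Pi.single_apply, wd_root, hy]
  filter_upwards [(ae_restrict_iff' measurableSet_unitCone).1 h, ae_all_iff.2 h1] with y hy hy1 hyc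
  obtain ⟨s, a, b, r, h0, hp, hb⟩ := hy hyc fun c => by
    rw [wd_root]
    exact (hyc.1 c).lt_of_ne (hy1 c).symm
  exact hp.goodPoint h0 hC hC' hb

/-- The sum of the coordinates as a linear form. -/
noncomputable def totLin (p : CombType d) : switchSpace p →ₗ[ℝ] ℝ where
  toFun := tot
  map_add' := tot_add
  map_smul' t x := tot_smul t x

/-- The orientation reversing band makes the switch form nonzero. Positive widths satisfying the
switch condition show that the total width does not vanish on its kernel. Each of the two forms
lowers the dimension by one. -/
theorem finrank_ker_totLin {p : CombType d} (hp : p.Recurrent) (hs : ∃ a, p.sgn a ≠ 0) :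
    Module.finrank ℝ (LinearMap.ker (totLin p)) = d - 2 := by
  obtain ⟨a, ha⟩ := hs
  have ha' : (p.sgn a : ℝ) ≠ 0 := by exact_mod_cast ha
  let f : EuclideanSpace ℝ (Fin d) →ₗ[ℝ] ℝ :=
    { toFun := fun x => ∑ c, (p.sgn c : ℝ) * x c
      map_add' := by intro x y; simp [mul_add, Finset.sum_add_distrib]
      map_smul' := by intro t x; simp [mul_left_comm _ t, ← Finset.mul_sum] }
  have hf : LinearMap.ker f = switchSpace p := rfl
  have hf1 : Function.Surjective f := by
    refine f.surjective fun h0 => ha' ?_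
    have := LinearMap.congr_fun h0 (EuclideanSpace.single a 1)
    simpa [f, PiLp.single_apply] using this
  have hg1 : Function.Surjective (totLin p) := by
    obtain ⟨w, hw0, hw⟩ := hp
    refine (totLin p).surjective fun h0 => ?_
    have h1 : tot (⟨WithLp.toLp 2 w, mem_switchSpace.2 hw⟩ : switchSpace p) = 0 :=
      LinearMap.congr_fun h0 _
    exact (Finset.sum_pos (fun c _ => hw0 c) ⟨a, Finset.mem_univ a⟩).ne' h1
  have e1 := f.finrank_range_add_finrank_ker
  have e2 := (totLin p).finrank_range_add_finrank_ker
  rw [LinearMap.range_eq_top.2 hf1, finrank_top, Module.finrank_self, hf] at e1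
  rw [LinearMap.range_eq_top.2 hg1, finrank_top, Module.finrank_self] at e2
  simp at e1
  omega

/-- Almost all points of some hyperplane parallel to the kernel of a linear form have a property
which holds almost everywhere. -/
theorem exists_ae_smul_add_ker {H : Type*} [NormedAddCommGroup H] [NormedSpace ℝ H]
    [FiniteDimensional ℝ H] [MeasurableSpace H] [BorelSpace H] (ν : Measure H) [ν.IsAddHaarMeasure]
    (f : H →ₗ[ℝ] ℝ) {u : H} (hu : f u = 1) (μ : Measure (LinearMap.ker f)) [μ.IsAddHaarMeasure]
    {P : H → Prop} (h : ∀ᵐ y ∂ν, P y) :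
    ∃ t ∈ Set.Ioo (0 : ℝ) 1, ∀ᵐ k ∂μ, P (t • (u + k.1)) := by
  let Ψ : ℝ × LinearMap.ker f →ₗ[ℝ] H :=
    (LinearMap.toSpanSingleton ℝ H u).coprod (LinearMap.ker f).subtype
  have hΨ : ∀ t k, Ψ (t, k) = t • u + k.1 := fun t k => rfl
  have hsurj : Function.Surjective Ψ := by
    intro y
    exact ⟨(f y, ⟨y - f y • u, by simp [hu]⟩), by simp [hΨ]⟩
  obtain ⟨N, hNs, hNm, hN0⟩ := exists_measurable_superset_of_null (ae_iff.1 h)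
  -- In the coordinates given by the value of the form and the kernel, Fubini makes almost every
  -- parallel hyperplane good.
  have h1 : ∀ᵐ z ∂(volume : Measure ℝ).prod μ, Ψ z ∈ Nᶜ :=
    (ae_comp_linearMap_mem_iff Ψ ((volume : Measure ℝ).prod μ) ν hsurj hNm.compl).2
      (measure_eq_zero_iff_ae_notMem.1 hN0)
  have h2 := Measure.ae_ae_of_ae_prod h1
  have h3 : ∃ᵐ t : ℝ, t ∈ Set.Ioo (0 : ℝ) 1 := by
    rw [frequently_ae_mem_iff]
    simp
  obtain ⟨t, ht01, ht⟩ := (h3.and_eventually h2).exists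
  refine ⟨t, ht01, ?_⟩
  -- Fubini controls the points `t • u + k`; replacing `k` by `t • k` preserves null sets and
  -- exhibits the slice as a multiple of the slice of height one.
  have h4 := Measure.addHaar_preimage_smul μ ht01.1.ne' {k | ¬ Ψ (t, k) ∈ Nᶜ}
  rw [ae_iff.1 ht, mul_zero] at h4
  rw [ae_iff]
  refine measure_mono_null (fun k hk => ?_) h4
  have h5 : Ψ (t, t • k) = t • (u + k.1) := by rw [hΨ, smul_add]; rfl
  simp only [Set.mem_preimage, Set.mem_ofPred_eq, h5, Set.mem_compl_iff, not_not]
  exact hNs hk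

/-- The map `k ↦ u + k` is an isometry from the kernel of the total width onto the affine slice of
total width one, so `(d - 2)`-dimensional Hausdorff measure there is a Haar measure on the kernel. A
good slice at height `t < 1` inside the unit cone is scaled back to height one by homogeneity. -/
theorem ae_configSpace_of_ae {p : CombType d} (hp : p.NonClassical) (hd : 0 < d)
    {P : EuclideanSpace ℝ (Fin d) → Prop} (hP : ∀ x (t : ℝ), 0 < t → P x → P (t • x))
    (h : ∀ᵐ y : switchSpace p, y ∈ unitCone p → P y.1) :
    ∀ᵐ x ∂((μHE[d - 2] : Measure (EuclideanSpace ℝ (Fin d))).restrict p.configSpace), P x := by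
  obtain ⟨a, ha⟩ := hp.2.exists_sgn_ne_zero hd
  have hrank := finrank_ker_totLin hp.1 ⟨a, ha⟩
  obtain ⟨w, hw0, hw⟩ := hp.1
  have hwt : 0 < ∑ c, w c := Finset.sum_pos (fun c _ => hw0 c) ⟨a, Finset.mem_univ a⟩
  obtain ⟨u, hu⟩ : ∃ u : switchSpace p, tot u = 1 := by
    let y : switchSpace p := ⟨WithLp.toLp 2 w, mem_switchSpace.2 hw⟩
    have hy : tot y = ∑ c, w c := rfl
    refine ⟨(tot y)⁻¹ • y, ?_⟩
    rw [tot_smul, hy, inv_mul_cancel₀ hwt.ne']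
  let K := LinearMap.ker (totLin p)
  let μ : Measure K := μHE[Module.finrank ℝ K]
  have hμ : μ.IsAddHaarMeasure := isAddHaarMeasure_euclideanHausdorffMeasure (E := K)
  have hμd : μ = μHE[d - 2] := by simp only [μ, K, hrank]
  obtain ⟨t, ⟨ht0, ht1⟩, ht⟩ := exists_ae_smul_add_ker volume (totLin p) (u := u) hu μ h
  let ι : K → EuclideanSpace ℝ (Fin d) := fun k => (u + k.1).1
  have hι : Isometry ι := by
    refine Isometry.of_dist_eq fun k k' => ?_
    simp only [ι, Submodule.coe_add, dist_add_left]
    rfl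
  have h4 : μHE[d - 2] (ι '' {k | ¬ (t • (u + k.1) ∈ unitCone p → P (t • (u + k.1)).1)}) = 0 := by
    rw [hι.euclideanHausdorffMeasure_image, ← hμd, ae_iff.1 ht]
  have hmeas : MeasurableSet p.configSpace := by
    refine IsClosed.measurableSet ?_
    simp only [configSpace, switchCondition_iff, Set.ofPred_and, Set.ofPred_forall]
    refine (isClosed_iInter fun i => isClosed_le continuous_const (by fun_prop)).inter
      ((isClosed_eq (by fun_prop) continuous_const).inter
        (isClosed_eq (by fun_prop) continuous_const))
  rw [ae_restrict_iff' hmeas, ae_iff]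
  refine measure_mono_null ?_ h4
  intro x hx
  simp only [Set.mem_ofPred_eq, Classical.not_imp] at hx
  obtain ⟨⟨hx0, hx1, hxs⟩, hxP⟩ := hx
  let y : switchSpace p := ⟨x, mem_switchSpace.2 hxs⟩
  have hy : tot y = 1 := hx1
  have hk : y - u ∈ K := by
    rw [LinearMap.mem_ker, map_sub]
    change tot y - tot u = 0
    rw [hu, hy, sub_self]
  refine ⟨⟨y - u, hk⟩, ?_, ?_⟩
  · simp only [Set.mem_ofPred_eq, add_sub_cancel, Classical.not_imp]
    refine ⟨⟨fun i => ?_, ?_⟩, fun hP' => hxP ?_⟩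
    · rw [crd_smul]
      exact mul_nonneg ht0.le (hx0 i)
    · rw [tot_smul, hy, mul_one]
      exact ht1.le
    · have := hP _ t⁻¹ (inv_pos.2 ht0) hP'
      rw [Submodule.coe_smul, smul_smul, inv_mul_cancel₀ ht0.ne', one_smul] at this
      exact this
  · simp [ι, y]

theorem mainTheorem6 (d : ℕ) :
    ∃ C : ℝ, 1 < C ∧
      ∀ (p₀ : CombType d) (hp₀ : p₀.NonClassical) (G₀ : Set (RauzyNode d)),
        IsSink G₀ → rauzyNode p₀ hp₀ ∈ G₀ →
        ∀ᵐ x ∂((μHE[d - 2] : Measure (EuclideanSpace ℝ (Fin d))).restrict p₀.configSpace),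
          ∃ s : ℕ → Stage d, IsExpansion p₀ x s ∧
            ∃ᶠ n in Filter.atTop, (s n).IsCDistributed C := by
  rcases Nat.eq_zero_or_pos d with rfl | hd
  · refine ⟨2, one_lt_two, fun p₀ hp₀ G₀ _ _ => ?_⟩
    -- An empty sum cannot be one.
    have : p₀.configSpace = ∅ := by
      ext x
      simp [configSpace]
    simp [this]
  -- The constants found so far depend on the type and on the sink. There are finitely many such
  -- pairs, so a maximum depends on `d` only; zero is the default for irrelevant pairs.
  have h : ∀ z : CombType d × Set (CombType d), ∃ C : ℝ, SinkSet z.2 → z.1 ∈ z.2 →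
      ∀ C' > C, ∀ᵐ y : switchSpace z.1, y ∈ unitCone z.1 → GoodPoint z.1 C' y.1 := by
    rintro ⟨p, G⟩
    by_cases hG : SinkSet G ∧ p ∈ G
    · obtain ⟨C, -, hC⟩ := ae_goodPoint hG.1 hG.2 hd
      exact ⟨C, fun _ _ => hC⟩
    · exact ⟨0, fun h1 h2 => absurd ⟨h1, h2⟩ hG⟩
  choose C hC using h
  obtain ⟨M, hM⟩ := Finite.exists_le C
  refine ⟨max M 1 + 1, by linarith [le_max_right M 1], fun p₀ hp₀ G₀ hG₀ hp => ?_⟩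
  exact ae_configSpace_of_ae hp₀ hd (P := GoodPoint p₀ (max M 1 + 1))
    (fun x t ht hx => hx.smul ht)
    (hC (p₀, labelledTypes G₀) (hG₀.sinkSet hd) ⟨hp₀, hp⟩ _
      (by linarith [le_max_left M 1, hM (p₀, labelledTypes G₀)]))
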